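/- Let $B\subset\mathbb{R}^3$ be the open unit ball, and for $n\ge 1$ let $e_n(x)=\frac{\sin(n\pi|x|)}{|x|}$ (with $e_n(0)=n\pi$) be the radial Dirichlet eigenfunctions of $-\Delta$ on $B$, so that $-\Delta e_n=\pi^2n^2e_n$. For $N\ge 1$ let $P_N$ be the orthogonal projection of $L^2(B;\mathbb{C})$ onto $\mathrm{span}(e_1,\dots,e_N)$. For $\phi\in L^2(B;\mathbb{C})$ let $u_N:\mathbb{R}\times B\to\mathbb{C}$ be the global solution, with values in the range of $P_N$, of the truncated equation $$ i\,\partial_tu+\Delta u-P_N(|u|^2u)=0,\qquad u|_{t=0}=P_N\phi . $$ Let $\mu_F^{(N)}$ be the law on $L^2(B;\mathbb{C})$ of $\sum_{n\le N}\frac{g_n}{n\pi}e_n$, where $g_1,\dots,g_N$ are independent normalized complex Gaussian random variables ($\mathbb{E}|g_n|^2=1$, with real and imaginary parts independent and $N(0,\tfrac12)$). Write $\langle x\rangle=(1+x^2)^{1/2}$ and $e(\theta)=e^{-i\pi^2\theta}$, so that $e^{it\Delta}e_n=e(n^2t)e_n$ and the functions $t\mapsto e(mt)$, $m\in\mathbb{Z}$,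 have the common period $2/\pi$. For $0<T<2/\pi$ and $f:[0,T)\times B\to\mathbb{C}$ put $$ \|f\|_{s,b}=\inf\Big(\sum_{n\ge 1,\,m\in\mathbb{Z}}\langle n\rangle^{2s}\langle n^2-m\rangle^{2b}|f_{n,m}|^2\Big)^{1/2}\in[0,\infty], $$ the infimum being over all representations $f(t,x)=\sum_{n\ge 1,\,m\in\mathbb{Z}}f_{n,m}e_n(x)e(mt)$ on $[0,T)\times B$, convergent unconditionally in $L^2([0,T)\times B)$ (the infimum is $\infty$ if there is no representation). Let $0\le s<\frac12$, $\frac12<b<\frac34$ and $0<T<2/\pi$. Then there are constants $C,c_1,c_2>0$, depending only on $s$, $b$ and $T$, such that for every integer $N\ge 1$ and every $\lambda>0$, $$ \mu_F^{(N)}\big(\{\phi:\ \|u_N\|_{s,b}>\lambda\}\big)\le C\exp(-c_1\lambda^{c_2}). $$ -/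

import Mathlib

open MeasureTheory ProbabilityTheory Filter Topology
open scoped ENNReal NNReal

namespace BallNLS

noncomputable section

/-- Three-dimensional Euclidean space. -/
abbrev E3 : Type := EuclideanSpace ℝ (Fin 3)

/-- The open unit ball `B` of `ℝ³`. -/
def unitBall : Set E3 := Metric.ball 0 1

/-- Lebesgue measure on `B`. -/
def ballMeasure : Measure E3 := volume.restrict unitBall

/-- The `n`-th radial Dirichlet eigenfunction `e_n(x) = sin(nπ|x|)/|x|` of `-Δ` on `B`,
with its continuous value `nπ` at the origin. -/
def eigenfunction (n : ℕ) (x : E3) : ℝ :=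
  (n * Real.pi) * Real.sinc (n * Real.pi * ‖x‖)

/-- Coefficient of `f` along `e_n`: `⟨f, e_n⟩ / ‖e_n‖²`, with the inner product of `L²(B)`. -/
def coeff (n : ℕ) (f : E3 → ℂ) : ℂ :=
  (∫ x, f x * (eigenfunction n x : ℂ) ∂ballMeasure) /
    ((∫ x, eigenfunction n x ^ 2 ∂ballMeasure : ℝ) : ℂ)

/-- The projection `P_N` onto the span of `e_1, …, e_N`. -/
def proj (N : ℕ) (f : E3 → ℂ) (x : E3) : ℂ :=
  ∑ n ∈ Finset.Icc 1 N, coeff n f * (eigenfunction n x : ℂ)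

/-- `u : ℝ × B → ℂ` is a global solution of the truncated equation
`i u_t + Δ u - P_N (|u|² u) = 0`, `u(0) = P_N φ`: it takes values in the range
of `P_N`, and the equation holds pointwise in `B`, at all times. -/
structure IsTruncatedSolution (N : ℕ) (φ : E3 → ℂ) (u : ℝ → E3 → ℂ) : Prop where
  mem_range : ∃ a : ℝ → ℕ → ℂ, ∀ t, ∀ x ∈ unitBall,
    u t x = ∑ n ∈ Finset.Icc 1 N, a t n * (eigenfunction n x : ℂ)
  initial : ∀ x ∈ unitBall, u 0 x = proj N φ x
  differentiable : ∀ t, ∀ x ∈ unitBall, DifferentiableAt ℝ (fun τ => u τ x) t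
  equation : ∀ t, ∀ x ∈ unitBall,
    Complex.I * deriv (fun τ => u τ x) t + Laplacian.laplacian (u t) x
      - proj N (fun y => (‖u t y‖ ^ 2 : ℝ) * u t y) x = 0

/-- The space `L²(B; ℂ)` of initial data. -/
abbrev L2Ball : Type := Lp ℂ 2 ballMeasure

/-- `L²(B; ℂ)` carries its Borel σ-algebra. -/
instance : MeasurableSpace L2Ball := borel _

instance : BorelSpace L2Ball := ⟨rfl⟩

instance : IsFiniteMeasure ballMeasure :=
  ⟨by simp [ballMeasure, unitBall]⟩

theorem continuous_eigenfunction (n : ℕ) : Continuous (eigenfunction n) := by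
  unfold eigenfunction
  exact continuous_const.mul (Real.continuous_sinc.comp (by fun_prop))

theorem memLp_eigenfunction (n : ℕ) :
    MemLp (fun x => (eigenfunction n x : ℂ)) 2 ballMeasure := by
  refine MemLp.of_bound
    (Complex.continuous_ofReal.comp (continuous_eigenfunction n)).aestronglyMeasurable
    (n * Real.pi) (Eventually.of_forall fun x => ?_)
  have h := Real.abs_sinc_le_one (n * Real.pi * ‖x‖)
  have hn : (0 : ℝ) ≤ n * Real.pi := by positivity
  rw [Complex.norm_real, Real.norm_eq_abs, eigenfunction, abs_mul, abs_of_nonneg hn]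
  exact mul_le_of_le_one_right hn h

/-- `e_n` as an element of `L²(B; ℂ)`. -/
def eigenL2 (n : ℕ) : L2Ball := (memLp_eigenfunction n).toLp _

/-- The law of a normalized complex Gaussian `g`: real and imaginary parts are independent
centred real Gaussians of variance `1/2`, so that `E|g|² = 1`. -/
def complexGaussian : Measure ℂ :=
  ((gaussianReal 0 (1 / 2)).prod (gaussianReal 0 (1 / 2))).map
    (fun p : ℝ × ℝ => (⟨p.1, p.2⟩ : ℂ))

/-- The free measure `μ_F^{(N)}` on `L²(B; ℂ)`: the law of `∑_{n ≤ N} (g_n / (nπ)) e_n` with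
independent normalized complex Gaussians `g_1, …, g_N` (the index `i : Fin N` is `n = i + 1`). -/
def freeMeasure (N : ℕ) : Measure L2Ball :=
  (Measure.pi fun _ : Fin N => complexGaussian).map
    (fun g => ∑ i : Fin N, (g i / (((i : ℕ) + 1) * Real.pi : ℂ)) • eigenL2 ((i : ℕ) + 1))

/-- The Japanese bracket `⟨x⟩ = (1 + x²)^{1/2}`. -/
def bracket (x : ℝ) : ℝ := Real.sqrt (1 + x ^ 2)

/-- The exponential `e(θ) = exp(-iπ²θ)`. As `-Δ e_n = π² n² e_n`, this is the normalization in
which `e^{itΔ} e_n = e(n² t) e_n`. The functions `t ↦ e(mt)`, `m ∈ ℤ`, have period `2/π`. -/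
def timeExp (θ : ℝ) : ℂ := Complex.exp (-(Complex.I * (Real.pi ^ 2 * θ : ℝ)))

/-- `f(t,x) = ∑_{n ≥ 1, m ∈ ℤ} F(n,m) e_n(x) e(mt)` on `[0,T) × B`, as an unconditionally
convergent series in `L²([0,T) × B)`. -/
def IsRepresentation (T : ℝ) (f : ℝ → E3 → ℂ) (F : ℕ+ × ℤ → ℂ) : Prop :=
  Tendsto
    (fun S : Finset (ℕ+ × ℤ) =>
      eLpNorm
        (fun p : ℝ × E3 => f p.1 p.2 -
          ∑ k ∈ S, F k * (eigenfunction (k.1 : ℕ) p.2 : ℂ) * timeExp (k.2 * p.1))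
        2 ((volume.restrict (Set.Ico 0 T)).prod ballMeasure))
    atTop (𝓝 0)

/-- The weighted `ℓ²` norm
`(∑_{n,m} ⟨n⟩^{2s} ⟨n² - m⟩^{2b} |F(n,m)|²)^{1/2} ∈ [0,∞]`. -/
def weightedNorm (s b : ℝ) (F : ℕ+ × ℤ → ℂ) : ℝ≥0∞ :=
  (∑' k : ℕ+ × ℤ, ENNReal.ofReal
    (bracket ((k.1 : ℕ) : ℝ) ^ (2 * s) *
      bracket (((k.1 : ℕ) : ℝ) ^ 2 - (k.2 : ℝ)) ^ (2 * b) * ‖F k‖ ^ 2)) ^ (1 / 2 : ℝ)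

/-- The norm `‖f‖_{s,b}` of `X^{s,b}([0,T))`: the infimum of the weighted norm over all
representations of `f` on `[0,T) × B` (it is `∞` when there is none of finite norm). -/
def xsbNorm (s b T : ℝ) (f : ℝ → E3 → ℂ) : ℝ≥0∞ :=
  ⨅ (F : ℕ+ × ℤ → ℂ) (_ : IsRepresentation T f F), weightedNorm s b F

end

end BallNLS

/-! Write u(t) = ∑ y_i(t) s_i with s_i = sin(ω_i r)/(ω_i r) and ω_i = (i+1)π. In these coordinates
the free measure is the law of N independent normalized complex Gaussians, with density π^{-N}
exp(-∑|y_i|²). The equation becomes the Hamiltonian system y_i' = -i ω_i² (y_i + 2Λ(|u|² u s_i))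
with Λ(F) = ∫₀¹ F r² dr, whose energy is E = ∑|y_i|² + V, V = Λ(|u|⁴). Energy is conserved and the
field is divergence free, so by Liouville's theorem the Gibbs measure π^{-N} e^{-E} dy = e^{-V} ·
(Gaussian law) is invariant (`exists_gibbs_preserving_flow`).

As V ≥ 0, Gibbs ≤ Gaussian. Hence every moment, under the Gibbs measure, of a functional of the
solution at time t is at most its Gaussian moment at time 0, with constants free of N. Conversely,
on {V ≤ K} the Gaussian law is at most e^K times the Gibbs measure, and {V > K} is rare
(`gaussianLaw_le_gibbs`).

The deterministic part (`exists_xsbNorm_sq_le`) bounds the squared norm by ∑ n^{2s-2}|y_i(0)|², n =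
i + 1, plus the time integral of a Besov-type functional of the cubic term r|u|²u. By Duhamel, the
modulated coefficient e(-n²t) y_i/ω_i has derivative -2i e(-n²t) times the n-th sine coefficient of
that cubic term. A periodic extension gains one power of the modulation ⟨n² - m⟩. What remains is a
sum over n and m of n^{2s}⟨n² + m⟩^{2b-2} times squared space-time coefficients. The factor n^{2s}
is absorbed by a bound on the sine coefficients uniform in n, and the modulation weight is summable
over n uniformly in m precisely because b < 3/4. Parseval in time finishes this part.

The probabilistic part (`exists_lintegral_pow_besov_le`) uses that r u(r) behaves like a Brownian
path: its variance is O(r) and that of its increments is O(h), uniformly in N. So the squared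
increments of the cubic term at scale h and position x are of size h^θ x^{-1-θ} times sixth powers
of Gaussians. The dyadic sum over h needs 2s < θ, the weighted integral over x needs θ < α, and the
Cauchy-Schwarz step behind the sine coefficient bound needs α < 1; these are compatible because s <
1/2.

Moments of order (6p)! give, at norm level λ, a Gibbs tail exp(-2κ λ^{1/3}). With K = κ λ^{1/3} the
loss e^K is absorbed, and the quartic tail of V at level K gives exp(-c λ^{1/12}). -/

namespace BallNLS

/-! ### Global flows of bounded Lipschitz fields and Liouville's theorem. -/

section Flow

variable {E : Type*} [NormedAddCommGroup E] [NormedSpace ℝ E]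

/-- `φ` is the global flow of the autonomous vector field `X`. -/
structure IsFlow (X : E → E) (φ : ℝ → E → E) : Prop where
  map_zero : ∀ x, φ 0 x = x
  hasDerivAt : ∀ t x, HasDerivAt (fun τ => φ τ x) (X (φ t x)) t

theorem IsFlow.eq_of_hasDerivAt {X : E → E} {φ : ℝ → E → E} {K : ℝ≥0} (hφ : IsFlow X φ)
    (hX : LipschitzWith K X) {y : ℝ → E} (hy : ∀ t, HasDerivAt y (X (y t)) t) (t : ℝ) :
    y t = φ t (y 0) := by
  have := ODE_solution_unique_univ (v := fun _ => X) (s := fun _ => Set.univ) (K := K)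
    (f := y) (g := fun t => φ t (y 0)) (t₀ := 0) (fun _ => hX.lipschitzOnWith)
    (fun t => ⟨hy t, trivial⟩) (fun t => ⟨hφ.hasDerivAt t _, trivial⟩) (hφ.map_zero _).symm
  exact congrFun this t

theorem IsFlow.map_add {X : E → E} {φ : ℝ → E → E} {K : ℝ≥0} (hφ : IsFlow X φ)
    (hX : LipschitzWith K X) (s t : ℝ) (x : E) : φ (s + t) x = φ s (φ t x) := by
  have h := hφ.eq_of_hasDerivAt hX (y := fun s => φ (s + t) x)
    (fun s => (hφ.hasDerivAt (s + t) x).comp_add_const s t) s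
  simpa using h

theorem IsFlow.neg {X : E → E} {φ : ℝ → E → E} (hφ : IsFlow X φ) :
    IsFlow (fun x => -X x) (fun t => φ (-t)) := by
  refine ⟨fun x => by simpa using hφ.map_zero x, fun t x => ?_⟩
  have h := (hφ.hasDerivAt (-t) x).scomp t (hasDerivAt_neg t)
  simpa [Function.comp_def] using h

theorem IsFlow.continuous {X : E → E} {φ : ℝ → E → E} (hφ : IsFlow X φ) (x : E) :
    Continuous (fun t => φ t x) :=
  continuous_iff_continuousAt.2 fun t => (hφ.hasDerivAt t x).continuousAt

theorem IsFlow.exists_lipschitzWith_of_nonneg {X : E → E} {φ : ℝ → E → E} {K : ℝ≥0}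
    (hφ : IsFlow X φ) (hX : LipschitzWith K X) {t : ℝ} (ht : 0 ≤ t) :
    ∃ C : ℝ≥0, LipschitzWith C (φ t) := by
  refine ⟨Real.toNNReal (Real.exp (K * t)), LipschitzWith.of_dist_le_mul fun x y => ?_⟩
  have h := dist_le_of_trajectories_ODE (v := fun _ => X) (K := K) (a := 0) (b := t)
    (f := fun t => φ t x) (g := fun t => φ t y) (δ := dist x y) (fun _ => hX)
    (hφ.continuous x).continuousOn (fun s _ => (hφ.hasDerivAt s x).hasDerivWithinAt)
    (hφ.continuous y).continuousOn (fun s _ => (hφ.hasDerivAt s y).hasDerivWithinAt)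
    (by simp [hφ.map_zero]) t ⟨ht, le_rfl⟩
  rw [Real.coe_toNNReal _ (Real.exp_pos _).le, mul_comm]
  simpa using h

theorem IsFlow.exists_lipschitzWith {X : E → E} {φ : ℝ → E → E} {K : ℝ≥0}
    (hφ : IsFlow X φ) (hX : LipschitzWith K X) (t : ℝ) :
    ∃ C : ℝ≥0, LipschitzWith C (φ t) := by
  rcases le_total 0 t with ht | ht
  · exact hφ.exists_lipschitzWith_of_nonneg hX ht
  · simpa using hφ.neg.exists_lipschitzWith_of_nonneg hX.neg (neg_nonneg.2 ht)

/-- A bounded Lipschitz vector field has a global flow. -/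
theorem exists_isFlow [CompleteSpace E] {X : E → E} {K L : ℝ≥0} (hX : LipschitzWith K X)
    (hL : ∀ x, ‖X x‖ ≤ L) : ∃ φ, IsFlow X φ := by
  -- Picard-Lindelöf applies on [-M, M] for every M: the field is bounded by L everywhere, so the
  -- closed ball of radius L·M about x is large enough.
  have key : ∀ (x : E) (M : ℝ≥0), ∃ α : ℝ → E, α 0 = x ∧
      ∀ t ∈ Set.Ioo (-M : ℝ) M, HasDerivAt α (X (α t)) t := by
    intro x M
    have h0 : (0 : ℝ) ∈ Set.Icc (-M : ℝ) M := by simp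
    have hPL : IsPicardLindelof (fun _ => X) (tmin := -M) (tmax := M) ⟨0, h0⟩ x (L * M) 0 L K :=
      IsPicardLindelof.of_time_independent (fun x _ => hL x) hX.lipschitzOnWith (by simp)
    obtain ⟨α, hα0, hα⟩ := hPL.exists_eq_forall_mem_Icc_hasDerivWithinAt (x := x) (by simp)
    exact ⟨α, hα0, fun t ht => (hα t (Set.Ioo_subset_Icc_self ht)).hasDerivAt
      (Icc_mem_nhds ht.1 ht.2)⟩
  choose α hα0 hα using key
  have huniq : ∀ x (M M' : ℝ≥0), M ≤ M' → Set.EqOn (α x M) (α x M') (Set.Ioo (-M : ℝ) M) := by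
    intro x M M' hM t ht
    have hMpos : (0 : ℝ) < M := by linarith [ht.1, ht.2]
    have hM' : (M : ℝ) ≤ M' := hM
    exact ODE_solution_unique_of_mem_Ioo (v := fun _ => X) (s := fun _ => Set.univ) (K := K)
      (fun _ _ => hX.lipschitzOnWith) (t₀ := 0) ⟨by linarith, hMpos⟩
      (fun t ht => ⟨hα x M t ht, trivial⟩)
      (fun t ht => ⟨hα x M' t ⟨by linarith [ht.1], by linarith [ht.2]⟩, trivial⟩)
      (by rw [hα0, hα0]) ht
  let φ : ℝ → E → E := fun t x => α x (Real.nnabs t + 1) t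
  refine ⟨φ, fun x => hα0 _ _, fun t x => ?_⟩
  -- The radius |τ| + 1 used in the definition varies with τ. For τ within 1 of t it stays below |t|
  -- + 2, so by uniqueness the single solution of radius |t| + 2 represents the flow near t and
  -- supplies the derivative.
  have hmem : t ∈ Set.Ioo (-(Real.nnabs t + 2 : ℝ≥0) : ℝ) (Real.nnabs t + 2 : ℝ≥0) := by
    have := abs_le.1 (le_refl |t|)
    simp only [NNReal.coe_add, Real.coe_nnabs, NNReal.coe_ofNat, Set.mem_Ioo]
    constructor <;> linarith
  have hev : (fun τ => φ τ x) =ᶠ[𝓝 t] α x (Real.nnabs t + 2) := by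
    filter_upwards [Metric.ball_mem_nhds t one_pos] with τ hτ
    have h1 : |τ| ≤ |t| + 1 := by
      have := abs_sub_abs_le_abs_sub τ t
      rw [Metric.mem_ball, Real.dist_eq] at hτ
      linarith
    have h2 := abs_le.1 (le_refl |τ|)
    refine huniq x _ _ ?_ ?_
    · rw [← NNReal.coe_le_coe]
      simp only [NNReal.coe_add, Real.coe_nnabs, NNReal.coe_ofNat, NNReal.coe_one]
      linarith
    · simp only [NNReal.coe_add, Real.coe_nnabs, NNReal.coe_one, Set.mem_Ioo]
      constructor <;> linarith
  have hval := hev.self_of_nhds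
  simp only at hval
  rw [hval]
  exact (hα x _ t hmem).congr_of_eventuallyEq hev

theorem IsFlow.lipschitzWith_time {X : E → E} {φ : ℝ → E → E} {L : ℝ≥0} (hφ : IsFlow X φ)
    (hL : ∀ x, ‖X x‖ ≤ L) (x : E) : LipschitzWith L (fun t => φ t x) := by
  refine lipschitzWith_of_nnnorm_deriv_le (fun t => (hφ.hasDerivAt t x).differentiableAt)
    fun t => ?_
  rw [(hφ.hasDerivAt t x).deriv]
  exact hL _

variable [MeasurableSpace E] [BorelSpace E]

theorem IsFlow.measurable_uncurry {X : E → E} {φ : ℝ → E → E} {K : ℝ≥0}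
    (hφ : IsFlow X φ) (hX : LipschitzWith K X) : Measurable (Function.uncurry φ) := by
  refine measurable_uncurry_of_continuous_of_measurable hφ.continuous fun t => ?_
  obtain ⟨C, hC⟩ := hφ.exists_lipschitzWith hX t
  exact hC.continuous.measurable

variable [FiniteDimensional ℝ E]

/-- Liouville's theorem, tested against Lipschitz functions. -/
theorem IsFlow.hasDerivAt_integral {ι : Type*} [Fintype ι] (b : Module.Basis ι ℝ E)
    (μ : Measure E) [μ.IsAddHaarMeasure] {X : E → E} {φ : ℝ → E → E} {K L : ℝ≥0}
    (hφ : IsFlow X φ) (hX : LipschitzWith K X) (hL : ∀ x, ‖X x‖ ≤ L)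
    {ρ : E → ℝ} (hρ : Continuous ρ) (hρi : Integrable ρ μ)
    (hsmooth : ContDiff ℝ 1 fun x => ρ x • X x)
    (hsupp : HasCompactSupport fun x => ρ x • X x)
    (hdiv : ∀ x, ∑ j, b.repr (fderiv ℝ (fun x => ρ x • X x) x (b j)) j = 0)
    {ψ : E → ℝ} {D M : ℝ≥0} (hψ : LipschitzWith D ψ) (hM : ∀ x, |ψ x| ≤ M) (t : ℝ) :
    HasDerivAt (fun t => ∫ x, ψ (φ t x) * ρ x ∂μ) 0 t := by
  obtain ⟨C, hC⟩ := hφ.exists_lipschitzWith hX t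
  -- The flow is only known to be Lipschitz in its initial point, so f is merely Lipschitz.
  -- Rademacher's theorem gives its derivative almost everywhere, and integration by parts is used
  -- for a Lipschitz function against a compactly supported Lipschitz one.
  set f : E → ℝ := fun x => ψ (φ t x) with hf
  have hfl : LipschitzWith (D * C) f := hψ.comp hC
  set Y : ι → E → ℝ := fun j x => b.repr (ρ x • X x) j with hY
  have hcoord : ∀ j, ∃ ℓ : E →L[ℝ] ℝ, ∀ x, ℓ x = b.repr x j := fun j =>
    ⟨LinearMap.toContinuousLinearMap (b.coord j), fun x => rfl⟩
  have hYs : ∀ j, ContDiff ℝ 1 (Y j) := fun j => by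
    obtain ⟨ℓ, hℓ⟩ := hcoord j
    have h : Y j = ℓ ∘ fun x => ρ x • X x := by
      funext x
      exact (hℓ _).symm
    rw [h]
    exact ℓ.contDiff.comp hsmooth
  have hYc : ∀ j, HasCompactSupport (Y j) := fun j => by
    obtain ⟨ℓ, hℓ⟩ := hcoord j
    have h : Y j = ℓ ∘ fun x => ρ x • X x := by
      funext x
      exact (hℓ _).symm
    rw [h]
    exact hsupp.comp_left (_root_.map_zero ℓ)
  have hYl : ∀ j, ∃ D, LipschitzWith D (Y j) := fun j =>
    ⟨_, (hYs j).lipschitzWith_of_hasCompactSupport (hYc j) (by simp) |>.choose_spec⟩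
  have hYd : ∀ j x v, lineDeriv ℝ (Y j) x v = b.repr (fderiv ℝ (fun x => ρ x • X x) x v) j := by
    intro j x v
    obtain ⟨ℓ, hℓ⟩ := hcoord j
    have h1 : DifferentiableAt ℝ (fun x => ρ x • X x) x :=
      (hsmooth.differentiable (by simp)).differentiableAt
    have h2 : HasFDerivAt (Y j) (ℓ.comp (fderiv ℝ (fun x => ρ x • X x) x)) x := by
      have h : Y j = ℓ ∘ fun x => ρ x • X x := by
        funext x
        exact (hℓ _).symm
      rw [h]
      exact ℓ.hasFDerivAt.comp x h1.hasFDerivAt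
    rw [h2.hasLineDerivAt v |>.lineDeriv, ContinuousLinearMap.comp_apply, hℓ]
  set F' : E → ℝ := fun x => ∑ j, lineDeriv ℝ f x (b j) * Y j x with hF'
  have hmain := hasDerivAt_integral_of_dominated_loc_of_lip (μ := μ) (𝕜 := ℝ)
    (F := fun τ x => ψ (φ τ x) * ρ x) (F' := F') (x₀ := t) (s := Set.univ)
    (bound := fun x => D * L * ρ x) univ_mem
    (Eventually.of_forall fun τ => by
      obtain ⟨C', hC'⟩ := hφ.exists_lipschitzWith hX τ
      exact ((hψ.continuous.comp hC'.continuous).mul hρ).aestronglyMeasurable)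
    (hρi.bdd_mul (c := M) hfl.continuous.aestronglyMeasurable (Eventually.of_forall fun x => hM _))
    (by
      refine Measurable.aestronglyMeasurable ?_
      refine Finset.measurable_sum _ fun j _ => ?_
      exact (measurable_lineDeriv hfl.continuous).mul (hYs j).continuous.measurable)
    (Eventually.of_forall fun x => by
      refine LipschitzOnWith.of_dist_le_mul fun τ _ τ' _ => ?_
      have h1 := (hψ.comp (hφ.lipschitzWith_time hL x)).dist_le_mul τ τ'
      simp only [Function.comp_apply, Real.dist_eq, NNReal.coe_mul] at h1 ⊢
      rw [← sub_mul, abs_mul, Real.coe_nnabs, abs_mul, abs_of_nonneg (by positivity : (0:ℝ) ≤ D * L)]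
      nlinarith [abs_nonneg (ρ x)])
    (hρi.const_mul _)
    (by
      filter_upwards [hfl.ae_differentiableAt (μ := μ)] with x hx
      -- By the group law ψ(φ_τ x) = f(φ_{τ-t} x), so the time derivative at t is the derivative of
      -- f at x along X(x). This turns transport in time into a space derivative of f.
      have h1 : HasDerivAt (fun τ => φ (τ - t) x) (X x) t := by
        have := (hφ.hasDerivAt (t - t) x).comp_sub_const t t
        simpa [hφ.map_zero] using this
      have h2 : HasDerivAt (fun τ => f (φ (τ - t) x)) (fderiv ℝ f x (X x)) t := by
        refine HasFDerivAt.comp_hasDerivAt_of_eq (l := f) (x := t) (y := x) hx.hasFDerivAt h1 ?_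
        simp [hφ.map_zero]
      have h3 : (fun τ => f (φ (τ - t) x)) = fun τ => ψ (φ τ x) := by
        funext τ
        simp only [hf]
        rw [← hφ.map_add hX]
        simp
      rw [h3] at h2
      have h4 : F' x = fderiv ℝ f x (X x) * ρ x := by
        have : fderiv ℝ f x (X x) * ρ x = fderiv ℝ f x (ρ x • X x) := by
          rw [map_smul, smul_eq_mul, mul_comm]
        rw [this]
        conv_rhs => rw [← b.sum_repr (ρ x • X x)]
        rw [map_sum]
        refine Finset.sum_congr rfl fun j _ => ?_
        rw [map_smul, smul_eq_mul, hx.lineDeriv_eq_fderiv, mul_comm]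
      rw [h4]
      exact h2.mul_const _)
  -- Integrating by parts coordinate by coordinate moves the derivatives from f to ρX, whose
  -- divergence is zero.
  have hzero : ∫ x, F' x ∂μ = 0 := by
    have hbm : ∀ j v, Integrable (fun x => lineDeriv ℝ (Y j) x v * f x) μ := by
      intro j v
      have hc : Continuous fun x => lineDeriv ℝ (Y j) x v := by
        have : (fun x => lineDeriv ℝ (Y j) x v) = fun x => fderiv ℝ (Y j) x v := by
          funext x
          exact ((hYs j).differentiable (by simp)).differentiableAt.lineDeriv_eq_fderiv
        rw [this]
        exact ((hYs j).continuous_fderiv (by simp)).clm_apply continuous_const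
      have hs : HasCompactSupport fun x => lineDeriv ℝ (Y j) x v := by
        have : (fun x => lineDeriv ℝ (Y j) x v) = fun x => fderiv ℝ (Y j) x v := by
          funext x
          exact ((hYs j).differentiable (by simp)).differentiableAt.lineDeriv_eq_fderiv
        rw [this]
        exact (hYc j).fderiv_apply (𝕜 := ℝ) v
      exact (hc.integrable_of_hasCompactSupport hs).mul_bdd (c := M)
        hfl.continuous.aestronglyMeasurable (Eventually.of_forall fun x => hM _)
    have hI : ∀ j, Integrable (fun x => lineDeriv ℝ f x (b j) * Y j x) μ := by
      intro j
      have h := hfl.memLp_lineDeriv (μ := μ) (b j)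
      have hYi := (hYs j).continuous.integrable_of_hasCompactSupport (μ := μ) (hYc j)
      exact hYi.bdd_mul (c := D * C * ‖b j‖) h.aestronglyMeasurable
        (Eventually.of_forall fun x => by
          simpa using norm_lineDeriv_le_of_lipschitz ℝ hfl (x₀ := x) (v := b j))
    simp only [hF']
    rw [integral_finsetSum _ fun j _ => hI j]
    have h1 : ∀ j, ∫ x, lineDeriv ℝ f x (b j) * Y j x ∂μ
        = ∫ x, lineDeriv ℝ (Y j) x (-b j) * f x ∂μ := by
      intro j
      obtain ⟨D', hD'⟩ := hYl j
      exact LipschitzWith.integral_lineDeriv_mul_eq hfl hD' (hYc j) _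
    simp_rw [h1]
    rw [← integral_finsetSum _ fun j _ => hbm j _]
    have h2 : ∀ x, ∑ j, lineDeriv ℝ (Y j) x (-b j) * f x = 0 := by
      intro x
      rw [← Finset.sum_mul]
      simp_rw [hYd]
      simp [Finset.sum_neg_distrib, hdiv x]
    simp [h2]
  rw [hzero] at hmain
  exact hmain.2

/-- **Liouville's theorem** for a weighted measure: if `div (ρ X) = 0` then the flow of `X`
preserves `ρ μ`. -/
theorem IsFlow.measurePreserving {ι : Type*} [Fintype ι] (b : Module.Basis ι ℝ E)
    (μ : Measure E) [μ.IsAddHaarMeasure] {X : E → E} {φ : ℝ → E → E} {K L : ℝ≥0}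
    (hφ : IsFlow X φ) (hX : LipschitzWith K X) (hL : ∀ x, ‖X x‖ ≤ L)
    {ρ : E → ℝ} (hρ : Continuous ρ) (hρ0 : ∀ x, 0 ≤ ρ x) (hρi : Integrable ρ μ)
    (hsmooth : ContDiff ℝ 1 fun x => ρ x • X x)
    (hsupp : HasCompactSupport fun x => ρ x • X x)
    (hdiv : ∀ x, ∑ j, b.repr (fderiv ℝ (fun x => ρ x • X x) x (b j)) j = 0) (t : ℝ) :
    MeasurePreserving (φ t) (μ.withDensity fun x => ENNReal.ofReal (ρ x))
      (μ.withDensity fun x => ENNReal.ofReal (ρ x)) := by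
  set ν := μ.withDensity fun x => ENNReal.ofReal (ρ x) with hν
  have hfin : IsFiniteMeasure ν := isFiniteMeasure_withDensity_ofReal hρi.2
  obtain ⟨C, hC⟩ := hφ.exists_lipschitzWith hX t
  have hm : Measurable (φ t) := hC.continuous.measurable
  have hdens : ∀ g : E → ℝ, ∫ x, g x ∂ν = ∫ x, g x * ρ x ∂μ := by
    intro g
    rw [hν, integral_withDensity_eq_integral_toReal_smul (by fun_prop)
      (Eventually.of_forall fun x => by simp)]
    refine integral_congr_ae (Eventually.of_forall fun x => ?_)
    simp [ENNReal.toReal_ofReal (hρ0 x), mul_comm]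
  have hinv : ∀ (ψ : E → ℝ) (D M : ℝ≥0), LipschitzWith D ψ → (∀ x, |ψ x| ≤ M) →
      ∫ x, ψ (φ t x) ∂ν = ∫ x, ψ x ∂ν := by
    intro ψ D M hψ hM
    rw [hdens (fun x => ψ (φ t x)), hdens]
    have hd := hφ.hasDerivAt_integral b μ hX hL hρ hρi hsmooth hsupp hdiv hψ hM
    have := is_const_of_deriv_eq_zero (fun t => (hd t).differentiableAt)
      (fun t => (hd t).deriv) t 0
    simpa [hφ.map_zero] using this
  refine ⟨hm, ?_⟩
  have : IsFiniteMeasure (ν.map (φ t)) := inferInstance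
  -- The real and imaginary parts of exp(iℓ) are bounded and Lipschitz, so they are admissible
  -- tests, and finite measures are determined by their characteristic functions.
  refine Measure.ext_of_charFunDual ?_
  ext ℓ
  rw [charFunDual_apply, charFunDual_apply, integral_map hm.aemeasurable (by fun_prop)]
  have hint : ∀ g : E → E, Continuous g →
      Integrable (fun x => Complex.exp (ℓ (g x) * Complex.I)) ν := by
    intro g hg
    refine Integrable.of_bound (C := 1) (by fun_prop) (Eventually.of_forall fun x => ?_)
    rw [Complex.norm_exp_ofReal_mul_I]
  have hcos : LipschitzWith ‖ℓ‖₊ fun x => Real.cos (ℓ x) := by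
    have h := Real.lipschitzWith_cos.comp ℓ.lipschitz
    rwa [one_mul] at h
  have hsin : LipschitzWith ‖ℓ‖₊ fun x => Real.sin (ℓ x) := by
    have h := Real.lipschitzWith_sin.comp ℓ.lipschitz
    rwa [one_mul] at h
  have hre : ∀ g : E → E, Continuous g → ∫ x, Complex.exp (ℓ (g x) * Complex.I) ∂ν
      = (∫ x, Real.cos (ℓ (g x)) ∂ν : ℝ) + (∫ x, Real.sin (ℓ (g x)) ∂ν : ℝ) * Complex.I := by
    intro g hg
    rw [← integral_re_add_im (hint g hg)]
    simp [Complex.exp_ofReal_mul_I_re, Complex.exp_ofReal_mul_I_im]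
  rw [hre _ hC.continuous, hre (fun x => x) continuous_id,
    hinv _ _ 1 hcos (fun x => by simpa using Real.abs_cos_le_one _),
    hinv _ _ 1 hsin (fun x => by simpa using Real.abs_sin_le_one _)]

end Flow

end BallNLS

namespace BallNLS

/-! ### The Hamiltonian field of the quartic energy: conservation and zero divergence. -/

section Hamiltonian

set_option linter.unusedSectionVars false

variable {ι : Type*} [Fintype ι]
  {A : Type*} [NormedCommRing A] [NormedAlgebra ℂ A] [StarRing A] [StarModule ℂ A]
  [ContinuousStar A]

/-- The linear combination `∑ gᵢ sᵢ`. -/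
noncomputable def field (s : ι → A) (g : ι → ℂ) : A := ∑ i, g i • s i

/-- The derivative `2 Λ(|f|² f sᵢ)` of the quartic potential, `f = ∑ gⱼ sⱼ`. -/
noncomputable def cubic (Λ : A →L[ℂ] ℂ) (s : ι → A) (g : ι → ℂ) (i : ι) : ℂ :=
  2 * Λ (field s g * field s g * star (field s g) * s i)

/-- The quartic potential `Λ(|f|⁴)`, `f = ∑ gⱼ sⱼ`. -/
noncomputable def potential (Λ : A →L[ℂ] ℂ) (s : ι → A) (g : ι → ℂ) : ℝ :=
  (Λ (field s g * field s g * star (field s g) * star (field s g))).re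

/-- The energy `∑ |gᵢ|² + Λ(|f|⁴)`. -/
noncomputable def energy (Λ : A →L[ℂ] ℂ) (s : ι → A) (g : ι → ℂ) : ℝ :=
  ∑ i, ((g i).re ^ 2 + (g i).im ^ 2) + potential Λ s g

/-- The Hamiltonian vector field `-i wᵢ (gᵢ + 2 Λ(|f|² f sᵢ))`. -/
noncomputable def hamField (Λ : A →L[ℂ] ℂ) (s : ι → A) (w : ι → ℝ) (g : ι → ℂ) (i : ι) : ℂ :=
  -Complex.I * w i * (g i + cubic Λ s g i)

theorem star_field {s : ι → A} (hs : ∀ i, star (s i) = s i) (g : ι → ℂ) :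
    star (field s g) = field s fun i => star (g i) := by
  simp [field, star_sum, star_smul, hs]

theorem contDiff_field (s : ι → A) : ContDiff ℝ ⊤ (field s) := by
  unfold field
  fun_prop

theorem contDiff_star_field {s : ι → A} (hs : ∀ i, star (s i) = s i) :
    ContDiff ℝ ⊤ fun g => star (field s g) := by
  simp_rw [star_field hs]
  refine (contDiff_field s).comp ?_
  refine contDiff_pi.2 fun i => ?_
  exact (starL' ℝ : ℂ ≃L[ℝ] ℂ).contDiff.comp (contDiff_apply ℝ ℂ i)

theorem contDiff_cubic (Λ : A →L[ℂ] ℂ) {s : ι → A} (hs : ∀ i, star (s i) = s i) (i : ι) :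
    ContDiff ℝ ⊤ fun g => cubic Λ s g i := by
  unfold cubic
  refine contDiff_const.mul ((Λ.restrictScalars ℝ).contDiff.comp ?_)
  exact (((contDiff_field s).mul (contDiff_field s)).mul (contDiff_star_field hs)).mul contDiff_const

theorem contDiff_energy (Λ : A →L[ℂ] ℂ) {s : ι → A} (hs : ∀ i, star (s i) = s i) :
    ContDiff ℝ ⊤ (energy Λ s) := by
  unfold energy potential
  refine ContDiff.add ?_ ?_
  · refine ContDiff.sum fun i _ => ?_
    exact ((Complex.reCLM.contDiff.comp (contDiff_apply ℝ ℂ i)).pow 2).add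
      ((Complex.imCLM.contDiff.comp (contDiff_apply ℝ ℂ i)).pow 2)
  · refine Complex.reCLM.contDiff.comp ((Λ.restrictScalars ℝ).contDiff.comp ?_)
    exact (((contDiff_field s).mul (contDiff_field s)).mul (contDiff_star_field hs)).mul
      (contDiff_star_field hs)

theorem contDiff_hamField (Λ : A →L[ℂ] ℂ) {s : ι → A} (hs : ∀ i, star (s i) = s i)
    (w : ι → ℝ) : ContDiff ℝ ⊤ (hamField Λ s w) := by
  refine contDiff_pi.2 fun i => ?_
  exact contDiff_const.mul ((contDiff_apply ℝ ℂ i).add (contDiff_cubic Λ hs i))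

theorem hasDerivAt_field_line (s : ι → A) (g v : ι → ℂ) :
    HasDerivAt (fun t : ℝ => field s (g + t • v)) (field s v) 0 := by
  have h : (fun t : ℝ => field s (g + t • v)) = fun t : ℝ => field s g + t • field s v := by
    funext t
    simp [field, add_smul, Finset.sum_add_distrib, Finset.smul_sum, mul_smul]
  rw [h]
  simpa using ((hasDerivAt_id (0 : ℝ)).smul_const (field s v)).const_add (field s g)

theorem hasDerivAt_star_field_line {s : ι → A} (hs : ∀ i, star (s i) = s i) (g v : ι → ℂ) :
    HasDerivAt (fun t : ℝ => star (field s (g + t • v))) (star (field s v)) 0 := by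
  have h := hasDerivAt_field_line s (fun i => star (g i)) (fun i => star (v i))
  rw [← star_field hs] at h
  convert h using 1
  funext t
  rw [star_field hs]
  congr 1
  funext i
  simp

theorem fderiv_cubic (Λ : A →L[ℂ] ℂ) {s : ι → A} (hs : ∀ i, star (s i) = s i)
    (g v : ι → ℂ) (i : ι) :
    fderiv ℝ (fun g => cubic Λ s g i) g v =
      2 * Λ ((2 * field s v * field s g * star (field s g)
        + field s g * field s g * star (field s v)) * s i) := by
  have hd : DifferentiableAt ℝ (fun g => cubic Λ s g i) g :=
    ((contDiff_cubic Λ hs i).differentiable (by simp)).differentiableAt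
  rw [← hd.lineDeriv_eq_fderiv]
  have h1 := hasDerivAt_field_line s g v
  have h2 := hasDerivAt_star_field_line hs g v
  have h3 := (((h1.mul h1).mul h2).mul_const (s i))
  have h4 := ((Λ.restrictScalars ℝ).hasFDerivAt.comp_hasDerivAt (0 : ℝ) h3).const_mul (2 : ℂ)
  refine HasLineDerivAt.lineDeriv (HasDerivAt.congr_deriv h4 ?_)
  simp only [ContinuousLinearMap.coe_restrictScalars', zero_smul, add_zero, Pi.mul_apply]
  congr 2
  ring

/-- Half the gradient of the energy is g + `cubic`. Differentiating the quartic term gives two terms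
in the direction v and two in its conjugate; they are conjugate to each other because Λ commutes
with the involution, so the real part doubles. -/
theorem fderiv_energy (Λ : A →L[ℂ] ℂ) (hΛ : ∀ a, Λ (star a) = star (Λ a)) {s : ι → A}
    (hs : ∀ i, star (s i) = s i) (g v : ι → ℂ) :
    fderiv ℝ (energy Λ s) g v = 2 * ∑ i, (star (g i + cubic Λ s g i) * v i).re := by
  have hd : DifferentiableAt ℝ (energy Λ s) g :=
    ((contDiff_energy Λ hs).differentiable (by simp)).differentiableAt
  rw [← hd.lineDeriv_eq_fderiv]
  have h1 := hasDerivAt_field_line s g v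
  have h2 := hasDerivAt_star_field_line hs g v
  have h3 := (((h1.mul h1).mul h2).mul h2)
  have h4 := Complex.reCLM.hasFDerivAt.comp_hasDerivAt (0 : ℝ)
    ((Λ.restrictScalars ℝ).hasFDerivAt.comp_hasDerivAt (0 : ℝ) h3)
  have h5 : HasDerivAt (fun t : ℝ => ∑ i, (((g + t • v) i).re ^ 2 + ((g + t • v) i).im ^ 2))
      (∑ i, (2 * (g i).re * (v i).re + 2 * (g i).im * (v i).im)) 0 := by
    refine HasDerivAt.fun_sum fun i _ => ?_
    have hr : HasDerivAt (fun t : ℝ => ((g + t • v) i).re) (v i).re 0 := by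
      simpa using ((hasDerivAt_id (0 : ℝ)).mul_const (v i).re).const_add (g i).re
    have him : HasDerivAt (fun t : ℝ => ((g + t • v) i).im) (v i).im 0 := by
      simpa using ((hasDerivAt_id (0 : ℝ)).mul_const (v i).im).const_add (g i).im
    refine ((hr.pow 2).add (him.pow 2)).congr_deriv ?_
    simp
  refine HasLineDerivAt.lineDeriv (HasDerivAt.congr_deriv (h5.add h4) ?_)
  simp only [ContinuousLinearMap.coe_restrictScalars', zero_smul, add_zero, Pi.mul_apply,
    Complex.reCLM_apply]
  set f := field s g with hf
  set k := field s v with hk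
  have hL : Λ (f * f * star f * star k) = ∑ i, star (v i) * Λ (f * f * star f * s i) := by
    have hk' : star k = ∑ i, star (v i) • s i := star_field hs v
    rw [hk', Finset.mul_sum, map_sum]
    refine Finset.sum_congr rfl fun i _ => ?_
    rw [mul_smul_comm, map_smul, smul_eq_mul]
  have hconj : Λ (k * f * star f * star f) = star (Λ (f * f * star f * star k)) := by
    rw [← hΛ]
    congr 1
    simp only [star_mul', star_star]
    ring
  have e1 : ((k * f + f * k) * star f + f * f * star k) * star f + f * f * star f * star k
      = (2 : ℂ) • (k * f * star f * star f) + (2 : ℂ) • (f * f * star f * star k) := by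
    rw [two_smul, two_smul]
    ring
  rw [e1, map_add, map_smul, map_smul, hconj, hL]
  have e2 : ∀ z : ℂ, ((2 : ℂ) • star z + (2 : ℂ) • z).re = 4 * z.re := by
    intro z
    simp
    ring
  rw [e2, Complex.re_sum, Finset.mul_sum, Finset.mul_sum, ← Finset.sum_add_distrib]
  refine Finset.sum_congr rfl fun i _ => ?_
  simp only [cubic, ← hf, Complex.mul_re, Complex.mul_im, Complex.star_def, Complex.conj_re,
    Complex.conj_im, Complex.add_re, Complex.add_im, Complex.re_ofNat, Complex.im_ofNat]
  ring

/-- In each complex coordinate the field is -i times a real multiple of the gradient, hence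
orthogonal to it. -/
theorem fderiv_energy_hamField (Λ : A →L[ℂ] ℂ) (hΛ : ∀ a, Λ (star a) = star (Λ a)) {s : ι → A}
    (hs : ∀ i, star (s i) = s i) (w : ι → ℝ) (g : ι → ℂ) :
    fderiv ℝ (energy Λ s) g (hamField Λ s w g) = 0 := by
  rw [fderiv_energy Λ hΛ hs]
  refine mul_eq_zero_of_right _ (Finset.sum_eq_zero fun i _ => ?_)
  simp only [hamField, Complex.star_def, Complex.mul_re, Complex.mul_im, Complex.neg_re,
    Complex.neg_im, Complex.I_re, Complex.I_im, Complex.conj_re, Complex.conj_im,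
    Complex.ofReal_re, Complex.ofReal_im]
  ring

variable [DecidableEq ι]

theorem field_single (s : ι → A) (i : ι) (z : ℂ) : field s (Pi.single i z) = z • s i := by
  rw [field, Finset.sum_eq_single i]
  · simp
  · intro j _ hj
    simp [hj]
  · simp

/-- This is the equality of mixed second derivatives of the potential within one complex coordinate,
which makes the divergence vanish. Along z the derivative is a combination of z Λ(|f|² sᵢ²) and z̄
Λ(f² sᵢ²): the first Λ-value is real, and the second contributes equally to both sides. -/
theorem im_fderiv_cubic_single (Λ : A →L[ℂ] ℂ) (hΛ : ∀ a, Λ (star a) = star (Λ a)) {s : ι → A}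
    (hs : ∀ i, star (s i) = s i) (g : ι → ℂ) (i : ι) :
    (fderiv ℝ (fun g => cubic Λ s g i) g (Pi.single i 1)).im
      = (fderiv ℝ (fun g => cubic Λ s g i) g (Pi.single i Complex.I)).re := by
  rw [fderiv_cubic Λ hs, fderiv_cubic Λ hs, field_single, field_single]
  set f := field s g
  have hreal : (Λ (s i * f * star f * s i)).im = 0 := by
    have : star (Λ (s i * f * star f * s i)) = Λ (s i * f * star f * s i) := by
      rw [← hΛ]
      congr 1
      simp only [star_mul', star_star, hs]
      ring
    simpa using Complex.conj_eq_iff_im.1 this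
  have e : ∀ z : ℂ, Λ ((2 * (z • s i) * f * star f + f * f * star (z • s i)) * s i)
      = 2 * z * Λ (s i * f * star f * s i) + star z * Λ (f * f * s i * s i) := by
    intro z
    have : (2 * (z • s i) * f * star f + f * f * star (z • s i)) * s i
        = (2 * z) • (s i * f * star f * s i) + star z • (f * f * s i * s i) := by
      rw [star_smul, hs, mul_smul (2 : ℂ) z, two_smul]
      simp only [Algebra.smul_def]
      ring
    rw [this, map_add, map_smul, map_smul, smul_eq_mul, smul_eq_mul]
  rw [e, e]
  simp [hreal]

/-- The divergence is θ'(E) dE(X) + θ(E) div X, and both terms vanish. Each already vanishes on the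
pair of real coordinates of one complex mode, so the sum is grouped by modes and the real weights w
play no role. -/
theorem div_smul_hamField (Λ : A →L[ℂ] ℂ) (hΛ : ∀ a, Λ (star a) = star (Λ a)) {s : ι → A}
    (hs : ∀ i, star (s i) = s i) (w : ι → ℝ) {θ : ℝ → ℝ} (hθ : ContDiff ℝ 1 θ) (g : ι → ℂ) :
    ∑ j, (Pi.basis fun _ : ι => Complex.basisOneI).repr
      (fderiv ℝ (fun x => θ (energy Λ s x) • hamField Λ s w x) g
        ((Pi.basis fun _ : ι => Complex.basisOneI) j)) j = 0 := by
  have hE := ((contDiff_energy Λ hs).differentiable (by simp)).differentiableAt (x := g)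
  have hX := ((contDiff_hamField Λ hs w).differentiable (by simp)).differentiableAt (x := g)
  have hθd := (hθ.differentiable (by simp)).differentiableAt (x := energy Λ s g)
  have hθE := hθd.hasDerivAt.comp_hasFDerivAt g hE.hasFDerivAt
  have hfd := hθE.smul hX.hasFDerivAt
  have hfd' : fderiv ℝ (fun x => θ (energy Λ s x) • hamField Λ s w x) g = _ := hfd.fderiv
  rw [hfd', Fintype.sum_sigma]
  refine Finset.sum_eq_zero fun i _ => ?_
  have hXi : ∀ v, fderiv ℝ (hamField Λ s w) g v i
      = -Complex.I * w i * (v i + fderiv ℝ (fun g => cubic Λ s g i) g v) := by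
    intro v
    have h1 : HasFDerivAt (fun g => hamField Λ s w g i)
        ((ContinuousLinearMap.proj (R := ℝ) (φ := fun _ : ι => ℂ) i).comp
          (fderiv ℝ (hamField Λ s w) g)) g :=
      (ContinuousLinearMap.proj (R := ℝ) (φ := fun _ : ι => ℂ) i).hasFDerivAt.comp g
        hX.hasFDerivAt
    have hc := ((contDiff_cubic Λ hs i).differentiable (by simp)).differentiableAt (x := g)
    have h2 : HasFDerivAt (fun g => hamField Λ s w g i)
        ((-Complex.I * w i) • ((ContinuousLinearMap.proj (R := ℝ) (φ := fun _ : ι => ℂ) i) +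
          fderiv ℝ (fun g => cubic Λ s g i) g)) g :=
      ((ContinuousLinearMap.proj (R := ℝ) (φ := fun _ : ι => ℂ) i).hasFDerivAt.add
        hc.hasFDerivAt).const_mul _
    have := congrArg (fun L => L v) (h1.unique h2)
    rw [mul_add]
    simpa using this
  simp only [Pi.basis_apply, Pi.basis_repr, Fin.sum_univ_two,
    add_apply, smul_apply, Pi.add_apply, Pi.smul_apply,
    ContinuousLinearMap.smulRight_apply, hXi, fderiv_energy Λ hΛ hs, Function.comp_apply]
  have him := im_fderiv_cubic_single Λ hΛ hs g i
  have hsum : ∀ z : ℂ, ∑ j, (star (g j + cubic Λ s g j) * (Pi.single i z : ι → ℂ) j).re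
      = (star (g i + cubic Λ s g i) * z).re := by
    intro z
    rw [Finset.sum_eq_single i]
    · simp
    · intro j _ hj
      simp [hj]
    · simp
  simp only [Complex.coe_basisOneI, Matrix.cons_val_zero, Matrix.cons_val_one, hsum]
  simp [hamField, Complex.basisOneI] at *
  rw [him]
  ring

end Hamiltonian

end BallNLS

namespace BallNLS

/-! ### Cutting the Hamiltonian field off in energy. -/

section CutoffFlow

set_option linter.unusedSectionVars false

variable {ι : Type*} [Fintype ι]
  {A : Type*} [NormedCommRing A] [NormedAlgebra ℂ A] [StarRing A] [StarModule ℂ A]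
  [ContinuousStar A]

theorem sq_norm_le_energy {Λ : A →L[ℂ] ℂ} {s : ι → A} (hpos : ∀ g, 0 ≤ potential Λ s g)
    (g : ι → ℂ) : ∑ i, ‖g i‖ ^ 2 ≤ energy Λ s g := by
  have h : ∑ i, ‖g i‖ ^ 2 = ∑ i, ((g i).re ^ 2 + (g i).im ^ 2) := by
    refine Finset.sum_congr rfl fun i _ => ?_
    rw [← Complex.normSq_eq_norm_sq, Complex.normSq_apply]
    ring
  rw [h, energy]
  linarith [hpos g]

/-- The potential is nonnegative, so the energy dominates ∑|gᵢ|² and its sublevel sets are bounded: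
a cut-off in energy is a cut-off in space. -/
theorem hasCompactSupport_smul_hamField {Λ : A →L[ℂ] ℂ} {s : ι → A}
    (hpos : ∀ g, 0 ≤ potential Λ s g) (w : ι → ℝ) {θ : ℝ → ℝ} {R : ℝ}
    (hθ : ∀ e, R ≤ e → θ e = 0) :
    HasCompactSupport fun g => θ (energy Λ s g) • hamField Λ s w g := by
  refine HasCompactSupport.intro (isCompact_closedBall (0 : ι → ℂ) (Real.sqrt R)) fun g hg => ?_
  have hR : R ≤ energy Λ s g := by
    by_contra! hlt
    refine hg ?_
    rw [mem_closedBall_zero_iff, pi_norm_le_iff_of_nonneg (Real.sqrt_nonneg _)]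
    intro i
    refine Real.le_sqrt_of_sq_le ?_
    have h1 := Finset.single_le_sum (f := fun i => ‖g i‖ ^ 2) (fun i _ => by positivity)
      (Finset.mem_univ i)
    have h2 := sq_norm_le_energy hpos g
    linarith
  simp [hθ _ hR]

/-- Solutions of the Hamiltonian equation of energy at most `R` follow a flow which preserves
the Gibbs measure. -/
theorem exists_gibbs_preserving_flow (Λ : A →L[ℂ] ℂ) (hΛ : ∀ a, Λ (star a) = star (Λ a))
    {s : ι → A} (hs : ∀ i, star (s i) = s i) (hpos : ∀ g, 0 ≤ potential Λ s g) (w : ι → ℝ)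
    (hint : Integrable (fun g : ι → ℂ => Real.exp (-energy Λ s g))) (R : ℝ) :
    ∃ φ : ℝ → (ι → ℂ) → ι → ℂ, Measurable (Function.uncurry φ) ∧
      (∀ t, MeasurePreserving (φ t)
        (volume.withDensity fun g => ENNReal.ofReal (Real.exp (-energy Λ s g)))
        (volume.withDensity fun g => ENNReal.ofReal (Real.exp (-energy Λ s g)))) ∧
      ∀ y : ℝ → ι → ℂ, (∀ t, HasDerivAt y (hamField Λ s w (y t)) t) → energy Λ s (y 0) ≤ R →
        ∀ t, y t = φ t (y 0) := by
  classical
  -- χ is 1 up to R and 0 from R + 1 on. A factor depending on the energy alone keeps the divergence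
  -- zero, while the field becomes bounded and globally Lipschitz.
  set χ : ℝ → ℝ := fun e => Real.smoothTransition (R + 1 - e) with hχ
  have hχs : ContDiff ℝ 1 χ := Real.smoothTransition.contDiff.comp (contDiff_const.sub contDiff_id)
  have hχ0 : ∀ e, R + 1 ≤ e → χ e = 0 := fun e he =>
    Real.smoothTransition.zero_of_nonpos (by linarith)
  have hχ1 : ∀ e, e ≤ R → χ e = 1 := fun e he =>
    Real.smoothTransition.one_of_one_le (by linarith)
  have hE : ContDiff ℝ 1 (energy Λ s) := (contDiff_energy Λ hs).of_le le_top
  have hX : ContDiff ℝ 1 (hamField Λ s w) := (contDiff_hamField Λ hs w).of_le le_top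
  set X : (ι → ℂ) → ι → ℂ := fun g => χ (energy Λ s g) • hamField Λ s w g with hXdef
  have hXs : ContDiff ℝ 1 X := (hχs.comp hE).smul hX
  have hXc : HasCompactSupport X := hasCompactSupport_smul_hamField hpos w hχ0
  obtain ⟨K, hK⟩ := hXs.lipschitzWith_of_hasCompactSupport hXc (by simp)
  obtain ⟨L, hL⟩ := hXs.continuous.bounded_above_of_compact_support hXc
  have hL' : ∀ x, ‖X x‖ ≤ (Real.toNNReal L : ℝ≥0) := fun x =>
    (hL x).trans (Real.le_coe_toNNReal L)
  obtain ⟨φ, hφ⟩ := exists_isFlow hK hL'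
  refine ⟨φ, hφ.measurable_uncurry hK, fun t => ?_, fun y hy hR t => ?_⟩
  -- The Gibbs density times the cut-off field is again a function of the energy times the original
  -- field, so its divergence vanishes.
  · set θ : ℝ → ℝ := fun e => Real.exp (-e) * χ e with hθ
    have hθs : ContDiff ℝ 1 θ := (Real.contDiff_exp.comp contDiff_neg).mul hχs
    have heq : (fun g => Real.exp (-energy Λ s g) • X g)
        = fun g => θ (energy Λ s g) • hamField Λ s w g := by
      funext g
      rw [hXdef, smul_smul]
    have hρ : Continuous fun g => Real.exp (-energy Λ s g) :=
      Real.continuous_exp.comp hE.continuous.neg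
    refine hφ.measurePreserving (Pi.basis fun _ : ι => Complex.basisOneI) volume hK hL'
      hρ (fun x => (Real.exp_pos _).le) hint ?_ ?_ ?_ t
    · rw [heq]
      exact (hθs.comp hE).smul hX
    · rw [heq]
      exact hasCompactSupport_smul_hamField hpos w (R := R + 1) fun e he => by simp [hθ, hχ0 e he]
    · rw [heq]
      exact fun g => div_smul_hamField Λ hΛ hs w hθs g
  -- A genuine trajectory stays at its initial energy, at most R, where the cut-off equals 1; it
  -- therefore also solves the cut-off equation.
  · have hconst : ∀ t, energy Λ s (y t) = energy Λ s (y 0) := by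
      intro t
      have hd : ∀ t, HasDerivAt (fun t => energy Λ s (y t)) 0 t := by
        intro t
        have h := ((hE.differentiable (by simp)).differentiableAt (x := y t)).hasFDerivAt.comp_hasDerivAt
          t (hy t)
        rwa [fderiv_energy_hamField Λ hΛ hs] at h
      exact is_const_of_deriv_eq_zero (fun t => (hd t).differentiableAt)
        (fun t => (hd t).deriv) t 0
    refine hφ.eq_of_hasDerivAt hK (fun t => ?_) t
    have : X (y t) = hamField Λ s w (y t) := by
      simp only [hXdef]
      rw [hconst t, hχ1 _ hR, one_smul]
    rw [this]
    exact hy t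

end CutoffFlow

end BallNLS

namespace BallNLS

/-! ### The complex Gaussian law: density and moments of linear forms. -/

section Gaussian

instance : IsProbabilityMeasure complexGaussian := by
  have h : Measurable fun p : ℝ × ℝ => (⟨p.1, p.2⟩ : ℂ) :=
    Complex.measurableEquivRealProd.symm.measurable
  exact Measure.isProbabilityMeasure_map h.aemeasurable

/-- Variance 1/2 in each real direction makes the exponent exactly |z|², the quadratic part of the
energy; this is what makes the Gibbs density relative to the Gaussian law a function of the
potential only. -/
theorem complexGaussian_eq_withDensity :
    complexGaussian = (volume : Measure ℂ).withDensity
      fun z => ENNReal.ofReal (Real.pi⁻¹ * Real.exp (-‖z‖ ^ 2)) := by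
  have hv : (1 / 2 : ℝ≥0) ≠ 0 := by norm_num
  have hm : Measurable fun p : ℝ × ℝ => (⟨p.1, p.2⟩ : ℂ) :=
    Complex.measurableEquivRealProd.symm.measurable
  have hmp : MeasurePreserving (fun p : ℝ × ℝ => (⟨p.1, p.2⟩ : ℂ)) volume volume :=
    Complex.volume_preserving_equiv_real_prod.symm
  have hd : Measurable fun z : ℂ => ENNReal.ofReal (Real.pi⁻¹ * Real.exp (-‖z‖ ^ 2)) := by fun_prop
  unfold complexGaussian
  rw [gaussianReal_of_var_ne_zero _ hv,
    prod_withDensity (measurable_gaussianPDF _ _) (measurable_gaussianPDF _ _)]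
  ext S hS
  rw [Measure.map_apply hm hS, withDensity_apply _ (hm hS), withDensity_apply _ hS,
    ← hmp.setLIntegral_comp_preimage hS hd]
  refine setLIntegral_congr_fun (hm hS) fun p _ => ?_
  rw [gaussianPDF, gaussianPDF, ← ENNReal.ofReal_mul (gaussianPDFReal_nonneg _ _ _)]
  congr 1
  have h2 : ‖(⟨p.1, p.2⟩ : ℂ)‖ ^ 2 = p.1 ^ 2 + p.2 ^ 2 := by
    rw [← Complex.normSq_eq_norm_sq, Complex.normSq_apply]
    ring
  simp only [gaussianPDFReal, h2]
  have h3 : (2 * Real.pi * ((1 / 2 : ℝ≥0) : ℝ)) = Real.pi := by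
    push_cast
    ring
  have h4 : (2 * ((1 / 2 : ℝ≥0) : ℝ)) = 1 := by
    push_cast
    ring
  rw [h3, h4, neg_add, Real.exp_add]
  have h5 : (Real.sqrt Real.pi)⁻¹ * (Real.sqrt Real.pi)⁻¹ = Real.pi⁻¹ := by
    rw [← mul_inv, Real.mul_self_sqrt Real.pi_pos.le]
  simp only [sub_zero, div_one]
  rw [← h5]
  ring

/-- A product of measures with densities has the product density. -/
theorem pi_withDensity_ofReal {ι : Type*} [Fintype ι] {α : Type*} [MeasurableSpace α]
    (μ : Measure α) [SigmaFinite μ] {f : α → ℝ} (hf : Measurable f) (hf0 : ∀ x, 0 ≤ f x)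
    (hfi : Integrable f μ) :
    (Measure.pi fun _ : ι => μ.withDensity fun x => ENNReal.ofReal (f x)) =
      (Measure.pi fun _ : ι => μ).withDensity fun x => ENNReal.ofReal (∏ i, f (x i)) := by
  have : IsFiniteMeasure (μ.withDensity fun x => ENNReal.ofReal (f x)) :=
    isFiniteMeasure_withDensity_ofReal hfi.2
  symm
  refine (Measure.pi_eq fun S hS => ?_).symm
  have hSm : MeasurableSet (Set.univ.pi S) := MeasurableSet.univ_pi hS
  have hprod : Measurable fun x : ι → α => ∏ i, f (x i) :=
    Finset.measurable_prod _ fun i _ => hf.comp (measurable_pi_apply i)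
  have hint : ∀ i, Integrable ((S i).indicator f) μ := fun i => hfi.indicator (hS i)
  have hind : ∀ x : ι → α, (Set.univ.pi S).indicator (fun x => ∏ i, f (x i)) x
      = ∏ i, (S i).indicator f (x i) := by
    intro x
    by_cases hx : x ∈ Set.univ.pi S
    · rw [Set.indicator_of_mem hx]
      exact Finset.prod_congr rfl fun i _ =>
        (Set.indicator_of_mem (hx i (Set.mem_univ i)) f).symm
    · rw [Set.indicator_of_notMem hx]
      simp only [Set.mem_univ_pi, not_forall] at hx
      obtain ⟨i, hi⟩ := hx
      exact (Finset.prod_eq_zero (Finset.mem_univ i) (Set.indicator_of_notMem hi f)).symm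
  have hw : ∀ i, (μ.withDensity fun x => ENNReal.ofReal (f x)) (S i)
      = ENNReal.ofReal (∫ x, (S i).indicator f x ∂μ) := by
    intro i
    rw [withDensity_apply _ (hS i), integral_indicator (hS i),
      ofReal_integral_eq_lintegral_ofReal hfi.integrableOn
        (Eventually.of_forall hf0)]
  rw [withDensity_apply _ hSm, ← ofReal_integral_eq_lintegral_ofReal]
  · rw [← integral_indicator hSm]
    simp_rw [hind, hw]
    rw [integral_fintype_prod_eq_prod (fun i => (S i).indicator f), ENNReal.ofReal_prod_of_nonneg]
    exact fun i _ => integral_nonneg fun x => Set.indicator_nonneg (fun x _ => hf0 x) x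
  · exact (Integrable.fintype_prod fun _ => hfi).integrableOn
  · exact Eventually.of_forall fun x => Finset.prod_nonneg fun i _ => hf0 _

theorem integrable_exp_neg_sq_norm :
    Integrable fun z : ℂ => Real.pi⁻¹ * Real.exp (-‖z‖ ^ 2) := by
  have h : ∫⁻ z : ℂ, ENNReal.ofReal (Real.pi⁻¹ * Real.exp (-‖z‖ ^ 2)) = 1 := by
    have h := measure_univ (μ := complexGaussian)
    rwa [complexGaussian_eq_withDensity, withDensity_apply _ MeasurableSet.univ,
      Measure.restrict_univ] at h
  refine ⟨by fun_prop, ?_⟩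
  rw [hasFiniteIntegral_iff_ofReal (Eventually.of_forall fun z => by positivity), h]
  exact ENNReal.one_lt_top

/-- The law of `N` independent normalized complex Gaussians. -/
noncomputable def gaussianLaw (ι : Type*) [Fintype ι] : Measure (ι → ℂ) :=
  Measure.pi fun _ : ι => complexGaussian

instance (ι : Type*) [Fintype ι] : IsProbabilityMeasure (gaussianLaw ι) := by
  unfold gaussianLaw
  infer_instance

theorem gaussianLaw_eq_withDensity (ι : Type*) [Fintype ι] :
    gaussianLaw ι = volume.withDensity fun g : ι → ℂ =>
      ENNReal.ofReal (Real.pi⁻¹ ^ Fintype.card ι * Real.exp (-∑ i, ‖g i‖ ^ 2)) := by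
  unfold gaussianLaw
  rw [complexGaussian_eq_withDensity, pi_withDensity_ofReal volume (by fun_prop)
    (fun z => by positivity) integrable_exp_neg_sq_norm]
  congr 1
  funext g
  rw [Finset.prod_mul_distrib, Finset.prod_const, Finset.card_univ, ← Real.exp_sum,
    Finset.sum_neg_distrib]

theorem integrable_exp_neg_sum_sq_norm (ι : Type*) [Fintype ι] :
    Integrable fun g : ι → ℂ => Real.exp (-∑ i, ‖g i‖ ^ 2) := by
  have h : Integrable fun g : ι → ℂ => ∏ i, (Real.pi⁻¹ * Real.exp (-‖g i‖ ^ 2)) :=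
    Integrable.fintype_prod (μ := fun _ => volume) fun _ => integrable_exp_neg_sq_norm
  have h2 := h.const_mul (Real.pi ^ Fintype.card ι)
  refine h2.congr (Eventually.of_forall fun g => ?_)
  simp only
  rw [Finset.prod_mul_distrib, Finset.prod_const, Finset.card_univ, ← Real.exp_sum,
    Finset.sum_neg_distrib, ← mul_assoc, ← mul_pow, mul_inv_cancel₀ Real.pi_pos.ne', one_pow,
    one_mul]

theorem integral_exp_re_complexGaussian (c : ℝ) :
    ∫ z, Real.exp (c * z.re) ∂complexGaussian = Real.exp (c ^ 2 / 4) := by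
  have hm : Measurable fun p : ℝ × ℝ => (⟨p.1, p.2⟩ : ℂ) :=
    Complex.measurableEquivRealProd.symm.measurable
  unfold complexGaussian
  rw [integral_map hm.aemeasurable (by fun_prop)]
  simp only
  rw [integral_fun_fst (f := fun x => Real.exp (c * x))]
  have h := mgf_gaussianReal (p := gaussianReal 0 (1 / 2)) (X := id) (μ := 0) (v := 1 / 2)
    (by simp) c
  simp only [mgf, id] at h
  rw [h]
  simp
  ring

theorem integral_exp_im_complexGaussian (c : ℝ) :
    ∫ z, Real.exp (c * z.im) ∂complexGaussian = Real.exp (c ^ 2 / 4) := by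
  have hm : Measurable fun p : ℝ × ℝ => (⟨p.1, p.2⟩ : ℂ) :=
    Complex.measurableEquivRealProd.symm.measurable
  unfold complexGaussian
  rw [integral_map hm.aemeasurable (by fun_prop)]
  simp only
  rw [integral_fun_snd (f := fun x => Real.exp (c * x))]
  have h := mgf_gaussianReal (p := gaussianReal 0 (1 / 2)) (X := id) (μ := 0) (v := 1 / 2)
    (by simp) c
  simp only [mgf, id] at h
  rw [h]
  simp
  ring

theorem lintegral_exp_gaussianLaw {ι : Type*} [Fintype ι] (ℓ : ℂ → ℝ)
    (hmgf : ∀ c : ℝ, ∫ z, Real.exp (c * ℓ z) ∂complexGaussian = Real.exp (c ^ 2 / 4))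
    (β : ι → ℝ) :
    ∫⁻ g, ENNReal.ofReal (Real.exp (∑ i, β i * ℓ (g i))) ∂gaussianLaw ι
      = ENNReal.ofReal (Real.exp ((∑ i, β i ^ 2) / 4)) := by
  have hi : ∀ c : ℝ, Integrable (fun z => Real.exp (c * ℓ z)) complexGaussian := fun c => by
    by_contra h
    have := hmgf c
    rw [integral_undef h] at this
    exact (Real.exp_pos _).ne this
  unfold gaussianLaw
  simp_rw [Real.exp_sum]
  rw [← ofReal_integral_eq_lintegral_ofReal]
  · rw [integral_fintype_prod_eq_prod (fun i z => Real.exp (β i * ℓ z))]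
    simp_rw [hmgf]
    rw [← Real.exp_sum, Finset.sum_div]
  · exact Integrable.fintype_prod_dep (f := fun i z => Real.exp (β i * ℓ z)) fun i => hi _
  · exact Eventually.of_forall fun g => Finset.prod_nonneg fun i _ => (Real.exp_pos _).le

/-- Growth like q! is weaker than the true Gaussian growth but comes directly from the exponential
moment, and it suffices for some stretched exponential tail. -/
theorem lintegral_pow_abs_gaussianLaw_le {ι : Type*} [Fintype ι] (ℓ : ℂ → ℝ) (hℓ : Measurable ℓ)
    (hmgf : ∀ c : ℝ, ∫ z, Real.exp (c * ℓ z) ∂complexGaussian = Real.exp (c ^ 2 / 4))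
    (β : ι → ℝ) {σ : ℝ} (hσ : 0 < σ) (hβ : ∑ i, β i ^ 2 ≤ σ ^ 2) (q : ℕ) :
    ∫⁻ g, ENNReal.ofReal (|∑ i, β i * ℓ (g i)| ^ q) ∂gaussianLaw ι
      ≤ ENNReal.ofReal (4 * (q.factorial * σ ^ q)) := by
  -- From (|x|/σ)^q / q! ≤ e^{|x|/σ} ≤ e^{x/σ} + e^{-x/σ}. Each exponential has expectation at most
  -- e^{1/4} ≤ 2, whence the constant 4.
  have hpt : ∀ x : ℝ, |x| ^ q ≤ q.factorial * σ ^ q * (Real.exp (σ⁻¹ * x) + Real.exp (-σ⁻¹ * x)) := by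
    intro x
    have h1 := Real.pow_div_factorial_le_exp (σ⁻¹ * |x|) (by positivity) q
    have h2 : Real.exp (σ⁻¹ * |x|) ≤ Real.exp (σ⁻¹ * x) + Real.exp (-σ⁻¹ * x) := by
      rcases abs_cases x with ⟨h, _⟩ | ⟨h, _⟩
      · rw [h]
        linarith [Real.exp_pos (-σ⁻¹ * x)]
      · rw [h, mul_neg, ← neg_mul]
        linarith [Real.exp_pos (σ⁻¹ * x)]
    have hf : (0 : ℝ) < q.factorial := by exact_mod_cast q.factorial_pos
    calc |x| ^ q = q.factorial * σ ^ q * ((σ⁻¹ * |x|) ^ q / q.factorial) := by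
          rw [mul_pow, inv_pow]
          field_simp
      _ ≤ _ := by
          gcongr
          exact h1.trans h2
  have hexp : ∀ c : ℝ, c ^ 2 = (σ⁻¹) ^ 2 →
      ∫⁻ g, ENNReal.ofReal (Real.exp (c * ∑ i, β i * ℓ (g i))) ∂gaussianLaw ι ≤
        ENNReal.ofReal 2 := by
    intro c hc
    have h := lintegral_exp_gaussianLaw ℓ hmgf (fun i => c * β i)
    simp_rw [mul_assoc, ← Finset.mul_sum] at h
    rw [h]
    refine ENNReal.ofReal_le_ofReal ?_
    have h1 : ∑ i, (c * β i) ^ 2 ≤ 1 := by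
      simp_rw [mul_pow]
      rw [← Finset.mul_sum, hc, inv_pow]
      rw [inv_mul_le_iff₀ (by positivity)]
      simpa using hβ
    calc Real.exp ((∑ i, (c * β i) ^ 2) / 4) ≤ Real.exp (1 / 4) := by
          apply Real.exp_le_exp.2
          linarith
      _ ≤ 2 := by
          have h2 : Real.exp (1 / 4) ≤ Real.exp (Real.log 2) := by
            apply Real.exp_le_exp.2
            linarith [Real.log_two_gt_d9]
          rwa [Real.exp_log two_pos] at h2
  have hmeas : Measurable fun g : ι → ℂ => ∑ i, β i * ℓ (g i) :=
    Finset.measurable_sum _ fun i _ => (hℓ.comp (measurable_pi_apply i)).const_mul _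
  calc ∫⁻ g, ENNReal.ofReal (|∑ i, β i * ℓ (g i)| ^ q) ∂gaussianLaw ι
      ≤ ∫⁻ g, ENNReal.ofReal (q.factorial * σ ^ q) *
          (ENNReal.ofReal (Real.exp (σ⁻¹ * ∑ i, β i * ℓ (g i))) +
            ENNReal.ofReal (Real.exp (-σ⁻¹ * ∑ i, β i * ℓ (g i)))) ∂gaussianLaw ι := by
        refine lintegral_mono fun g => ?_
        rw [← ENNReal.ofReal_add (Real.exp_pos _).le (Real.exp_pos _).le,
          ← ENNReal.ofReal_mul (by positivity)]
        exact ENNReal.ofReal_le_ofReal (hpt _)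
    _ ≤ ENNReal.ofReal (q.factorial * σ ^ q) * (ENNReal.ofReal 2 + ENNReal.ofReal 2) := by
        rw [lintegral_const_mul _ (by fun_prop), lintegral_add_left (by fun_prop)]
        gcongr
        · exact hexp _ rfl
        · exact hexp _ (by ring)
    _ = ENNReal.ofReal (4 * (q.factorial * σ ^ q)) := by
        rw [← ENNReal.ofReal_add (by norm_num) (by norm_num), ← ENNReal.ofReal_mul (by positivity)]
        congr 1
        ring

/-- Moments of real linear combinations of independent complex Gaussians. -/
theorem lintegral_pow_norm_gaussianLaw_le {ι : Type*} [Fintype ι] (β : ι → ℝ) {σ : ℝ} (hσ : 0 < σ)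
    (hβ : ∑ i, β i ^ 2 ≤ σ ^ 2) (q : ℕ) :
    ∫⁻ g, ENNReal.ofReal (‖∑ i, g i * (β i : ℂ)‖ ^ q) ∂gaussianLaw ι
      ≤ ENNReal.ofReal (8 * (q.factorial * (2 * σ) ^ q)) := by
  have hpt : ∀ g : ι → ℂ, ‖∑ i, g i * (β i : ℂ)‖ ^ q
      ≤ 2 ^ q * (|∑ i, β i * (g i).re| ^ q + |∑ i, β i * (g i).im| ^ q) := by
    intro g
    have hre : (∑ i, g i * (β i : ℂ)).re = ∑ i, β i * (g i).re := by
      rw [Complex.re_sum]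
      exact Finset.sum_congr rfl fun i _ => by simp [mul_comm]
    have him : (∑ i, g i * (β i : ℂ)).im = ∑ i, β i * (g i).im := by
      rw [Complex.im_sum]
      exact Finset.sum_congr rfl fun i _ => by simp [mul_comm]
    rw [← hre, ← him]
    set z := ∑ i, g i * (β i : ℂ)
    have h1 := Complex.norm_le_abs_re_add_abs_im z
    have h2 : ‖z‖ ≤ 2 * max |z.re| |z.im| := by
      linarith [le_max_left |z.re| |z.im|, le_max_right |z.re| |z.im|]
    calc ‖z‖ ^ q ≤ (2 * max |z.re| |z.im|) ^ q := by gcongr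
      _ = 2 ^ q * (max |z.re| |z.im|) ^ q := mul_pow _ _ _
      _ ≤ _ := by
          gcongr
          rcases max_cases |z.re| |z.im| with ⟨h, _⟩ | ⟨h, _⟩ <;> rw [h]
          · linarith [pow_nonneg (abs_nonneg z.im) q]
          · linarith [pow_nonneg (abs_nonneg z.re) q]
  have hre := lintegral_pow_abs_gaussianLaw_le Complex.re Complex.measurable_re
    integral_exp_re_complexGaussian β hσ hβ q
  have him := lintegral_pow_abs_gaussianLaw_le Complex.im Complex.measurable_im
    integral_exp_im_complexGaussian β hσ hβ q
  calc ∫⁻ g, ENNReal.ofReal (‖∑ i, g i * (β i : ℂ)‖ ^ q) ∂gaussianLaw ι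
      ≤ ∫⁻ g, ENNReal.ofReal (2 ^ q) * (ENNReal.ofReal (|∑ i, β i * (g i).re| ^ q) +
          ENNReal.ofReal (|∑ i, β i * (g i).im| ^ q)) ∂gaussianLaw ι := by
        refine lintegral_mono fun g => ?_
        rw [← ENNReal.ofReal_add (by positivity) (by positivity),
          ← ENNReal.ofReal_mul (by positivity)]
        exact ENNReal.ofReal_le_ofReal (hpt _)
    _ ≤ ENNReal.ofReal (2 ^ q) * (ENNReal.ofReal (4 * (q.factorial * σ ^ q)) +
          ENNReal.ofReal (4 * (q.factorial * σ ^ q))) := by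
        rw [lintegral_const_mul _ (by fun_prop), lintegral_add_left (by fun_prop)]
        gcongr
    _ = ENNReal.ofReal (8 * (q.factorial * (2 * σ) ^ q)) := by
        rw [← ENNReal.ofReal_add (by positivity) (by positivity),
          ← ENNReal.ofReal_mul (by positivity), mul_pow]
        congr 1
        ring

end Gaussian

/-! ### From factorial moments to stretched exponential tails. -/

section Tail

/-- Factorial moment bounds give a stretched exponential tail. -/
theorem measure_lt_le_of_lintegral_pow_le {Ω : Type*} [MeasurableSpace Ω] (μ : Measure Ω)
    {k : ℕ} (hk : 0 < k) {A B : ℝ} (hA : 0 ≤ A) (hB : 0 < B) {F : Ω → ℝ≥0∞} (hF : Measurable F)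
    (hmom : ∀ p : ℕ, ∫⁻ x, F x ^ p ∂μ ≤ ENNReal.ofReal (A * B ^ p * (k * p).factorial))
    {τ : ℝ} (hτ : 0 < τ) :
    μ {x | ENNReal.ofReal τ < F x}
      ≤ ENNReal.ofReal (A * Real.exp 1 *
          Real.exp (-((τ / (Real.exp 1 * B)) ^ (1 / k : ℝ) / k))) := by
  set y : ℝ := (τ / (Real.exp 1 * B)) ^ (1 / k : ℝ) / k with hy
  have hk' : (0 : ℝ) < k := by exact_mod_cast hk
  have hbase : 0 < τ / (Real.exp 1 * B) := by positivity
  have hy0 : 0 ≤ y := by positivity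
  -- Chebyshev's inequality with the p-th moment. The choice of y gives (kp)^k ≤ τ/(eB), so (kp)!
  -- B^p τ^{-p} ≤ e^{-p}; rounding y down costs the factor e.
  set p : ℕ := ⌊y⌋₊ with hp
  have hpy : (p : ℝ) ≤ y := Nat.floor_le hy0
  have hyp : y < p + 1 := Nat.lt_floor_add_one y
  have hkp : ((k * p : ℕ) : ℝ) ^ k ≤ τ / (Real.exp 1 * B) := by
    have h1 : ((k * p : ℕ) : ℝ) ≤ (τ / (Real.exp 1 * B)) ^ (1 / k : ℝ) := by
      push_cast
      rw [hy, le_div_iff₀ hk'] at hpy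
      linarith
    calc ((k * p : ℕ) : ℝ) ^ k ≤ ((τ / (Real.exp 1 * B)) ^ (1 / k : ℝ)) ^ k := by gcongr
      _ = τ / (Real.exp 1 * B) := by
          rw [← Real.rpow_natCast, ← Real.rpow_mul hbase.le, one_div_mul_cancel hk'.ne',
            Real.rpow_one]
  have hfac : ((k * p).factorial : ℝ) ≤ (τ / (Real.exp 1 * B)) ^ p := by
    calc ((k * p).factorial : ℝ) ≤ ((k * p : ℕ) : ℝ) ^ (k * p) := by
          exact_mod_cast Nat.factorial_le_pow (k * p)
      _ = (((k * p : ℕ) : ℝ) ^ k) ^ p := by rw [pow_mul]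
      _ ≤ _ := by gcongr
  have hmark : μ {x | ENNReal.ofReal τ < F x} ≤ (∫⁻ x, F x ^ p ∂μ) / ENNReal.ofReal τ ^ p := by
    have hτp : ENNReal.ofReal τ ^ p ≠ 0 := pow_ne_zero _ (by simpa using hτ)
    refine le_trans (measure_mono ?_)
      (meas_ge_le_lintegral_div (hF.pow_const p).aemeasurable hτp (by simp))
    intro x hx
    exact pow_le_pow_left₀ zero_le (le_of_lt (Set.mem_ofPred_eq ▸ hx)) p
  refine hmark.trans ?_
  rw [← ENNReal.ofReal_pow hτ.le]
  refine (ENNReal.div_le_div_right (hmom p) _).trans ?_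
  rw [← ENNReal.ofReal_div_of_pos (by positivity)]
  refine ENNReal.ofReal_le_ofReal ?_
  rw [div_le_iff₀ (by positivity)]
  have he : Real.exp (-(p : ℝ)) ≤ Real.exp 1 * Real.exp (-y) := by
    rw [← Real.exp_add]
    exact Real.exp_le_exp.2 (by linarith)
  calc A * B ^ p * (k * p).factorial ≤ A * B ^ p * (τ / (Real.exp 1 * B)) ^ p := by gcongr
    _ = A * Real.exp (-(p : ℝ)) * τ ^ p := by
        have : Real.exp (-(p : ℝ)) = (Real.exp 1 ^ p)⁻¹ := by
          rw [← Real.exp_nat_mul, mul_one, Real.exp_neg]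
        rw [this, div_pow, mul_pow]
        field_simp
    _ ≤ A * (Real.exp 1 * Real.exp (-y)) * τ ^ p := by gcongr
    _ = _ := by ring

end Tail

end BallNLS

namespace BallNLS

/-! ### The weight ⟨n² - m⟩ and its summability over n. -/

section Bracket

theorem one_le_bracket (x : ℝ) : 1 ≤ bracket x := by
  unfold bracket
  rw [Real.one_le_sqrt]
  nlinarith [sq_nonneg x]

theorem bracket_pos (x : ℝ) : 0 < bracket x := one_pos.trans_le (one_le_bracket x)

theorem abs_le_bracket (x : ℝ) : |x| ≤ bracket x := by
  unfold bracket
  exact Real.abs_le_sqrt (by linarith)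

theorem bracket_sq (x : ℝ) : bracket x ^ 2 = 1 + x ^ 2 :=
  Real.sq_sqrt (by positivity)

theorem bracket_le_two_mul_abs {x : ℝ} (hx : 1 ≤ |x|) : bracket x ≤ 2 * |x| := by
  unfold bracket
  rw [Real.sqrt_le_left (by positivity)]
  nlinarith [sq_abs x]

theorem summable_int_bracket_rpow {p : ℝ} (hp : 1 < p) :
    Summable fun j : ℤ => bracket j ^ (-p) := by
  have h1 := (Real.summable_abs_int_rpow hp).add
    (summable_of_ne_finset_zero (s := {(0 : ℤ)}) (f := fun j : ℤ => if j = 0 then (1 : ℝ) else 0)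
      fun j hj => by
        simp only [Finset.mem_singleton] at hj
        simp [hj])
  refine Summable.of_nonneg_of_le (fun j => Real.rpow_nonneg (bracket_pos _).le _) (fun j => ?_) h1
  by_cases hj : j = 0
  · subst hj
    have : bracket ((0 : ℤ) : ℝ) ^ (-p) ≤ 1 :=
      Real.rpow_le_one_of_one_le_of_nonpos (one_le_bracket _) (by linarith)
    have h0 : (0 : ℝ) ≤ |((0 : ℤ) : ℝ)| ^ (-p) := by positivity
    simp only [if_true]
    linarith
  · have hpos : (0 : ℝ) < |(j : ℝ)| := abs_pos.2 (by exact_mod_cast hj)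
    simp only [hj, if_false, add_zero]
    exact Real.rpow_le_rpow_of_nonpos hpos (abs_le_bracket _) (by linarith)

/-- With y² = max(m, 0), |n² - y²| = |n - y|(n + y) ≥ |n - y|². Thus n² - m grows quadratically in
the distance from n to y, which is what allows exponents below 1 in the next sum. -/
theorem sq_sub_sqrt_le_abs (n : ℕ) (m : ℤ) :
    (n - Real.sqrt (max m 0)) ^ 2 ≤ |(n : ℝ) ^ 2 - m| := by
  set y := Real.sqrt (max m 0) with hy
  have hy0 : 0 ≤ y := Real.sqrt_nonneg _
  have hn0 : (0 : ℝ) ≤ n := n.cast_nonneg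
  have hy2 : y ^ 2 = max (m : ℝ) 0 := Real.sq_sqrt (le_max_right _ _)
  have h1 : |(n : ℝ) ^ 2 - y ^ 2| ≤ |(n : ℝ) ^ 2 - m| := by
    rw [hy2]
    rcases le_total (m : ℝ) 0 with h | h
    · rw [max_eq_right h, sub_zero, abs_of_nonneg (by positivity), abs_of_nonneg (by nlinarith)]
      linarith
    · rw [max_eq_left h]
  refine le_trans ?_ h1
  have h2 : (n : ℝ) ^ 2 - y ^ 2 = (n - y) * (n + y) := by ring
  rw [h2, abs_mul, ← sq_abs, pow_two]
  refine mul_le_mul_of_nonneg_left ?_ (abs_nonneg _)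
  rw [abs_of_nonneg (by positivity : 0 ≤ n + y), abs_le]
  constructor <;> linarith

/-- Uniform summability of `⟨n² - m⟩^{-β}` in `n`, for `β > 1/2`. -/
theorem exists_tsum_bracket_sq_sub_le {β : ℝ} (hβ : 1 / 2 < β) :
    ∃ C : ℝ, 0 < C ∧ ∀ m : ℤ,
      ∑' n : ℕ, ENNReal.ofReal (bracket ((n : ℝ) ^ 2 - m) ^ (-β)) ≤ ENNReal.ofReal C := by
  have hs := (summable_int_bracket_rpow (p := 2 * β) (by linarith)).mul_left ((16 : ℝ) ^ β)
  refine ⟨∑' j : ℤ, 16 ^ β * bracket j ^ (-(2 * β)) + 1,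
    add_pos_of_nonneg_of_pos (tsum_nonneg fun j => ?_) one_pos, fun m => ?_⟩
  · have := bracket_pos (j : ℝ)
    positivity
  set y := Real.sqrt (max m 0) with hy
  -- Up to the factor 16, ⟨n² - m⟩ dominates ⟨n - k⟩². The sum is therefore compared with ∑_j
  -- ⟨j⟩^{-2β} over all integers, which converges as 2β > 1 and no longer depends on m.
  set k : ℤ := ⌊y⌋ with hk
  have hle : ∀ n : ℕ, bracket ((n : ℝ) ^ 2 - m) ^ (-β)
      ≤ 16 ^ β * bracket (((n : ℤ) - k : ℤ) : ℝ) ^ (-(2 * β)) := by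
    intro n
    set z : ℝ := (((n : ℤ) - k : ℤ) : ℝ) with hz
    have hzy : |z| ≤ |n - y| + 1 := by
      have h1 : z = (n - y) + (y - k) := by
        rw [hz]
        push_cast
        ring
      have h2 : |y - k| ≤ 1 := by
        rw [abs_of_nonneg (by linarith [Int.floor_le y])]
        linarith [Int.lt_floor_add_one y]
      rw [h1]
      exact (abs_add_le _ _).trans (by linarith)
    have hb := sq_sub_sqrt_le_abs n m
    have hsq : bracket z ^ 2 ≤ 16 * bracket ((n : ℝ) ^ 2 - m) := by
      rw [bracket_sq]
      have h3 := one_le_bracket ((n : ℝ) ^ 2 - m)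
      have h4 := abs_le_bracket ((n : ℝ) ^ 2 - m)
      have h5 : z ^ 2 ≤ (|n - y| + 1) ^ 2 := by
        rw [← sq_abs z]
        gcongr
      have h6 : |n - y| ^ 2 ≤ |(n : ℝ) ^ 2 - m| := by
        rw [sq_abs]
        exact hb
      nlinarith [sq_nonneg (|n - y| - 1)]
    have hzpos := bracket_pos z
    have hbpos := bracket_pos ((n : ℝ) ^ 2 - m)
    calc bracket ((n : ℝ) ^ 2 - m) ^ (-β) ≤ (bracket z ^ 2 / 16) ^ (-β) := by
          refine Real.rpow_le_rpow_of_nonpos (by positivity) ?_ (by linarith)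
          linarith
      _ = 16 ^ β * bracket z ^ (-(2 * β)) := by
          rw [Real.div_rpow (by positivity) (by norm_num), ← Real.rpow_natCast,
            ← Real.rpow_mul hzpos.le, Real.rpow_neg (by norm_num : (0 : ℝ) ≤ 16), div_inv_eq_mul,
            mul_comm]
          congr 2
          push_cast
          ring
  calc ∑' n : ℕ, ENNReal.ofReal (bracket ((n : ℝ) ^ 2 - m) ^ (-β))
      ≤ ∑' n : ℕ, ENNReal.ofReal (16 ^ β * bracket (((n : ℤ) - k : ℤ) : ℝ) ^ (-(2 * β))) :=
        ENNReal.tsum_le_tsum fun n => ENNReal.ofReal_le_ofReal (hle n)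
    _ ≤ ∑' j : ℤ, ENNReal.ofReal (16 ^ β * bracket (j : ℝ) ^ (-(2 * β))) :=
        ENNReal.tsum_comp_le_tsum_of_injective (f := fun n : ℕ => (n : ℤ) - k)
          (fun a b h => by simpa using h)
          (fun j : ℤ => ENNReal.ofReal (16 ^ β * bracket (j : ℝ) ^ (-(2 * β))))
    _ = ENNReal.ofReal (∑' j : ℤ, 16 ^ β * bracket (j : ℝ) ^ (-(2 * β))) :=
        (ENNReal.ofReal_tsum_of_nonneg (fun j => by
          have := bracket_pos (j : ℝ)
          positivity) hs).symm
    _ ≤ _ := ENNReal.ofReal_le_ofReal (by linarith)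

end Bracket

/-! ### Cauchy-Schwarz in squared form, for extended nonnegative functions. -/

section CauchySchwarz

theorem lintegral_mul_sq_le {α : Type*} [MeasurableSpace α] (μ : Measure α) {f g : α → ℝ≥0∞}
    (hf : AEMeasurable f μ) (hg : AEMeasurable g μ) :
    (∫⁻ x, f x * g x ∂μ) ^ 2 ≤ (∫⁻ x, f x ^ 2 ∂μ) * ∫⁻ x, g x ^ 2 ∂μ := by
  have h := ENNReal.lintegral_mul_le_Lp_mul_Lq μ Real.HolderConjugate.two_two hf hg
  have h2 := pow_le_pow_left₀ zero_le h 2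
  refine h2.trans (le_of_eq ?_)
  rw [mul_pow, ← ENNReal.rpow_natCast, ← ENNReal.rpow_natCast, ← ENNReal.rpow_mul,
    ← ENNReal.rpow_mul]
  norm_num

theorem tsum_mul_sq_le {α : Type*} [Countable α] (f g : α → ℝ≥0∞) :
    (∑' x, f x * g x) ^ 2 ≤ (∑' x, f x ^ 2) * ∑' x, g x ^ 2 := by
  let _ : MeasurableSpace α := ⊤
  have h := lintegral_mul_sq_le (Measure.count : Measure α) (f := f) (g := g)
    (measurable_from_top).aemeasurable (measurable_from_top).aemeasurable
  simpa [lintegral_count] using h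

end CauchySchwarz

/-! ### Periodic extension in time with a gain of one modulation power. -/

section TimeExtension

open Complex in
/-- A primitive on `[0,T]` extends to a function of period `P > T` whose Fourier coefficients are
controlled by those of the derivative cut off to `[0,T)`. -/
theorem exists_periodic_extension {b P T : ℝ} (hb : 1 / 2 < b) (hb1 : b < 1) (hT0 : 0 < T)
    (hTP : T < P) :
    ∃ C : ℝ, 0 < C ∧ ∀ A γ : ℝ → ℂ, (∀ t, HasDerivAt A (γ t) t) → Continuous γ →
      ∃ G : ℤ → ℂ, Summable (fun j => ‖G j‖) ∧
        (∀ t ∈ Set.Ico 0 T, HasSum (fun j => G j * fourier j (t : AddCircle P)) (A t)) ∧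
        ∑' j : ℤ, ENNReal.ofReal (bracket j ^ (2 * b) * ‖G j‖ ^ 2) ≤
          ENNReal.ofReal C * (ENNReal.ofReal (‖A 0‖ ^ 2) +
            ∑' j : ℤ, ENNReal.ofReal (bracket j ^ (2 * b - 2) *
              ‖fourierCoeffOn (hT0.trans hTP) ((Set.Iio T).indicator γ) j‖ ^ 2)) := by
  have hP : 0 < P := hT0.trans hTP
  have hfact : Fact (0 < P) := ⟨hP⟩
  -- The extension returns linearly from A(T) to A(0) on [T, P]. Since A(T) - A(0) = P c₀, with c₀
  -- the mean of the truncated derivative, its slope is -M c₀.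
  set M : ℝ := P / (P - T) with hM
  have hM0 : 0 < M := div_pos hP (by linarith)
  set D : ℝ := (P / (2 * Real.pi)) ^ 2 * 8 * (1 + M ^ 2) with hD
  have hD0 : 0 < D := by positivity
  have hbs := summable_int_bracket_rpow (p := 2 * b) (by linarith)
  set B : ℝ := ∑' j : ℤ, bracket j ^ (-(2 * b)) with hB
  have hB0 : 0 ≤ B := tsum_nonneg fun j => Real.rpow_nonneg (bracket_pos _).le _
  refine ⟨D + 2 + 2 * (B * D), by positivity, fun A γ hA hγ => ?_⟩
  set c : ℤ → ℂ := fourierCoeffOn hP ((Set.Iio T).indicator γ) with hc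
  set η : ℤ → ℂ := fourierCoeffOn hP ((Set.Ici T).indicator fun _ => (1 : ℂ)) with hη
  set sl : ℂ := -(A T - A 0) / (P - T : ℝ) with hsl
  -- A on [0, T), then a straight segment ending at A(0): f is continuous with f(P) = f(0), so
  -- integration by parts has no boundary term and G_j is the j-th coefficient of f' divided by a
  -- multiple of j.
  set f : ℝ → ℂ := fun t => if t < T then A t else A T + (t - T : ℝ) * sl with hf
  set f' : ℝ → ℂ := fun t => (Set.Iio T).indicator γ t + sl * (Set.Ici T).indicator (fun _ => (1 : ℂ)) t
    with hf'
  have hPT : ((P - T : ℝ) : ℂ) ≠ 0 := by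
    rw [Ne, ofReal_eq_zero]
    linarith
  have hf0 : f 0 = A 0 := by simp [hf, hT0]
  have hfP : f P = A 0 := by
    simp only [hf, not_lt.2 hTP.le, if_false, hsl]
    rw [mul_div_cancel₀ _ hPT]
    ring
  have hAc : Continuous A := continuous_iff_continuousAt.2 fun t => (hA t).continuousAt
  have hfc : Continuous f := by
    have h : f = fun t => if T ≤ t then A T + (t - T : ℝ) * sl else A t := by
      funext t
      by_cases h : t < T
      · simp [hf, h, not_le.2 h]
      · simp [hf, h, not_lt.1 h]
    rw [h]
    refine Continuous.if_le (by fun_prop) hAc continuous_const continuous_id ?_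
    rintro t rfl
    simp
  have hff' : ∀ x, HasDerivWithinAt f (f' x) (Set.Ioi x) x := by
    intro x
    by_cases hx : x < T
    · have h1 : f =ᶠ[𝓝 x] A := by
        filter_upwards [Iio_mem_nhds hx] with t ht
        simp [hf, Set.mem_Iio.1 ht]
      have h2 : f' x = γ x := by simp [hf', hx, not_le.2 hx]
      rw [h2]
      exact ((hA x).congr_of_eventuallyEq h1).hasDerivWithinAt
    · have hx' := not_lt.1 hx
      have h2 : f' x = sl := by simp [hf', hx, hx']
      rw [h2]
      have h3 : HasDerivAt (fun t : ℝ => A T + (t - T : ℝ) * sl) sl x := by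
        have := (((hasDerivAt_id x).sub_const T).ofReal_comp.mul_const sl).const_add (A T)
        simpa using this
      refine h3.hasDerivWithinAt.congr (fun t ht => ?_) ?_
      · simp [hf, not_lt.2 (hx'.trans (le_of_lt (Set.mem_Ioi.1 ht)))]
      · simp [hf, hx]
  have hi1 : IntervalIntegrable ((Set.Iio T).indicator γ) volume 0 P := by
    have := hγ.intervalIntegrable (μ := volume) 0 P
    rw [intervalIntegrable_iff] at this ⊢
    exact this.indicator measurableSet_Iio
  have hi2 : IntervalIntegrable ((Set.Ici T).indicator fun _ => (1 : ℂ)) volume 0 P := by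
    have := (continuous_const (y := (1 : ℂ))).intervalIntegrable (μ := volume) 0 P
    rw [intervalIntegrable_iff] at this ⊢
    exact this.indicator measurableSet_Ici
  have hi' : IntervalIntegrable f' volume 0 P := hi1.add (hi2.const_mul sl)
  have hcoef' : ∀ j, fourierCoeffOn hP f' j = c j + sl * η j := by
    intro j
    simp only [hc, hη, fourierCoeffOn_eq_integral, hf', smul_eq_mul, mul_add]
    have hcont : ∀ u : ℝ → ℂ, IntervalIntegrable u volume 0 P →
        IntervalIntegrable (fun x : ℝ => fourier (-j) (x : AddCircle (P - 0)) * u x) volume 0 P := by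
      intro u hu
      refine hu.continuousOn_mul ?_
      exact ((map_continuous (fourier (-j))).comp (AddCircle.continuous_mk' _)).continuousOn
    rw [intervalIntegral.integral_add (hcont _ hi1) (hcont _ (hi2.const_mul sl)), smul_add]
    congr 1
    have : ∀ x : ℝ, fourier (-j) (x : AddCircle (P - 0)) *
        (sl * (Set.Ici T).indicator (fun _ => (1 : ℂ)) x)
        = sl * (fourier (-j) (x : AddCircle (P - 0)) * (Set.Ici T).indicator (fun _ => (1 : ℂ)) x) :=
      fun x => by ring
    simp_rw [this]
    rw [intervalIntegral.integral_const_mul]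
    simp only [Complex.real_smul]
    ring
  -- the zeroth coefficient of the derivative measures the gap
  have hgap : A T - A 0 = P * c 0 := by
    have h1 : ∫ t in (0 : ℝ)..P, (Set.Iio T).indicator γ t = ∫ t in (0 : ℝ)..T, γ t := by
      rw [intervalIntegral.integral_of_le hP.le, intervalIntegral.integral_of_le hT0.le,
        setIntegral_indicator measurableSet_Iio, ← integral_Ioc_eq_integral_Ioo.symm]
      congr 2
      ext t
      simp only [Set.mem_inter_iff, Set.mem_Ioc, Set.mem_Iio, Set.mem_Ioo]
      constructor
      · rintro ⟨⟨h1, _⟩, h2⟩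
        exact ⟨h1, h2⟩
      · rintro ⟨h1, h2⟩
        exact ⟨⟨h1, by linarith⟩, h2⟩
    have h2 : ∫ t in (0 : ℝ)..T, γ t = A T - A 0 :=
      intervalIntegral.integral_eq_sub_of_hasDerivAt (fun t _ => hA t) (hγ.intervalIntegrable _ _)
    have h3 : c 0 = (1 / P : ℝ) * (A T - A 0) := by
      simp only [hc, fourierCoeffOn_eq_integral]
      simp [h1, h2]
    rw [h3, ← mul_assoc, ← ofReal_mul, mul_one_div_cancel hP.ne', ofReal_one, one_mul]
  have hslc : sl = -(M * c 0) := by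
    rw [hsl, hgap, hM]
    push_cast at hPT ⊢
    field_simp
  set G : ℤ → ℂ := fourierCoeffOn hP f with hG
  have hGj : ∀ j : ℤ, j ≠ 0 → ‖G j‖ = P / (2 * Real.pi * |(j : ℝ)|) * ‖c j - M * c 0 * η j‖ := by
    intro j hj
    have h := fourierCoeffOn_of_hasDeriv_right (f := f) (f' := f') hP hj hfc.continuousOn
      (fun x _ => hff' x) hi'
    rw [hG, h, hfP, hf0, sub_self, mul_zero, zero_sub, hcoef' j, hslc]
    have e1 : c j - M * c 0 * η j = c j + -(M * c 0) * η j := by ring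
    rw [e1]
    simp only [norm_mul, norm_neg, norm_div, norm_one, norm_I, mul_one, ofReal_zero, sub_zero]
    have e2 : ‖(P : ℂ)‖ = P := by rw [norm_real, Real.norm_of_nonneg hP.le]
    have e3 : ‖(Real.pi : ℂ)‖ = Real.pi := by rw [norm_real, Real.norm_of_nonneg Real.pi_pos.le]
    have e4 : ‖(j : ℂ)‖ = |(j : ℝ)| := by
      rw [← Complex.ofReal_intCast, norm_real, Real.norm_eq_abs]
    rw [e2, e3, e4]
    have e5 : ‖(2 : ℂ)‖ = 2 := by simp
    rw [e5]
    ring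
  -- square summability
  have hcs : Summable fun j => ‖c j‖ ^ 2 := by
    have hL : MemLp ((Set.Iio T).indicator γ) 2 (volume.restrict (Set.Ioc 0 P)) := by
      refine MemLp.indicator measurableSet_Iio ?_
      have hK := isCompact_Icc.exists_bound_of_continuousOn (s := Set.Icc 0 P) hγ.continuousOn
      obtain ⟨K, hK⟩ := hK
      refine MemLp.of_bound hγ.aestronglyMeasurable K ?_
      filter_upwards [ae_restrict_mem measurableSet_Ioc] with t ht
      exact hK t (Set.Ioc_subset_Icc_self ht)
    exact (hasSum_sq_fourierCoeffOn hP hL).summable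
  have hηL : MemLp ((Set.Ici T).indicator fun _ => (1 : ℂ)) 2 (volume.restrict (Set.Ioc 0 P)) :=
    (memLp_const 1).indicator measurableSet_Ici
  have hηs := hasSum_sq_fourierCoeffOn hP hηL
  have hη1 : ∑' j, ‖η j‖ ^ 2 ≤ 1 := by
    rw [hηs.tsum_eq, sub_zero, smul_eq_mul]
    have h1 : ∫ x in (0 : ℝ)..P, ‖(Set.Ici T).indicator (fun _ => (1 : ℂ)) x‖ ^ 2
        ≤ ∫ x in (0 : ℝ)..P, (1 : ℝ) := by
      refine intervalIntegral.integral_mono_on hP.le ?_ (by simp) fun x _ => ?_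
      · rw [intervalIntegrable_iff_integrableOn_Ioc_of_le hP.le]
        exact hηL.integrable_norm_pow (by norm_num)
      · by_cases hx : x ∈ Set.Ici T <;> simp [hx]
    rw [intervalIntegral.integral_const, sub_zero, smul_eq_mul, mul_one] at h1
    rw [inv_mul_le_iff₀ hP, mul_one]
    exact h1
  have hsq : ∀ j : ℤ, ‖c j - M * c 0 * η j‖ ^ 2 ≤ 2 * ‖c j‖ ^ 2 + 2 * (M ^ 2 * ‖c 0‖ ^ 2) * ‖η j‖ ^ 2 := by
    intro j
    have h1 := norm_sub_le (c j) (M * c 0 * η j)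
    have h2 : ‖(M : ℂ) * c 0 * η j‖ = M * ‖c 0‖ * ‖η j‖ := by
      rw [norm_mul, norm_mul, norm_real, Real.norm_of_nonneg hM0.le]
    rw [h2] at h1
    have h3 := pow_le_pow_left₀ (norm_nonneg _) h1 2
    nlinarith [sq_nonneg (‖c j‖ - M * ‖c 0‖ * ‖η j‖)]
  have hds : Summable fun j => ‖c j - M * c 0 * η j‖ ^ 2 :=
    Summable.of_nonneg_of_le (fun j => by positivity) hsq
      ((hcs.mul_left 2).add (hηs.summable.mul_left _))
  -- The coefficients of f' are square summable and so is 1/|j|. Their product is summable, which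
  -- gives pointwise rather than only L² convergence of the Fourier series.
  have hGs : Summable fun j => ‖G j‖ := by
    have h2 : Summable fun j : ℤ => 1 / |(j : ℝ)| ^ 2 := by
      have := Real.summable_abs_int_rpow (b := 2) (by norm_num)
      refine this.congr fun j => ?_
      rw [Real.rpow_neg (abs_nonneg _), one_div]
      norm_num
    have h3 : Summable fun j : ℤ => (P / (2 * Real.pi)) * (‖c j - M * c 0 * η j‖ ^ 2 + 1 / |(j : ℝ)| ^ 2) :=
      (hds.add h2).mul_left _
    refine Summable.of_norm_bounded_eventually h3 ?_
    have : ({0} : Set ℤ)ᶜ ∈ Filter.cofinite := (Set.finite_singleton 0).compl_mem_cofinite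
    filter_upwards [this] with j hj
    have hj : j ≠ 0 := hj
    have hpos : (0 : ℝ) < |(j : ℝ)| := abs_pos.2 (by exact_mod_cast hj)
    rw [norm_norm, hGj j hj]
    have h4 : P / (2 * Real.pi * |(j : ℝ)|) * ‖c j - M * c 0 * η j‖
        = P / (2 * Real.pi) * (‖c j - M * c 0 * η j‖ * (1 / |(j : ℝ)|)) := by
      field_simp
    rw [h4]
    have h5 : 1 / |(j : ℝ)| ^ 2 = (1 / |(j : ℝ)|) ^ 2 := by rw [div_pow, one_pow]
    have h6 : (0 : ℝ) < P / (2 * Real.pi) := by positivity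
    rw [h5]
    gcongr
    nlinarith [sq_nonneg (‖c j - M * c 0 * η j‖ - 1 / |(j : ℝ)|),
      sq_nonneg ‖c j - M * c 0 * η j‖, sq_nonneg (1 / |(j : ℝ)|)]
  -- the Fourier series converges pointwise
  have hsum : ∀ t ∈ Set.Ico 0 P, HasSum (fun j => G j * fourier j (t : AddCircle P)) (f t) := by
    intro t ht
    have hper : f 0 = f P := by rw [hf0, hfP]
    have hcl : Continuous (AddCircle.liftIco P 0 f) :=
      AddCircle.liftIco_zero_continuous hper hfc.continuousOn
    have hco : ∀ j, fourierCoeff (AddCircle.liftIco P 0 f) j = G j := by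
      intro j
      rw [fourierCoeff_liftIco_eq]
      simp [hG]
    have hsm : Summable (fourierCoeff (⟨_, hcl⟩ : C(AddCircle P, ℂ))) := by
      refine Summable.of_norm (hGs.congr fun j => ?_)
      exact congrArg _ (hco j).symm
    have h := has_pointwise_sum_fourier_series_of_summable hsm (t : AddCircle P)
    have hv : AddCircle.liftIco P 0 f (t : AddCircle P) = f t :=
      AddCircle.liftIco_zero_coe_apply ht
    simp only [ContinuousMap.coe_mk, hv, hco, smul_eq_mul] at h
    exact h
  -- the bound on the nonzero frequencies
  set S : ℝ≥0∞ := ∑' j : ℤ, ENNReal.ofReal (bracket j ^ (2 * b - 2) * ‖c j‖ ^ 2) with hS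
  have hc0S : ENNReal.ofReal (‖c 0‖ ^ 2) ≤ S := by
    have := ENNReal.le_tsum (f := fun j : ℤ => ENNReal.ofReal (bracket j ^ (2 * b - 2) * ‖c j‖ ^ 2)) 0
    have hb0 : bracket ((0 : ℤ) : ℝ) = 1 := by simp [bracket]
    simpa only [hb0, Real.one_rpow, one_mul] using this
  set H : ℤ → ℝ≥0∞ := fun j => if j = 0 then 0 else ENNReal.ofReal (bracket j ^ (2 * b) * ‖G j‖ ^ 2)
    with hH
  have hHle : ∑' j, H j ≤ ENNReal.ofReal D * S := by
    have hpt : ∀ j, H j ≤ ENNReal.ofReal ((P / (2 * Real.pi)) ^ 2 * 8) *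
        (ENNReal.ofReal (bracket j ^ (2 * b - 2) * ‖c j‖ ^ 2) +
          ENNReal.ofReal (M ^ 2 * ‖c 0‖ ^ 2) * ENNReal.ofReal (‖η j‖ ^ 2)) := by
      intro j
      by_cases hj : j = 0
      · simp [hH, hj]
      · simp only [hH, hj, if_false]
        have hpos : (0 : ℝ) < |(j : ℝ)| := abs_pos.2 (by exact_mod_cast hj)
        have h1j : (1 : ℝ) ≤ |(j : ℝ)| := by
          rw [← Int.cast_abs]
          exact_mod_cast Int.one_le_abs hj
        have hbp := bracket_pos (j : ℝ)
        rw [← ENNReal.ofReal_mul (by positivity), ← ENNReal.ofReal_add (by positivity) (by positivity),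
          ← ENNReal.ofReal_mul (by positivity)]
        refine ENNReal.ofReal_le_ofReal ?_
        have hw : bracket j ^ (2 * b - 2) * (bracket j) ^ 2 = bracket j ^ (2 * b) := by
          rw [← Real.rpow_natCast, ← Real.rpow_add hbp]
          congr 1
          push_cast
          ring
        -- As b < 1, the weight can be dropped on the slope term. There only Bessel's bound ∑|η_j|²
        -- ≤ 1 is needed, and |c₀|² is itself the j = 0 term of S.
        have hw1 : bracket j ^ (2 * b - 2) ≤ 1 :=
          Real.rpow_le_one_of_one_le_of_nonpos (one_le_bracket _) (by linarith)
        have hw0 : 0 < bracket j ^ (2 * b - 2) := Real.rpow_pos_of_pos hbp _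
        have hbj := bracket_le_two_mul_abs h1j
        rw [← hw, hGj j hj, mul_pow]
        have h7 : (bracket j) ^ 2 * (P / (2 * Real.pi * |(j : ℝ)|)) ^ 2 ≤ (P / (2 * Real.pi)) ^ 2 * 4 := by
          rw [← mul_pow]
          have : bracket j * (P / (2 * Real.pi * |(j : ℝ)|)) ≤ P / (2 * Real.pi) * 2 := by
            calc bracket j * (P / (2 * Real.pi * |(j : ℝ)|))
                ≤ (2 * |(j : ℝ)|) * (P / (2 * Real.pi * |(j : ℝ)|)) := by gcongr
              _ = P / (2 * Real.pi) * 2 := by field_simp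
          calc _ ≤ (P / (2 * Real.pi) * 2) ^ 2 := by gcongr
            _ = _ := by ring
        have h8 := hsq j
        calc bracket j ^ (2 * b - 2) * bracket j ^ 2 *
              ((P / (2 * Real.pi * |(j : ℝ)|)) ^ 2 * ‖c j - M * c 0 * η j‖ ^ 2)
            = bracket j ^ (2 * b - 2) * (bracket j ^ 2 * (P / (2 * Real.pi * |(j : ℝ)|)) ^ 2) *
                ‖c j - M * c 0 * η j‖ ^ 2 := by ring
          _ ≤ bracket j ^ (2 * b - 2) * ((P / (2 * Real.pi)) ^ 2 * 4) *
                (2 * ‖c j‖ ^ 2 + 2 * (M ^ 2 * ‖c 0‖ ^ 2) * ‖η j‖ ^ 2) := by gcongr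
          _ = (P / (2 * Real.pi)) ^ 2 * 8 * (bracket j ^ (2 * b - 2) * ‖c j‖ ^ 2 +
                bracket j ^ (2 * b - 2) * (M ^ 2 * ‖c 0‖ ^ 2 * ‖η j‖ ^ 2)) := by ring
          _ ≤ _ := by
              have := mul_le_of_le_one_left
                (by positivity : 0 ≤ M ^ 2 * ‖c 0‖ ^ 2 * ‖η j‖ ^ 2) hw1
              gcongr
    have hηE : ∑' j, ENNReal.ofReal (‖η j‖ ^ 2) ≤ 1 := by
      rw [← ENNReal.ofReal_tsum_of_nonneg (fun j => by positivity) hηs.summable]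
      exact ENNReal.ofReal_le_one.2 hη1
    calc ∑' j, H j ≤ _ := ENNReal.tsum_le_tsum hpt
      _ = ENNReal.ofReal ((P / (2 * Real.pi)) ^ 2 * 8) *
          (S + ENNReal.ofReal (M ^ 2 * ‖c 0‖ ^ 2) * ∑' j, ENNReal.ofReal (‖η j‖ ^ 2)) := by
          rw [ENNReal.tsum_mul_left, ENNReal.tsum_add, ENNReal.tsum_mul_left]
      _ ≤ ENNReal.ofReal ((P / (2 * Real.pi)) ^ 2 * 8) *
          (S + ENNReal.ofReal (M ^ 2) * S * 1) := by
          rw [ENNReal.ofReal_mul (by positivity : 0 ≤ M ^ 2)]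
          gcongr
      _ = ENNReal.ofReal D * S := by
          rw [mul_one, hD, ENNReal.ofReal_mul (by positivity : 0 ≤ (P / (2 * Real.pi)) ^ 2 * 8),
            ENNReal.ofReal_add one_pos.le (by positivity), ENNReal.ofReal_one]
          ring
  -- the bound on the zeroth coefficient
  have hG0 : ENNReal.ofReal (‖G 0‖ ^ 2) ≤ 2 * (ENNReal.ofReal (‖A 0‖ ^ 2) +
      ENNReal.ofReal B * (ENNReal.ofReal D * S)) := by
    -- The integration by parts says nothing about j = 0. Evaluating the Fourier series at t = 0
    -- gives G₀ = A(0) - ∑_{j≠0} G_j, and Cauchy-Schwarz against ⟨j⟩^{-2b}, summable as b > 1/2,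
    -- reduces the sum to the nonzero frequencies.
    have h0 := hsum 0 ⟨le_rfl, hP⟩
    simp only [QuotientAddGroup.mk_zero, fourier_eval_zero, mul_one, hf0] at h0
    set x : ℝ := ∑' j : ℤ, (if j = 0 then 0 else ‖G j‖) with hx
    have hxs : Summable fun j : ℤ => (if j = 0 then 0 else ‖G j‖) := by
      refine Summable.of_nonneg_of_le (fun j => ?_) (fun j => ?_) hGs <;> split_ifs <;> simp
    have hGx : ‖G 0‖ ≤ ‖A 0‖ + x := by
      have h1 := h0.sub (hasSum_ite_eq (0 : ℤ) (G 0))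
      have h2 : ‖A 0 - G 0‖ ≤ x := by
        refine h1.norm_le_of_bounded hxs.hasSum fun j => ?_
        by_cases hj : j = 0 <;> simp [hj]
      have h3 := norm_sub_norm_le (G 0) (A 0)
      rw [norm_sub_rev] at h3
      linarith
    have hx0 : 0 ≤ x := tsum_nonneg fun j => by split_ifs <;> simp
    have hxE : ENNReal.ofReal (x ^ 2) ≤ ENNReal.ofReal B * ∑' j, H j := by
      have h1 := tsum_mul_sq_le (fun j : ℤ => ENNReal.ofReal (bracket j ^ (-b)))
        (fun j : ℤ => if j = 0 then 0 else ENNReal.ofReal (bracket j ^ b * ‖G j‖))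
      have e1 : ∀ j : ℤ, ENNReal.ofReal (bracket j ^ (-b)) *
          (if j = 0 then 0 else ENNReal.ofReal (bracket j ^ b * ‖G j‖))
          = ENNReal.ofReal (if j = 0 then 0 else ‖G j‖) := by
        intro j
        have hbp := bracket_pos (j : ℝ)
        by_cases hj : j = 0
        · simp [hj]
        · simp only [hj, if_false]
          rw [← ENNReal.ofReal_mul (Real.rpow_nonneg hbp.le _), ← mul_assoc, ← Real.rpow_add hbp]
          simp
      have e2 : ∀ j : ℤ, ENNReal.ofReal (bracket j ^ (-b)) ^ 2
          = ENNReal.ofReal (bracket j ^ (-(2 * b))) := by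
        intro j
        have hbp := bracket_pos (j : ℝ)
        rw [← ENNReal.ofReal_pow (Real.rpow_nonneg hbp.le _), ← Real.rpow_natCast,
          ← Real.rpow_mul hbp.le]
        congr 2
        push_cast
        ring
      have e3 : ∀ j : ℤ, (if j = 0 then 0 else ENNReal.ofReal (bracket j ^ b * ‖G j‖)) ^ 2
          = H j := by
        intro j
        have hbp := bracket_pos (j : ℝ)
        by_cases hj : j = 0
        · simp [hj, hH]
        · simp only [hj, if_false, hH]
          rw [← ENNReal.ofReal_pow (by positivity), mul_pow, ← Real.rpow_natCast (bracket j ^ b),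
            ← Real.rpow_mul hbp.le]
          congr 3
          push_cast
          ring
      simp_rw [e1, e2, e3] at h1
      rw [← ENNReal.ofReal_tsum_of_nonneg (fun j => by split_ifs <;> simp) hxs,
        ← ENNReal.ofReal_tsum_of_nonneg (fun j => Real.rpow_nonneg (bracket_pos _).le _) hbs,
        ← ENNReal.ofReal_pow hx0] at h1
      exact h1
    have h5 : ‖G 0‖ ^ 2 ≤ 2 * (‖A 0‖ ^ 2 + x ^ 2) := by
      have := pow_le_pow_left₀ (norm_nonneg _) hGx 2
      nlinarith [sq_nonneg (‖A 0‖ - x)]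
    calc ENNReal.ofReal (‖G 0‖ ^ 2) ≤ ENNReal.ofReal (2 * (‖A 0‖ ^ 2 + x ^ 2)) :=
          ENNReal.ofReal_le_ofReal h5
      _ = 2 * (ENNReal.ofReal (‖A 0‖ ^ 2) + ENNReal.ofReal (x ^ 2)) := by
          rw [ENNReal.ofReal_mul two_pos.le, ENNReal.ofReal_add (by positivity) (by positivity)]
          norm_num
      _ ≤ _ := by
          gcongr
          exact hxE.trans (by gcongr)
  refine ⟨G, hGs, fun t ht => ?_, ?_⟩
  · have h := hsum t ⟨ht.1, ht.2.trans hTP⟩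
    have h2 : f t = A t := by simp [hf, ht.2]
    rwa [h2] at h
  · have hsplit : ∑' j : ℤ, ENNReal.ofReal (bracket j ^ (2 * b) * ‖G j‖ ^ 2)
        = ENNReal.ofReal (‖G 0‖ ^ 2) + ∑' j, H j := by
      have h1 : ∀ j : ℤ, ENNReal.ofReal (bracket j ^ (2 * b) * ‖G j‖ ^ 2)
          = (if j = 0 then ENNReal.ofReal (‖G 0‖ ^ 2) else 0) + H j := by
        intro j
        have hb0 : bracket (0 : ℝ) = 1 := by simp [bracket]
        by_cases hj : j = 0
        · simp [hj, hH, hb0]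
        · simp [hj, hH]
      simp_rw [h1]
      rw [ENNReal.tsum_add, tsum_ite_eq]
    rw [hsplit]
    calc ENNReal.ofReal (‖G 0‖ ^ 2) + ∑' j, H j
        ≤ 2 * (ENNReal.ofReal (‖A 0‖ ^ 2) + ENNReal.ofReal B * (ENNReal.ofReal D * S)) +
          ENNReal.ofReal D * S := add_le_add hG0 hHle
      _ = ENNReal.ofReal 2 * ENNReal.ofReal (‖A 0‖ ^ 2) + ENNReal.ofReal (2 * (B * D) + D) * S := by
          rw [ENNReal.ofReal_add (by positivity) hD0.le, ENNReal.ofReal_mul two_pos.le,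
            ENNReal.ofReal_mul hB0]
          norm_num
          ring
      _ ≤ _ := by
          have hBD := mul_nonneg hB0 hD0.le
          have h1 : (2 : ℝ) ≤ D + 2 + 2 * (B * D) := by linarith
          have h2 : 2 * (B * D) + D ≤ D + 2 + 2 * (B * D) := by linarith
          rw [mul_add]
          exact add_le_add (mul_le_mul_left (ENNReal.ofReal_le_ofReal h1) _)
            (mul_le_mul_left (ENNReal.ofReal_le_ofReal h2) _)

end TimeExtension

end BallNLS

namespace BallNLS

/-! ### Sine coefficients controlled by increments. -/

section SineCoefficients

/-- Squared increment of `W` of step `h` at `x`, with the boundary contribution near `0`. -/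
noncomputable def incrSq (h : ℝ) (W : ℝ → ℂ) (x : ℝ) : ℝ≥0∞ :=
  (if x < h then ‖W x‖ₑ ^ 2 else 0) + ‖W (x + h) - W x‖ₑ ^ 2

/-- A weighted Besov-type functional controlling the sine coefficients of `W`. -/
noncomputable def besov (s α : ℝ) (W : ℝ → ℂ) : ℝ≥0∞ :=
  ∑' k : ℕ, ENNReal.ofReal (4 ^ (s * (k + 1))) *
    ∫⁻ x in Set.Ioc (0 : ℝ) 1, ENNReal.ofReal (x ^ α) * incrSq (2⁻¹ ^ (k + 1)) W x

/-- Integrating the second difference 2V(x) - V(x-h) - V(x+h) against sin(ωx) multiplies the sine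
coefficient by 2 - 2cos(ωh) ≥ 2, so first differences of the zero extension V control the
coefficient. The term with x < h is the jump of V at 0; there is no separate term at 1 because W
itself vanishes beyond 1. -/
theorem enorm_integral_sin_le {W : ℝ → ℂ} (hW : IntegrableOn W (Set.Ioc 0 1))
    (hW1 : ∀ x, 1 < x → W x = 0) {ω h : ℝ} (hh : 0 ≤ h) (hωh : Real.cos (ω * h) ≤ 0) :
    ‖∫ x in (0 : ℝ)..1, W x * Real.sin (ω * x)‖ₑ ≤
      ∫⁻ x in Set.Ioc (0 : ℝ) 1, ((if x < h then ‖W x‖ₑ else 0) + ‖W (x + h) - W x‖ₑ) := by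
  set V : ℝ → ℂ := (Set.Ioc 0 1).indicator W with hV
  have hVi : Integrable V := (integrable_indicator_iff measurableSet_Ioc).2 hW
  set I : ℂ := ∫ x in (0 : ℝ)..1, W x * Real.sin (ω * x) with hI
  have hVS : ∀ S : ℝ → ℂ, ∫ x, V x * S x = ∫ x in (0 : ℝ)..1, W x * S x := by
    intro S
    rw [intervalIntegral.integral_of_le zero_le_one, ← integral_indicator measurableSet_Ioc]
    refine integral_congr_ae (Eventually.of_forall fun x => ?_)
    by_cases hx : x ∈ Set.Ioc (0 : ℝ) 1 <;> simp [hV, hx]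
  have hint : ∀ (U : ℝ → ℂ) (a : ℝ), Integrable U →
      Integrable fun x => U x * (Real.sin (ω * (x + a)) : ℂ) := by
    intro U a hU
    refine hU.mul_bdd (c := 1) (by fun_prop) (Eventually.of_forall fun x => ?_)
    rw [Complex.norm_real]
    exact Real.abs_sin_le_one _
  have hsin : ∀ U : ℝ → ℂ, Integrable U → Integrable fun x => U x * (Real.sin (ω * x) : ℂ) :=
    fun U hU => by simpa using hint U 0 hU
  have hshift : ∀ a : ℝ, ∫ x, V x * (Real.sin (ω * (x + a)) : ℂ)
      = ∫ x, V (x - a) * (Real.sin (ω * x) : ℂ) := by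
    intro a
    rw [← integral_add_right_eq_self (fun x => V (x - a) * (Real.sin (ω * x) : ℂ)) a]
    simp
  have hkey : (2 - 2 * Real.cos (ω * h) : ℂ) * I =
      ∫ x, ((V x - V (x - h)) * Real.sin (ω * x) + (V x - V (x + h)) * Real.sin (ω * x)) := by
    have h1 : ∫ x, V x * (Real.sin (ω * (x + h)) : ℂ) + V x * (Real.sin (ω * (x + -h)) : ℂ)
        = 2 * Real.cos (ω * h) * I := by
      rw [hI, ← hVS, ← integral_const_mul]
      refine integral_congr_ae (Eventually.of_forall fun x => ?_)
      simp only
      rw [← mul_add, ← Complex.ofReal_add, mul_add, mul_add, Real.sin_add, Real.sin_add, mul_neg,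
        Real.cos_neg, Real.sin_neg]
      push_cast
      ring
    rw [integral_add (hint V h hVi) (hint V (-h) hVi), hshift, hshift] at h1
    have e : ∀ x, ((V x - V (x - h)) * Real.sin (ω * x) + (V x - V (x + h)) * Real.sin (ω * x) : ℂ)
        = (2 * (V x * Real.sin (ω * x)) - V (x - h) * Real.sin (ω * x)) -
          V (x - -h) * Real.sin (ω * x) := by
      intro x
      rw [sub_neg_eq_add]
      ring
    simp_rw [e]
    have hA : Integrable fun x => 2 * (V x * (Real.sin (ω * x) : ℂ)) - V (x - h) * Real.sin (ω * x) :=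
      ((hsin V hVi).const_mul 2).sub (hsin _ (hVi.comp_sub_right h))
    rw [integral_sub hA (hsin _ (hVi.comp_sub_right (-h))),
      integral_sub ((hsin V hVi).const_mul 2) (hsin _ (hVi.comp_sub_right h)), integral_const_mul,
      hVS, ← hI]
    linear_combination h1
  have hbound : ‖I‖ₑ ≤ ∫⁻ x, ‖V (x + h) - V x‖ₑ := by
    have h2 : (2 : ℝ≥0∞) * ‖I‖ₑ ≤ ‖(2 - 2 * Real.cos (ω * h) : ℂ) * I‖ₑ := by
      rw [enorm_mul]
      gcongr
      have h3 : ((2 - 2 * Real.cos (ω * h) : ℝ) : ℂ) = (2 - 2 * Real.cos (ω * h) : ℂ) := by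
        push_cast
        ring
      rw [← h3, ← ofReal_norm, Complex.norm_real, Real.norm_of_nonneg (by linarith)]
      calc (2 : ℝ≥0∞) = ENNReal.ofReal 2 := by norm_num
        _ ≤ _ := ENNReal.ofReal_le_ofReal (by linarith)
    have h4 : ‖(2 - 2 * Real.cos (ω * h) : ℂ) * I‖ₑ ≤ 2 * ∫⁻ x, ‖V (x + h) - V x‖ₑ := by
      rw [hkey]
      refine (enorm_integral_le_lintegral_enorm _).trans ?_
      have h5 : ∀ U : ℂ, ∀ x : ℝ, ‖U * (Real.sin (ω * x) : ℂ)‖ₑ ≤ ‖U‖ₑ := by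
        intro U x
        rw [← ofReal_norm, ← ofReal_norm, norm_mul, Complex.norm_real]
        exact ENNReal.ofReal_le_ofReal
          (mul_le_of_le_one_right (norm_nonneg _) (Real.abs_sin_le_one _))
      have hVm : AEStronglyMeasurable V := hVi.aestronglyMeasurable
      calc ∫⁻ x, ‖(V x - V (x - h)) * Real.sin (ω * x) + (V x - V (x + h)) * Real.sin (ω * x)‖ₑ
          ≤ ∫⁻ x, (‖V x - V (x - h)‖ₑ + ‖V x - V (x + h)‖ₑ) :=
            lintegral_mono fun x => (enorm_add_le _ _).trans (add_le_add (h5 _ _) (h5 _ _))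
        _ = (∫⁻ x, ‖V x - V (x - h)‖ₑ) + ∫⁻ x, ‖V x - V (x + h)‖ₑ :=
            lintegral_add_left' (hVi.sub (hVi.comp_sub_right h)).aestronglyMeasurable.enorm _
        _ = 2 * ∫⁻ x, ‖V (x + h) - V x‖ₑ := by
            rw [two_mul, ← lintegral_add_right_eq_self (fun x => ‖V x - V (x - h)‖ₑ) h]
            simp only [add_sub_cancel_right]
            congr 1
            exact lintegral_congr fun x => enorm_sub_rev _ _
    have h6 := h2.trans h4
    rwa [ENNReal.mul_le_mul_iff_right (by norm_num) (by norm_num)] at h6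
  refine hbound.trans ?_
  have hpt : ∀ x, ‖V (x + h) - V x‖ₑ ≤
      (Set.Ioc (-h) 0).indicator (fun x => ‖V (x + h)‖ₑ) x +
        (Set.Ioc (0 : ℝ) 1).indicator (fun x => ‖W (x + h) - W x‖ₑ) x := by
    intro x
    by_cases h1 : x ∈ Set.Ioc (0 : ℝ) 1
    · have h2 : V (x + h) = W (x + h) := by
        by_cases h3 : x + h ≤ 1
        · have h4 : x + h ∈ Set.Ioc (0 : ℝ) 1 := ⟨by linarith [h1.1], h3⟩
          exact Set.indicator_of_mem h4 W
        · rw [hW1 _ (not_le.1 h3)]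
          exact Set.indicator_of_notMem (fun h4 => h3 h4.2) _
      have h3 : V x = W x := Set.indicator_of_mem h1 _
      rw [h2, h3, Set.indicator_of_mem h1]
      exact le_add_self
    · have h3 : V x = 0 := Set.indicator_of_notMem h1 _
      rw [h3, sub_zero]
      by_cases h4 : x ∈ Set.Ioc (-h) 0
      · rw [Set.indicator_of_mem h4]
        exact le_self_add
      · have h5 : V (x + h) = 0 := by
          refine Set.indicator_of_notMem (fun h6 => ?_) _
          have h7 : 0 < x := by
            by_contra h8
            exact h4 ⟨by linarith [h6.1], not_lt.1 h8⟩
          exact h1 ⟨h7, by linarith [h6.2]⟩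
        simp [h5]
  have hfirst : ∫⁻ x, (Set.Ioc (-h) 0).indicator (fun x => ‖V (x + h)‖ₑ) x
      ≤ ∫⁻ x in Set.Ioc (0 : ℝ) 1, (if x ≤ h then ‖W x‖ₑ else 0) := by
    rw [← lintegral_sub_right_eq_self _ h, ← lintegral_indicator measurableSet_Ioc]
    refine lintegral_mono fun x => ?_
    by_cases h1 : x - h ∈ Set.Ioc (-h) 0
    · rw [Set.indicator_of_mem h1]
      simp only [sub_add_cancel]
      by_cases h2 : x ∈ Set.Ioc (0 : ℝ) 1
      · have h3 : x ≤ h := by linarith [h1.2]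
        simp [h2, hV, h3]
      · simp [h2, hV]
    · rw [Set.indicator_of_notMem h1]
      exact zero_le
  have hfirst' : ∫⁻ x in Set.Ioc (0 : ℝ) 1, (if x ≤ h then ‖W x‖ₑ else 0)
      = ∫⁻ x in Set.Ioc (0 : ℝ) 1, (if x < h then ‖W x‖ₑ else 0) := by
    refine lintegral_congr_ae ?_
    have : ∀ᵐ x ∂(volume.restrict (Set.Ioc (0 : ℝ) 1)), x ≠ h :=
      ae_restrict_of_ae (Measure.ae_ne volume h)
    filter_upwards [this] with x hx
    have : x ≤ h ↔ x < h := ⟨fun h1 => lt_of_le_of_ne h1 hx, le_of_lt⟩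
    simp [this]
  have hm : AEMeasurable (fun x => if x < h then ‖W x‖ₑ else 0) (volume.restrict (Set.Ioc (0 : ℝ) 1)) := by
    have h1 : (fun x => if x < h then ‖W x‖ₑ else 0) = (Set.Iio h).indicator fun x => ‖W x‖ₑ := by
      funext x
      simp [Set.indicator]
    rw [h1]
    exact hW.aestronglyMeasurable.enorm.indicator measurableSet_Iio
  calc ∫⁻ x, ‖V (x + h) - V x‖ₑ ≤ _ := lintegral_mono hpt
    _ = (∫⁻ x, (Set.Ioc (-h) 0).indicator (fun x => ‖V (x + h)‖ₑ) x) +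
        ∫⁻ x, (Set.Ioc (0 : ℝ) 1).indicator (fun x => ‖W (x + h) - W x‖ₑ) x := by
        refine lintegral_add_left' ?_ _
        exact (hVi.comp_add_right h).aestronglyMeasurable.enorm.indicator measurableSet_Ioc
    _ ≤ _ := by
        rw [lintegral_add_left' hm]
        exact add_le_add (hfirst.trans hfirst'.le) (lintegral_indicator measurableSet_Ioc _).le

theorem lintegral_rpow_neg_Ioc {α : ℝ} (hα1 : α < 1) :
    ∫⁻ x in Set.Ioc (0 : ℝ) 1, ENNReal.ofReal (x ^ (-α)) = ENNReal.ofReal (1 / (1 - α)) := by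
  have hi : IntervalIntegrable (fun x : ℝ => x ^ (-α)) volume 0 1 :=
    intervalIntegral.intervalIntegrable_rpow' (by linarith)
  rw [← ofReal_integral_eq_lintegral_ofReal]
  · rw [← intervalIntegral.integral_of_le zero_le_one, integral_rpow (Or.inl (by linarith))]
    congr 1
    rw [Real.zero_rpow (by linarith), Real.one_rpow, sub_zero]
    congr 1
    ring
  · exact (intervalIntegrable_iff_integrableOn_Ioc_of_le zero_le_one).1 hi
  · filter_upwards [ae_restrict_mem measurableSet_Ioc] with x hx
    exact Real.rpow_nonneg hx.1.le _

theorem measurable_incrSq {W : ℝ → ℂ} (hW : Measurable W) (h : ℝ) : Measurable (incrSq h W) := by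
  unfold incrSq
  refine Measurable.add ?_ ?_
  · exact Measurable.ite measurableSet_Iio (hW.enorm.pow_const 2) measurable_const
  · exact (((hW.comp (measurable_id.add_const h)).sub hW).enorm).pow_const 2

/-- Cauchy-Schwarz against x^{-α}, whose integral 1/(1-α) is finite for α < 1. The weight x^α left
on the increments is what later compensates their singularity at the origin; the factor 2 comes from
squaring a sum of two terms. -/
theorem enorm_integral_sin_sq_le {W : ℝ → ℂ} (hWm : Measurable W)
    (hW : IntegrableOn W (Set.Ioc 0 1))
    (hW1 : ∀ x, 1 < x → W x = 0) {ω h α : ℝ} (hα1 : α < 1) (hh : 0 ≤ h)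
    (hωh : Real.cos (ω * h) ≤ 0) :
    ‖∫ x in (0 : ℝ)..1, W x * Real.sin (ω * x)‖ₑ ^ 2 ≤ ENNReal.ofReal (2 / (1 - α)) *
      ∫⁻ x in Set.Ioc (0 : ℝ) 1, ENNReal.ofReal (x ^ α) * incrSq h W x := by
  set D : ℝ → ℝ≥0∞ := fun x => (if x < h then ‖W x‖ₑ else 0) + ‖W (x + h) - W x‖ₑ with hD
  have hDm : Measurable D := by
    refine Measurable.add ?_ ?_
    · exact Measurable.ite measurableSet_Iio hWm.enorm measurable_const
    · exact ((hWm.comp (measurable_id.add_const h)).sub hWm).enorm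
  have hpm : ∀ p : ℝ, Measurable fun x : ℝ => ENNReal.ofReal (x ^ p) := fun p =>
    (measurable_id.pow_const p).ennreal_ofReal
  have h1 := enorm_integral_sin_le hW hW1 hh hωh
  have h2 : ∫⁻ x in Set.Ioc (0 : ℝ) 1, D x = ∫⁻ x in Set.Ioc (0 : ℝ) 1,
      ENNReal.ofReal (x ^ (-α / 2)) * (ENNReal.ofReal (x ^ (α / 2)) * D x) := by
    refine setLIntegral_congr_fun measurableSet_Ioc fun x hx => ?_
    rw [← mul_assoc, ← ENNReal.ofReal_mul (Real.rpow_nonneg hx.1.le _), ← Real.rpow_add hx.1]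
    simp [neg_div]
  have h3 := lintegral_mul_sq_le (volume.restrict (Set.Ioc (0 : ℝ) 1))
    (f := fun x => ENNReal.ofReal (x ^ (-α / 2)))
    (g := fun x => ENNReal.ofReal (x ^ (α / 2)) * D x) (hpm _).aemeasurable
    ((hpm _).mul hDm).aemeasurable
  have h4 : ∫⁻ x in Set.Ioc (0 : ℝ) 1, ENNReal.ofReal (x ^ (-α / 2)) ^ 2
      = ENNReal.ofReal (1 / (1 - α)) := by
    rw [← lintegral_rpow_neg_Ioc hα1]
    refine setLIntegral_congr_fun measurableSet_Ioc fun x hx => ?_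
    rw [← ENNReal.ofReal_pow (Real.rpow_nonneg hx.1.le _), ← Real.rpow_natCast,
      ← Real.rpow_mul hx.1.le]
    congr 2
    push_cast
    ring
  have h5 : ∫⁻ x in Set.Ioc (0 : ℝ) 1, (ENNReal.ofReal (x ^ (α / 2)) * D x) ^ 2
      ≤ ∫⁻ x in Set.Ioc (0 : ℝ) 1, 2 * (ENNReal.ofReal (x ^ α) * incrSq h W x) := by
    refine setLIntegral_mono' measurableSet_Ioc fun x hx => ?_
    have e1 : ENNReal.ofReal (x ^ (α / 2)) ^ 2 = ENNReal.ofReal (x ^ α) := by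
      rw [← ENNReal.ofReal_pow (Real.rpow_nonneg hx.1.le _), ← Real.rpow_natCast,
        ← Real.rpow_mul hx.1.le]
      congr 2
      push_cast
      ring
    have e2 : D x ^ 2 ≤ 2 * incrSq h W x := by
      have := ENNReal.rpow_add_le_mul_rpow_add_rpow (if x < h then ‖W x‖ₑ else 0)
        ‖W (x + h) - W x‖ₑ (p := 2) (by norm_num)
      simp only [hD, incrSq]
      norm_num at this
      refine this.trans (le_of_eq ?_)
      split_ifs <;> simp
    calc (ENNReal.ofReal (x ^ (α / 2)) * D x) ^ 2 = ENNReal.ofReal (x ^ α) * D x ^ 2 := by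
          rw [mul_pow, e1]
      _ ≤ ENNReal.ofReal (x ^ α) * (2 * incrSq h W x) := by gcongr
      _ = _ := by ring
  calc ‖∫ x in (0 : ℝ)..1, W x * Real.sin (ω * x)‖ₑ ^ 2
      ≤ (∫⁻ x in Set.Ioc (0 : ℝ) 1, D x) ^ 2 := pow_le_pow_left₀ zero_le h1 2
    _ ≤ ENNReal.ofReal (1 / (1 - α)) *
        ∫⁻ x in Set.Ioc (0 : ℝ) 1, 2 * (ENNReal.ofReal (x ^ α) * incrSq h W x) := by
        rw [h2]
        refine h3.trans ?_
        rw [h4]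
        gcongr
    _ = _ := by
        have hm : Measurable fun x => ENNReal.ofReal (x ^ α) * incrSq h W x :=
          (hpm α).mul (measurable_incrSq hWm h)
        rw [lintegral_const_mul _ hm, ← mul_assoc]
        congr 1
        have h2' : (2 : ℝ≥0∞) = ENNReal.ofReal 2 := by norm_num
        have : 0 ≤ 1 / (1 - α) := by
          apply one_div_nonneg.2
          linarith
        rw [h2', ← ENNReal.ofReal_mul this]
        congr 1
        ring

/-- The Besov-type functional controls all sine coefficients. -/
theorem rpow_mul_enorm_integral_sin_sq_le {W : ℝ → ℂ} (hWm : Measurable W)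
    (hW : IntegrableOn W (Set.Ioc 0 1))
    (hW1 : ∀ x, 1 < x → W x = 0) {s α : ℝ} (hs : 0 ≤ s) (hα1 : α < 1) {n : ℕ} (hn : n ≠ 0) :
    ENNReal.ofReal ((n : ℝ) ^ (2 * s)) *
      ‖∫ x in (0 : ℝ)..1, W x * Real.sin (n * Real.pi * x)‖ₑ ^ 2
        ≤ ENNReal.ofReal (2 / (1 - α)) * besov s α W := by
  -- For 2^k ≤ n < 2^{k+1} and h = 2^{-(k+1)}, nh lies in [1/2, 1], so cos(nπh) ≤ 0. Only the k-th
  -- term of the functional is used: the bound is uniform in n, not summed over n.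
  set k := Nat.log 2 n with hk
  have h1 : (2 : ℝ) ^ k ≤ n := by exact_mod_cast Nat.pow_log_le_self 2 hn
  have h2 : (n : ℝ) < 2 ^ (k + 1) := by exact_mod_cast Nat.lt_pow_succ_log_self (by norm_num) n
  set h : ℝ := 2⁻¹ ^ (k + 1) with hh
  have hpow : (0 : ℝ) < 2 ^ (k + 1) := by positivity
  have hh' : h = (2 ^ (k + 1))⁻¹ := by rw [hh, inv_pow]
  have hnh1 : (n : ℝ) * h ≤ 1 := by
    rw [hh', ← div_eq_mul_inv, div_le_one hpow]
    exact h2.le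
  have hnh2 : 1 / 2 ≤ (n : ℝ) * h := by
    rw [hh', ← div_eq_mul_inv, div_le_div_iff₀ two_pos hpow, pow_succ]
    linarith
  have hcos : Real.cos (n * Real.pi * h) ≤ 0 := by
    refine Real.cos_nonpos_of_pi_div_two_le_of_le ?_ ?_ <;> nlinarith [Real.pi_pos]
  have hmain := enorm_integral_sin_sq_le hWm hW hW1 (α := α) hα1 (by positivity : 0 ≤ h) hcos
  have hns : (n : ℝ) ^ (2 * s) ≤ 4 ^ (s * (k + 1)) := by
    calc (n : ℝ) ^ (2 * s) ≤ (2 ^ (k + 1)) ^ (2 * s) := by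
          exact Real.rpow_le_rpow (by positivity) h2.le (by linarith)
      _ = 4 ^ (s * (k + 1)) := by
          rw [← Real.rpow_natCast, ← Real.rpow_mul (by norm_num),
            (by norm_num : (4 : ℝ) = 2 ^ (2 : ℝ)), ← Real.rpow_mul (by norm_num)]
          congr 1
          push_cast
          ring
  calc _ ≤ ENNReal.ofReal (4 ^ (s * (k + 1))) * (ENNReal.ofReal (2 / (1 - α)) *
      ∫⁻ x in Set.Ioc (0 : ℝ) 1, ENNReal.ofReal (x ^ α) * incrSq h W x) := by gcongr
    _ = ENNReal.ofReal (2 / (1 - α)) * (ENNReal.ofReal (4 ^ (s * (k + 1))) *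
      ∫⁻ x in Set.Ioc (0 : ℝ) 1, ENNReal.ofReal (x ^ α) * incrSq h W x) := by ring
    _ ≤ _ := by
      gcongr
      exact ENNReal.le_tsum (f := fun k : ℕ => ENNReal.ofReal (4 ^ (s * ((k : ℝ) + 1))) *
        ∫⁻ x in Set.Ioc (0 : ℝ) 1, ENNReal.ofReal (x ^ α) * incrSq (2⁻¹ ^ (k + 1)) W x) k

end SineCoefficients

end BallNLS

namespace BallNLS

/-! ### Parseval in time and the weighted space-time sum. -/

section SpaceTime

theorem norm_fourier_coe {P : ℝ} (m : ℤ) (t : AddCircle P) : ‖fourier m t‖ = 1 := by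
  rw [fourier_apply]
  exact Circle.norm_coe _

theorem tsum_enorm_fourierCoeffOn_sq {P M : ℝ} (hP : 0 < P) {u : ℝ → ℂ} (hu : Measurable u)
    (hM : ∀ t ∈ Set.Ioc 0 P, ‖u t‖ ≤ M) :
    ∑' m : ℤ, ‖fourierCoeffOn hP u m‖ₑ ^ 2
      = ENNReal.ofReal P⁻¹ * ∫⁻ t in Set.Ioc 0 P, ‖u t‖ₑ ^ 2 := by
  have hL : MemLp u 2 (volume.restrict (Set.Ioc 0 P)) := by
    refine MemLp.of_bound hu.aestronglyMeasurable M ?_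
    filter_upwards [ae_restrict_mem measurableSet_Ioc] with t ht
    exact hM t ht
  have h := hasSum_sq_fourierCoeffOn hP hL
  have e : ∀ z : ℂ, ‖z‖ₑ ^ 2 = ENNReal.ofReal (‖z‖ ^ 2) := fun z => by
    rw [ENNReal.ofReal_pow (norm_nonneg _), ofReal_norm]
  simp_rw [e]
  rw [← ENNReal.ofReal_tsum_of_nonneg (fun _ => by positivity) h.summable, h.tsum_eq, sub_zero,
    smul_eq_mul, ENNReal.ofReal_mul (by positivity), intervalIntegral.integral_of_le hP.le,
    ofReal_integral_eq_lintegral_ofReal]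
  · exact hL.integrable_norm_pow (by norm_num)
  · exact Eventually.of_forall fun t => by positivity

theorem fourierCoeffOn_eq_setIntegral {P : ℝ} (hP : 0 < P) (u : ℝ → ℂ) (m : ℤ) :
    fourierCoeffOn hP u m
      = (P⁻¹ : ℝ) * ∫ t in Set.Ioc 0 P, fourier (-m) (t : AddCircle P) * u t := by
  rw [fourierCoeffOn_eq_integral, intervalIntegral.integral_of_le hP.le]
  simp

theorem integrable_fourier_mul {P M : ℝ} {u : ℝ → ℂ} (hu : Measurable u)
    (hM : ∀ t ∈ Set.Ioc 0 P, ‖u t‖ ≤ M) (m : ℤ) :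
    Integrable (fun t : ℝ => fourier m (t : AddCircle P) * u t) (volume.restrict (Set.Ioc 0 P)) := by
  have hc : Continuous fun t : ℝ => fourier m (t : AddCircle P) :=
    (map_continuous (fourier m)).comp (AddCircle.continuous_mk' _)
  have hi : Integrable u (volume.restrict (Set.Ioc 0 P)) := by
    refine Integrable.of_bound hu.aestronglyMeasurable M ?_
    filter_upwards [ae_restrict_mem measurableSet_Ioc] with t ht
    exact hM t ht
  refine hi.bdd_mul (c := 1) hc.aestronglyMeasurable (Eventually.of_forall fun t => ?_)
  exact (norm_fourier_coe m _).le

theorem fourierCoeffOn_sub {P M : ℝ} (hP : 0 < P) {u v : ℝ → ℂ} (hu : Measurable u)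
    (hv : Measurable v) (huM : ∀ t ∈ Set.Ioc 0 P, ‖u t‖ ≤ M) (hvM : ∀ t ∈ Set.Ioc 0 P, ‖v t‖ ≤ M)
    (m : ℤ) :
    fourierCoeffOn hP (fun t => u t - v t) m = fourierCoeffOn hP u m - fourierCoeffOn hP v m := by
  simp only [fourierCoeffOn_eq_setIntegral, mul_sub]
  rw [integral_sub (integrable_fourier_mul hu huM _) (integrable_fourier_mul hv hvM _), mul_sub]

variable {P M : ℝ} (hP : 0 < P) {v : ℝ → ℝ → ℂ} (hv : Measurable (Function.uncurry v))
  (hM : ∀ t ∈ Set.Ioc 0 P, ∀ x, 0 < x → ‖v t x‖ ≤ M) (hv1 : ∀ t x, 1 < x → v t x = 0)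

include hv in
theorem measurable_fourierCoeffOn (m : ℤ) :
    Measurable fun x => fourierCoeffOn hP (fun t => v t x) m := by
  simp only [fourierCoeffOn_eq_setIntegral]
  refine Measurable.const_mul ?_ _
  have hc : Continuous fun t : ℝ => fourier (-m) (t : AddCircle P) :=
    (map_continuous (fourier (-m))).comp (AddCircle.continuous_mk' _)
  have h : Measurable (Function.uncurry fun (x t : ℝ) => fourier (-m) (t : AddCircle P) * v t x) :=
    (hc.measurable.comp measurable_snd).mul (hv.comp measurable_swap)
  exact (StronglyMeasurable.integral_prod_right (ν := volume.restrict (Set.Ioc 0 P))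
    h.stronglyMeasurable).measurable

include hM in
theorem norm_fourierCoeffOn_le (m : ℤ) {x : ℝ} (hx : 0 < x) :
    ‖fourierCoeffOn hP (fun t => v t x) m‖ ≤ M := by
  rw [fourierCoeffOn_eq_setIntegral, norm_mul, Complex.norm_real,
    Real.norm_of_nonneg (by positivity)]
  have h : ‖∫ t in Set.Ioc 0 P, fourier (-m) (t : AddCircle P) * v t x‖ ≤ M * P := by
    have := norm_setIntegral_le_of_norm_le_const (μ := volume) (s := Set.Ioc 0 P) (C := M)
      (f := fun t : ℝ => fourier (-m) (t : AddCircle P) * v t x) (by simp) (fun t ht => by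
        rw [norm_mul, norm_fourier_coe, one_mul]
        exact hM t ht x hx)
    simpa [hP.le] using this
  rw [inv_mul_le_iff₀ hP, mul_comm P]
  exact h

include hv hM in
theorem fourierCoeffOn_integral_sin (ω : ℝ) (m : ℤ) :
    fourierCoeffOn hP (fun t => ∫ x in (0 : ℝ)..1, v t x * Real.sin (ω * x)) m
      = ∫ x in (0 : ℝ)..1, fourierCoeffOn hP (fun t => v t x) m * Real.sin (ω * x) := by
  simp only [fourierCoeffOn_eq_setIntegral, intervalIntegral.integral_of_le zero_le_one, mul_assoc]
  rw [integral_const_mul]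
  congr 1
  have e1 : ∀ t : ℝ, fourier (-m) (t : AddCircle P) *
      ∫ x in Set.Ioc (0 : ℝ) 1, v t x * Real.sin (ω * x)
      = ∫ x in Set.Ioc (0 : ℝ) 1, fourier (-m) (t : AddCircle P) * v t x * Real.sin (ω * x) := by
    intro t
    rw [← integral_const_mul]
    simp_rw [mul_assoc]
  have e2 : ∀ x : ℝ, (∫ t in Set.Ioc 0 P, fourier (-m) (t : AddCircle P) * v t x) * Real.sin (ω * x)
      = ∫ t in Set.Ioc 0 P, fourier (-m) (t : AddCircle P) * v t x * Real.sin (ω * x) := by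
    intro x
    rw [← integral_mul_const]
  simp_rw [e1, e2]
  refine integral_integral_swap ?_
  have hc : Continuous fun t : ℝ => fourier (-m) (t : AddCircle P) :=
    (map_continuous (fourier (-m))).comp (AddCircle.continuous_mk' _)
  refine Integrable.of_bound (C := M) ?_ ?_
  · refine Measurable.aestronglyMeasurable ?_
    exact ((hc.measurable.comp measurable_fst).mul hv).mul
      (Complex.measurable_ofReal.comp
        (Real.measurable_sin.comp (measurable_const.mul measurable_snd)))
  · rw [Measure.prod_restrict]
    filter_upwards [ae_restrict_mem (measurableSet_Ioc.prod measurableSet_Ioc)] with p hp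
    have h1 := hM p.1 hp.1 p.2 hp.2.1
    have h2 := Real.abs_sin_le_one (ω * p.2)
    simp only [Function.uncurry, norm_mul, Complex.norm_real, Real.norm_eq_abs]
    rw [norm_fourier_coe, one_mul]
    exact (mul_le_of_le_one_right (norm_nonneg _) h2).trans h1

theorem measurable_uncurry_incrSq {v : ℝ → ℝ → ℂ} (hv : Measurable (Function.uncurry v)) (h : ℝ) :
    Measurable fun p : ℝ × ℝ => incrSq h (v p.1) p.2 := by
  unfold incrSq
  refine Measurable.add ?_ ?_
  · refine Measurable.ite (measurableSet_Iio.preimage measurable_snd) ?_ measurable_const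
    exact hv.enorm.pow_const 2
  · refine (Measurable.enorm ?_).pow_const 2
    exact (hv.comp (measurable_fst.prodMk (measurable_snd.add_const h))).sub hv

include hv hM in
-- Taking Fourier coefficients in time commutes with increments in space, so Parseval applies at
-- each fixed x.
theorem tsum_incrSq_fourierCoeffOn {h x : ℝ} (hh : 0 ≤ h) (hx : 0 < x) :
    ∑' m : ℤ, incrSq h (fun x => fourierCoeffOn hP (fun t => v t x) m) x
      = ENNReal.ofReal P⁻¹ * ∫⁻ t in Set.Ioc 0 P, incrSq h (v t) x := by
  have hvx : ∀ x, Measurable fun t => v t x := fun x =>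
    hv.comp (measurable_id.prodMk measurable_const)
  have hxh : 0 < x + h := by linarith
  unfold incrSq
  rw [ENNReal.tsum_add]
  have h1 : ∀ m, fourierCoeffOn hP (fun t => v t (x + h)) m - fourierCoeffOn hP (fun t => v t x) m
      = fourierCoeffOn hP (fun t => v t (x + h) - v t x) m := fun m =>
    (fourierCoeffOn_sub hP (hvx _) (hvx _) (fun t ht => hM t ht _ hxh)
      (fun t ht => hM t ht _ hx) m).symm
  simp_rw [h1]
  rw [tsum_enorm_fourierCoeffOn_sq hP (u := fun t => v t (x + h) - v t x)
    ((hvx _).sub (hvx _)) (M := M + M) fun t ht => (norm_sub_le _ _).trans (add_le_add (hM t ht _ hxh) (hM t ht _ hx))]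
  by_cases hxlt : x < h
  · simp only [hxlt, if_true]
    rw [tsum_enorm_fourierCoeffOn_sq hP (hvx _) (M := M) fun t ht => hM t ht _ hx, ← mul_add,
      lintegral_add_left ((hvx _).enorm.pow_const 2)]
  · simp only [hxlt, if_false, tsum_zero, zero_add]

include hv hM in
-- The functional is a positive combination of squared increments, so Parseval in time passes
-- through its sum and integral by Tonelli.
theorem tsum_besov_fourierCoeffOn (s α : ℝ) :
    ∑' m : ℤ, besov s α (fun x => fourierCoeffOn hP (fun t => v t x) m)
      = ENNReal.ofReal P⁻¹ * ∫⁻ t in Set.Ioc 0 P, besov s α (v t) := by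
  have hpm : Measurable fun x : ℝ => ENNReal.ofReal (x ^ α) :=
    (measurable_id.pow_const α).ennreal_ofReal
  unfold besov
  rw [ENNReal.tsum_comm]
  have hin : ∀ k : ℕ, ∑' m : ℤ, ENNReal.ofReal (4 ^ (s * (k + 1))) *
      ∫⁻ x in Set.Ioc (0 : ℝ) 1, ENNReal.ofReal (x ^ α) *
        incrSq (2⁻¹ ^ (k + 1)) (fun x => fourierCoeffOn hP (fun t => v t x) m) x
      = ENNReal.ofReal P⁻¹ * ∫⁻ t in Set.Ioc 0 P, ENNReal.ofReal (4 ^ (s * (k + 1))) *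
        ∫⁻ x in Set.Ioc (0 : ℝ) 1, ENNReal.ofReal (x ^ α) * incrSq (2⁻¹ ^ (k + 1)) (v t) x := by
    intro k
    have hjm : Measurable (Function.uncurry fun (t x : ℝ) =>
        ENNReal.ofReal (x ^ α) * incrSq (2⁻¹ ^ (k + 1)) (v t) x) :=
      (hpm.comp measurable_snd).mul (measurable_uncurry_incrSq hv _)
    have hjm2 : Measurable fun t : ℝ => ∫⁻ x in Set.Ioc (0 : ℝ) 1,
        ENNReal.ofReal (x ^ α) * incrSq (2⁻¹ ^ (k + 1)) (v t) x := hjm.lintegral_prod_right'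
    rw [ENNReal.tsum_mul_left, lintegral_const_mul _ hjm2, ← lintegral_tsum]
    · rw [lintegral_lintegral_swap hjm.aemeasurable]
      rw [mul_left_comm]
      congr 1
      rw [← lintegral_const_mul]
      · refine setLIntegral_congr_fun measurableSet_Ioc fun x hx => ?_
        rw [ENNReal.tsum_mul_left, tsum_incrSq_fourierCoeffOn hP hv hM (by positivity) hx.1,
          lintegral_const_mul]
        · ring
        · exact (measurable_uncurry_incrSq hv _).comp (measurable_id.prodMk measurable_const)
      · exact (hjm.comp measurable_swap).lintegral_prod_right'
    · intro m
      exact (hpm.mul (measurable_incrSq (measurable_fourierCoeffOn hP hv m) _)).aemeasurable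
  simp_rw [hin]
  rw [ENNReal.tsum_mul_left, lintegral_tsum]
  intro k
  have hjm : Measurable (Function.uncurry fun (t x : ℝ) =>
      ENNReal.ofReal (x ^ α) * incrSq (2⁻¹ ^ (k + 1)) (v t) x) :=
    (hpm.comp measurable_snd).mul (measurable_uncurry_incrSq hv _)
  exact (hjm.lintegral_prod_right'.const_mul _).aemeasurable

/-- Weighted space-time bound of the sine-Fourier coefficients, the weight `⟨n² + m⟩^{2b-2}` being
uniformly summable in `n` as `b < 3/4`. -/
theorem exists_tsum_sin_fourierCoeffOn_le {s b α P : ℝ} (hs : 0 ≤ s) (hb : b < 3 / 4)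
    (hα1 : α < 1) (hP : 0 < P) :
    ∃ C : ℝ, 0 < C ∧ ∀ (M : ℝ) (v : ℝ → ℝ → ℂ), Measurable (Function.uncurry v) →
      (∀ t ∈ Set.Ioc 0 P, ∀ x, 0 < x → ‖v t x‖ ≤ M) → (∀ t x, 1 < x → v t x = 0) →
      ∑' n : ℕ, ∑' m : ℤ, ENNReal.ofReal (((n + 1 : ℕ) : ℝ) ^ (2 * s) *
          bracket (((n + 1 : ℕ) : ℝ) ^ 2 + m) ^ (2 * b - 2)) *
        ‖fourierCoeffOn hP
          (fun t => ∫ x in (0 : ℝ)..1, v t x * Real.sin ((n + 1 : ℕ) * Real.pi * x)) m‖ₑ ^ 2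
        ≤ ENNReal.ofReal C * ∫⁻ t in Set.Ioc 0 P, besov s α (v t) := by
  -- The requirement 2 - 2b > 1/2 is exactly b < 3/4.
  obtain ⟨C₁, hC₁, hC⟩ := exists_tsum_bracket_sq_sub_le (β := 2 - 2 * b) (by linarith)
  have hα : 0 < 2 / (1 - α) := div_pos two_pos (by linarith)
  refine ⟨C₁ * (2 / (1 - α)) * P⁻¹, by positivity, fun M v hv hM hv1 => ?_⟩
  -- At fixed m the weighted sine coefficients are bounded uniformly in n, so the sum over n falls
  -- on the modulation weight alone; the sum over m is left for Parseval.
  rw [ENNReal.tsum_comm]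
  have hin : ∀ m : ℤ, ∑' n : ℕ, ENNReal.ofReal (((n + 1 : ℕ) : ℝ) ^ (2 * s) *
          bracket (((n + 1 : ℕ) : ℝ) ^ 2 + m) ^ (2 * b - 2)) *
        ‖fourierCoeffOn hP
          (fun t => ∫ x in (0 : ℝ)..1, v t x * Real.sin ((n + 1 : ℕ) * Real.pi * x)) m‖ₑ ^ 2
      ≤ ENNReal.ofReal C₁ * (ENNReal.ofReal (2 / (1 - α)) *
          besov s α (fun x => fourierCoeffOn hP (fun t => v t x) m)) := by
    intro m
    set F : ℝ → ℂ := fun x => fourierCoeffOn hP (fun t => v t x) m with hF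
    have hFm : Measurable F := measurable_fourierCoeffOn hP hv m
    have hFi : IntegrableOn F (Set.Ioc 0 1) := by
      refine Integrable.of_bound hFm.aestronglyMeasurable M ?_
      filter_upwards [ae_restrict_mem measurableSet_Ioc] with x hx
      exact norm_fourierCoeffOn_le hP hM m hx.1
    have hF1 : ∀ x, 1 < x → F x = 0 := by
      intro x hx
      simp [hF, hv1 _ x hx, fourierCoeffOn_eq_setIntegral]
    have hterm : ∀ n : ℕ, ENNReal.ofReal (((n + 1 : ℕ) : ℝ) ^ (2 * s) *
          bracket (((n + 1 : ℕ) : ℝ) ^ 2 + m) ^ (2 * b - 2)) *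
        ‖fourierCoeffOn hP
          (fun t => ∫ x in (0 : ℝ)..1, v t x * Real.sin ((n + 1 : ℕ) * Real.pi * x)) m‖ₑ ^ 2
        ≤ ENNReal.ofReal (bracket (((n + 1 : ℕ) : ℝ) ^ 2 - (-m : ℤ)) ^ (-(2 - 2 * b))) *
          (ENNReal.ofReal (2 / (1 - α)) * besov s α F) := by
      intro n
      rw [fourierCoeffOn_integral_sin hP hv hM, ENNReal.ofReal_mul (by positivity),
        mul_comm (ENNReal.ofReal _) (ENNReal.ofReal _), mul_assoc]
      have e1 : bracket (((n + 1 : ℕ) : ℝ) ^ 2 - (-m : ℤ)) ^ (-(2 - 2 * b))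
          = bracket (((n + 1 : ℕ) : ℝ) ^ 2 + m) ^ (2 * b - 2) := by
        congr 1
        · congr 1
          push_cast
          ring
        · ring
      rw [e1]
      refine mul_le_mul' le_rfl ?_
      exact rpow_mul_enorm_integral_sin_sq_le hFm hFi hF1 hs hα1 n.succ_ne_zero
    calc _ ≤ _ := ENNReal.tsum_le_tsum hterm
      _ = (∑' n : ℕ, ENNReal.ofReal (bracket (((n + 1 : ℕ) : ℝ) ^ 2 - (-m : ℤ)) ^ (-(2 - 2 * b)))) *
          (ENNReal.ofReal (2 / (1 - α)) * besov s α F) := ENNReal.tsum_mul_right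
      _ ≤ _ := by
          gcongr
          refine le_trans ?_ (hC (-m))
          exact ENNReal.tsum_comp_le_tsum_of_injective (f := fun n : ℕ => n + 1)
            (add_left_injective 1)
            (fun n : ℕ => ENNReal.ofReal (bracket ((n : ℝ) ^ 2 - (-m : ℤ)) ^ (-(2 - 2 * b))))
  calc _ ≤ _ := ENNReal.tsum_le_tsum hin
    _ = ENNReal.ofReal C₁ * (ENNReal.ofReal (2 / (1 - α)) *
        (ENNReal.ofReal P⁻¹ * ∫⁻ t in Set.Ioc 0 P, besov s α (v t))) := by
        rw [ENNReal.tsum_mul_left, ENNReal.tsum_mul_left, tsum_besov_fourierCoeffOn hP hv hM]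
    _ = _ := by
        rw [ENNReal.ofReal_mul (by positivity), ENNReal.ofReal_mul hC₁.le]
        ring

end SpaceTime

end BallNLS

namespace BallNLS

/-! ### Gaussian moments of the potential, the initial datum and the cubic term. -/

section Moments

theorem pow_lintegral_le {Y : Type*} [MeasurableSpace Y] (m : Measure Y) {f : Y → ℝ≥0∞}
    (hf : AEMeasurable f m) (p : ℕ) :
    (∫⁻ y, f y ∂m) ^ (p + 1) ≤ m Set.univ ^ p * ∫⁻ y, f y ^ (p + 1) ∂m := by
  rcases Nat.eq_zero_or_pos p with rfl | hp
  · simp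
  have hpR : (0 : ℝ) < p := by exact_mod_cast hp
  have hc : ((p + 1 : ℕ) : ℝ).HolderConjugate (((p : ℝ) + 1) / p) := by
    rw [Real.holderConjugate_iff]
    constructor
    · push_cast; linarith
    · push_cast; field_simp; ring
  have h := ENNReal.lintegral_mul_le_Lp_mul_Lq m hc hf (aemeasurable_const (b := (1 : ℝ≥0∞)))
  simp only [Pi.mul_apply, mul_one, ENNReal.one_rpow, lintegral_const, one_mul,
    ENNReal.rpow_natCast] at h
  calc (∫⁻ y, f y ∂m) ^ (p + 1)
      ≤ ((∫⁻ y, f y ^ (p + 1) ∂m) ^ (1 / ((p + 1 : ℕ) : ℝ)) *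
          m Set.univ ^ (1 / (((p : ℝ) + 1) / p))) ^ (p + 1) := by gcongr
    _ = m Set.univ ^ p * ∫⁻ y, f y ^ (p + 1) ∂m := by
      rw [mul_pow, ← ENNReal.rpow_natCast, ← ENNReal.rpow_natCast, ← ENNReal.rpow_mul,
        ← ENNReal.rpow_mul, one_div_mul_cancel (by positivity), ENNReal.rpow_one, mul_comm]
      congr 1
      rw [← ENNReal.rpow_natCast]
      congr 1
      push_cast
      field_simp

/-- Jensen's inequality for the moments of an average of nonnegative random variables. -/
theorem lintegral_pow_lintegral_le {X Y : Type*} [MeasurableSpace X] [MeasurableSpace Y]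
    (μ : Measure X) [SFinite μ] (m : Measure Y) [SFinite m] {F : X → Y → ℝ≥0∞}
    (hF : Measurable (Function.uncurry F)) (p : ℕ) {B : ℝ≥0∞}
    (hB : ∀ᵐ y ∂m, ∫⁻ x, F x y ^ p ∂μ ≤ B) (h0 : p = 0 → μ Set.univ ≤ B) :
    ∫⁻ x, (∫⁻ y, F x y ∂m) ^ p ∂μ ≤ m Set.univ ^ p * B := by
  rcases p with _ | p
  · simpa using h0 rfl
  have hFp : Measurable (Function.uncurry fun x y => F x y ^ (p + 1)) := hF.pow_const (p + 1)
  calc ∫⁻ x, (∫⁻ y, F x y ∂m) ^ (p + 1) ∂μ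
      ≤ ∫⁻ x, m Set.univ ^ p * ∫⁻ y, F x y ^ (p + 1) ∂m ∂μ := by
        refine lintegral_mono fun x => pow_lintegral_le m ?_ p
        exact (hF.comp measurable_prodMk_left).aemeasurable
    _ = m Set.univ ^ p * ∫⁻ x, ∫⁻ y, F x y ^ (p + 1) ∂m ∂μ :=
        lintegral_const_mul _ hFp.lintegral_prod_right'
    _ = m Set.univ ^ p * ∫⁻ y, ∫⁻ x, F x y ^ (p + 1) ∂μ ∂m := by
        rw [lintegral_lintegral_swap hFp.aemeasurable]
    _ ≤ m Set.univ ^ p * ∫⁻ _, B ∂m := by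
        exact mul_le_mul' le_rfl (lintegral_mono_ae hB)
    _ = m Set.univ ^ (p + 1) * B := by
        rw [lintegral_const, pow_succ]
        ring

/-- The two bounds combine to |βᵢ| ≤ 3δ/(1 + δ(i+1)), and the squares of these are dominated by the
increments of 9δ(1 - 1/(1 + δi)), which telescope. The point is a bound linear in δ and independent
of N; it provides the Brownian-type variances. -/
theorem sum_sq_le_of_le_min {N : ℕ} {β : Fin N → ℝ} {δ : ℝ} (hδ : 0 < δ)
    (h1 : ∀ i, |β i| ≤ δ) (h2 : ∀ i : Fin N, |β i| ≤ 2 / ((i : ℕ) + 1)) :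
    ∑ i, β i ^ 2 ≤ 9 * δ := by
  have hstep : ∀ i : Fin N, β i ^ 2 ≤
      9 * δ * (1 - 1 / (1 + δ * ((i : ℕ) + 1 : ℕ))) - 9 * δ * (1 - 1 / (1 + δ * ((i : ℕ) : ℕ))) := by
    intro i
    have hi : (0 : ℝ) ≤ (i : ℕ) := by positivity
    have hd : 0 < 1 + δ * ((i : ℕ) : ℝ) := by positivity
    have hd1 : 0 < 1 + δ * (((i : ℕ) : ℝ) + 1) := by positivity
    have h3 : |β i| * (1 + δ * (((i : ℕ) : ℝ) + 1)) ≤ 3 * δ := by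
      have h4 := h2 i
      rw [le_div_iff₀ (by positivity)] at h4
      nlinarith [h1 i, mul_le_mul_of_nonneg_left h4 hδ.le]
    have h5 : (|β i| * (1 + δ * (((i : ℕ) : ℝ) + 1))) ^ 2 ≤ (3 * δ) ^ 2 := by gcongr
    have h6 : 9 * δ * (1 - 1 / (1 + δ * ((i : ℕ) + 1 : ℕ)))
        - 9 * δ * (1 - 1 / (1 + δ * ((i : ℕ) : ℕ)))
        = 9 * δ ^ 2 / ((1 + δ * (i : ℕ)) * (1 + δ * (((i : ℕ) : ℝ) + 1))) := by
      push_cast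
      field_simp
      ring
    rw [h6, le_div_iff₀ (by positivity)]
    rw [mul_pow, sq_abs] at h5
    calc β i ^ 2 * ((1 + δ * (i : ℕ)) * (1 + δ * (((i : ℕ) : ℝ) + 1)))
        ≤ β i ^ 2 * ((1 + δ * (((i : ℕ) : ℝ) + 1)) * (1 + δ * (((i : ℕ) : ℝ) + 1))) := by
          gcongr
          linarith
      _ ≤ 9 * δ ^ 2 := by nlinarith [h5]
  calc ∑ i, β i ^ 2 ≤ ∑ i : Fin N, (9 * δ * (1 - 1 / (1 + δ * ((i : ℕ) + 1 : ℕ)))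
        - 9 * δ * (1 - 1 / (1 + δ * ((i : ℕ) : ℕ)))) := Finset.sum_le_sum fun i _ => hstep i
    _ = ∑ i ∈ Finset.range N, (9 * δ * (1 - 1 / (1 + δ * (i + 1 : ℕ)))
        - 9 * δ * (1 - 1 / (1 + δ * (i : ℕ)))) :=
        Fin.sum_univ_eq_sum_range (fun i : ℕ => 9 * δ * (1 - 1 / (1 + δ * (i + 1 : ℕ)))
          - 9 * δ * (1 - 1 / (1 + δ * (i : ℕ)))) N
    _ = 9 * δ * (1 - 1 / (1 + δ * N)) - 9 * δ * (1 - 1 / (1 + δ * (0 : ℕ))) :=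
        Finset.sum_range_sub (fun i : ℕ => 9 * δ * (1 - 1 / (1 + δ * i))) N
    _ ≤ 9 * δ := by
        have : 0 ≤ 9 * δ * (1 / (1 + δ * (N : ℝ))) := by positivity
        rw [Nat.cast_zero, mul_zero, add_zero, div_one, sub_self, mul_zero, sub_zero, mul_sub,
          mul_one]
        linarith

/-- `sin((i+1)πx)/((i+1)π)` on `x ≤ 1`, extended by zero. -/
noncomputable def sineMode (i : ℕ) (x : ℝ) : ℝ :=
  if x ≤ 1 then Real.sin ((i + 1 : ℕ) * Real.pi * x) / ((i + 1 : ℕ) * Real.pi) else 0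

theorem abs_sin_mul_sub_div_le {ω x y : ℝ} (hω : 0 < ω) :
    |Real.sin (ω * x) / ω - Real.sin (ω * y) / ω| ≤ |x - y| := by
  rw [← sub_div, abs_div, abs_of_pos hω, div_le_iff₀ hω]
  have h := Real.lipschitzWith_sin.dist_le_mul (ω * x) (ω * y)
  rw [Real.dist_eq, Real.dist_eq, ← mul_sub, abs_mul, abs_of_pos hω] at h
  simpa [mul_comm] using h

theorem sin_nat_succ_mul_pi (i : ℕ) : Real.sin ((i + 1 : ℕ) * Real.pi * 1) = 0 := by
  rw [mul_one]
  exact Real.sin_nat_mul_pi _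

/-- The sine vanishes at 1, so the extension by zero is still 1-Lipschitz. -/
theorem abs_sineMode_sub_le (i : ℕ) {x h : ℝ} (hh : 0 ≤ h) :
    |sineMode i (x + h) - sineMode i x| ≤ h := by
  have hω : 0 < ((i + 1 : ℕ) : ℝ) * Real.pi := by positivity
  unfold sineMode
  split_ifs with h1 h2 h2
  · refine (abs_sin_mul_sub_div_le hω).trans ?_
    simp [abs_of_nonneg hh]
  · linarith
  · have h3 := abs_sin_mul_sub_div_le (x := 1) (y := x) hω
    rw [sin_nat_succ_mul_pi, zero_div] at h3
    refine h3.trans ?_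
    rw [abs_of_nonneg (by linarith)]
    linarith
  · simpa using hh

theorem abs_sineMode_le_inv (i : ℕ) (x : ℝ) : |sineMode i x| ≤ 1 / ((i : ℝ) + 1) := by
  unfold sineMode
  split_ifs with h1
  · rw [abs_div, abs_of_pos (by positivity : 0 < ((i + 1 : ℕ) : ℝ) * Real.pi)]
    have h2 := Real.abs_sin_le_one ((i + 1 : ℕ) * Real.pi * x)
    have h3 := Real.pi_gt_three
    push_cast at h2 ⊢
    gcongr
    nlinarith [(Nat.cast_nonneg i : (0 : ℝ) ≤ i)]
  · simp
    positivity

theorem abs_sineMode_le (i : ℕ) {x : ℝ} (hx : 0 ≤ x) : |sineMode i x| ≤ x := by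
  have h := abs_sineMode_sub_le i (x := 0) hx
  have h0 : sineMode i 0 = 0 := by simp [sineMode]
  rwa [h0, zero_add, sub_zero] at h

theorem measurable_sineMode (i : ℕ) : Measurable (sineMode i) := by
  unfold sineMode
  exact Measurable.ite measurableSet_Iic (by fun_prop) measurable_const

theorem sum_sineMode_sq_le {N : ℕ} {x : ℝ} (hx : 0 < x) :
    ∑ i : Fin N, sineMode i x ^ 2 ≤ 9 * x :=
  sum_sq_le_of_le_min hx (fun i => abs_sineMode_le _ hx.le) fun i =>
    (abs_sineMode_le_inv _ _).trans (by gcongr; norm_num)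

theorem sum_sineMode_sub_sq_le {N : ℕ} (x : ℝ) {h : ℝ} (hh : 0 < h) :
    ∑ i : Fin N, (sineMode i (x + h) - sineMode i x) ^ 2 ≤ 9 * h := by
  refine sum_sq_le_of_le_min hh (fun i => abs_sineMode_sub_le _ hh.le) fun i => ?_
  refine (abs_sub _ _).trans ?_
  have h1 := abs_sineMode_le_inv i (x + h)
  have h2 := abs_sineMode_le_inv i x
  calc _ ≤ _ := add_le_add h1 h2
    _ = _ := by ring

/-- `r f(r)` for the radial function `f(r) = ∑ g_i sin((i+1)πr)/((i+1)πr)`, extended by zero. -/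
noncomputable def profile {N : ℕ} (g : Fin N → ℂ) (x : ℝ) : ℂ :=
  ∑ i, g i * (sineMode i x : ℂ)

/-- `r |f(r)|² f(r)` for the radial function `f` with profile `r f(r)`. -/
noncomputable def cubicProfile {N : ℕ} (g : Fin N → ℂ) (x : ℝ) : ℂ :=
  (‖profile g x‖ ^ 2 : ℝ) * profile g x / (x ^ 2 : ℝ)

theorem measurable_uncurry_profile {N : ℕ} :
    Measurable (Function.uncurry (profile : (Fin N → ℂ) → ℝ → ℂ)) := by
  unfold profile Function.uncurry
  refine Finset.measurable_sum _ fun i _ => ?_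
  refine Measurable.mul (by fun_prop) ?_
  exact Complex.measurable_ofReal.comp ((measurable_sineMode _).comp measurable_snd)

theorem measurable_uncurry_cubicProfile {N : ℕ} :
    Measurable (Function.uncurry (cubicProfile : (Fin N → ℂ) → ℝ → ℂ)) := by
  have h := measurable_uncurry_profile (N := N)
  unfold cubicProfile
  refine Measurable.div (Measurable.mul ?_ h) (by fun_prop)
  exact Complex.measurable_ofReal.comp (h.norm.pow_const 2)

/-- The variance of the profile at x is ∑ `sineMode i x`² ≤ 9x, so after division by √x it is at
most 3², uniformly in N and x. -/
theorem lintegral_pow_norm_profile_le {N : ℕ} {x : ℝ} (hx : 0 < x) (q : ℕ) :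
    ∫⁻ g, ENNReal.ofReal ((‖profile g x‖ / √x) ^ q) ∂gaussianLaw (Fin N)
      ≤ ENNReal.ofReal (8 * (q.factorial * 6 ^ q)) := by
  have hsx : 0 < √x := Real.sqrt_pos.2 hx
  have hβ : ∑ i : Fin N, (sineMode i x / √x) ^ 2 ≤ 3 ^ 2 := by
    simp_rw [div_pow, ← Finset.sum_div, Real.sq_sqrt hx.le]
    rw [div_le_iff₀ hx]
    linarith [sum_sineMode_sq_le (N := N) hx]
  have h := lintegral_pow_norm_gaussianLaw_le _ (by norm_num : (0 : ℝ) < 3) hβ q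
  rw [show (2 : ℝ) * 3 = 6 by norm_num] at h
  refine le_trans (le_of_eq ?_) h
  refine lintegral_congr fun g => ?_
  congr 2
  nth_rewrite 1 [← Real.norm_of_nonneg hsx.le]
  rw [profile, ← Complex.norm_real, ← norm_div, Finset.sum_div]
  push_cast
  simp_rw [mul_div_assoc]

theorem lintegral_pow_norm_profile_sub_le {N : ℕ} (x : ℝ) {h : ℝ} (hh : 0 < h) (q : ℕ) :
    ∫⁻ g, ENNReal.ofReal ((‖profile g (x + h) - profile g x‖ / √h) ^ q) ∂gaussianLaw (Fin N)
      ≤ ENNReal.ofReal (8 * (q.factorial * 6 ^ q)) := by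
  have hsx : 0 < √h := Real.sqrt_pos.2 hh
  have hβ : ∑ i : Fin N, ((sineMode i (x + h) - sineMode i x) / √h) ^ 2 ≤ 3 ^ 2 := by
    simp_rw [div_pow, ← Finset.sum_div, Real.sq_sqrt hh.le]
    rw [div_le_iff₀ hh]
    linarith [sum_sineMode_sub_sq_le (N := N) x hh]
  have h' := lintegral_pow_norm_gaussianLaw_le _ (by norm_num : (0 : ℝ) < 3) hβ q
  rw [show (2 : ℝ) * 3 = 6 by norm_num] at h'
  refine le_trans (le_of_eq ?_) h'
  refine lintegral_congr fun g => ?_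
  congr 2
  nth_rewrite 1 [← Real.norm_of_nonneg hsx.le]
  rw [profile, profile, ← Finset.sum_sub_distrib, ← Complex.norm_real, ← norm_div, Finset.sum_div]
  push_cast
  simp_rw [← mul_sub, mul_div_assoc]

theorem norm_sq_mul_sub_le (a b : ℂ) :
    ‖((‖b‖ ^ 2 : ℝ) : ℂ) * b - ((‖a‖ ^ 2 : ℝ) : ℂ) * a‖
      ≤ 3 / 2 * ‖b - a‖ * (‖a‖ ^ 2 + ‖b‖ ^ 2) := by
  have e : ((‖b‖ ^ 2 : ℝ) : ℂ) * b - ((‖a‖ ^ 2 : ℝ) : ℂ) * a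
      = (((‖b‖ ^ 2 + ‖a‖ ^ 2) / 2 : ℝ) : ℂ) * (b - a)
        + (((‖b‖ - ‖a‖) * (‖b‖ + ‖a‖) / 2 : ℝ) : ℂ) * (b + a) := by
    push_cast
    ring
  rw [e]
  have h1 : |‖b‖ - ‖a‖| ≤ ‖b - a‖ := abs_norm_sub_norm_le b a
  have h2 : ‖b + a‖ ≤ ‖b‖ + ‖a‖ := norm_add_le b a
  have h3 := norm_nonneg a
  have h4 := norm_nonneg b
  have h5 := norm_nonneg (b - a)
  refine (norm_add_le _ _).trans ?_
  rw [norm_mul, norm_mul, Complex.norm_real, Complex.norm_real,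
    Real.norm_of_nonneg (by positivity), Real.norm_eq_abs, abs_div, abs_mul,
    abs_of_nonneg (by positivity : 0 ≤ ‖b‖ + ‖a‖), abs_two]
  have h6 : |‖b‖ - ‖a‖| * (‖b‖ + ‖a‖) / 2 * ‖b + a‖
      ≤ ‖b - a‖ * (‖b‖ + ‖a‖) / 2 * (‖b‖ + ‖a‖) := by gcongr
  have h7 : ‖b - a‖ * (‖b‖ + ‖a‖) ^ 2 ≤ ‖b - a‖ * (2 * (‖a‖ ^ 2 + ‖b‖ ^ 2)) := by
    gcongr
    nlinarith [sq_nonneg (‖a‖ - ‖b‖)]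
  nlinarith

theorem sq_mul_pow_four_le {a b : ℝ} (ha : 0 ≤ a) (hb : 0 ≤ b) : a ^ 2 * b ^ 4 ≤ a ^ 6 + b ^ 6 := by
  rcases le_total a b with h | h
  · have : a ^ 2 * b ^ 4 ≤ b ^ 2 * b ^ 4 := by gcongr
    nlinarith [pow_nonneg ha 6]
  · have : a ^ 2 * b ^ 4 ≤ a ^ 2 * a ^ 4 := by gcongr
    nlinarith [pow_nonneg hb 6]

/-- Here a and b are profile values at x and x + h, and G1, G2, G3 are their sizes and that of their
difference in Gaussian units √x, √(x+h), √h. The difference splits into a variation of the numerator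
and a variation of 1/x²; for h ≤ x both have squared size at most h/x² times sixth powers of the
G's. -/
theorem norm_cubic_quotient_sub_sq_le {a b : ℂ} {x h G1 G2 G3 : ℝ} (hx : 0 < x) (hh : 0 < h)
    (hlt : h ≤ x) (hG1 : 0 ≤ G1) (hG2 : 0 ≤ G2) (hG3 : 0 ≤ G3) (sq1 : ‖a‖ ^ 2 = x * G1 ^ 2)
    (sq2 : ‖b‖ ^ 2 = (x + h) * G2 ^ 2) (sq3 : ‖b - a‖ ^ 2 = h * G3 ^ 2) :
    ‖((‖b‖ ^ 2 : ℝ) : ℂ) * b / (((x + h) ^ 2 : ℝ) : ℂ) - ((‖a‖ ^ 2 : ℝ) : ℂ) * a / ((x ^ 2 : ℝ) : ℂ)‖ ^ 2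
      ≤ (h / x) / x * (18 * (G1 ^ 6 + G2 ^ 6 + G3 ^ 6)) := by
  obtain ⟨y, hy⟩ : ∃ y, y = x + h := ⟨_, rfl⟩
  rw [← hy] at sq2 ⊢
  have hy0 : 0 < y := by linarith
  have hxy : x ≤ y := by linarith
  have hhx : h / x ≤ 1 := by rw [div_le_one hx]; exact hlt
  have hd0 : 0 ≤ 1 / x ^ 2 - 1 / y ^ 2 := by
    rw [sub_nonneg]
    gcongr
  have hd1 : 1 / x ^ 2 - 1 / y ^ 2 ≤ 2 * h / x ^ 3 := by
    rw [div_sub_div _ _ (by positivity) (by positivity), div_le_div_iff₀ (by positivity)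
      (by positivity), hy]
    have : 0 ≤ h ^ 2 * x ^ 3 * (3 * x + 2 * h) := by positivity
    nlinarith
  have hn : ‖((‖b‖ ^ 2 : ℝ) : ℂ) * b / ((y ^ 2 : ℝ) : ℂ) - ((‖a‖ ^ 2 : ℝ) : ℂ) * a / ((x ^ 2 : ℝ) : ℂ)‖
      ≤ 3 / 2 * ‖b - a‖ * (‖a‖ ^ 2 + ‖b‖ ^ 2) / y ^ 2 + (1 / x ^ 2 - 1 / y ^ 2) * ‖a‖ ^ 3 := by
    have hsplit : ((‖b‖ ^ 2 : ℝ) : ℂ) * b / ((y ^ 2 : ℝ) : ℂ)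
        - ((‖a‖ ^ 2 : ℝ) : ℂ) * a / ((x ^ 2 : ℝ) : ℂ)
        = (((‖b‖ ^ 2 : ℝ) : ℂ) * b - ((‖a‖ ^ 2 : ℝ) : ℂ) * a) / ((y ^ 2 : ℝ) : ℂ)
          - ((1 / x ^ 2 - 1 / y ^ 2 : ℝ) : ℂ) * (((‖a‖ ^ 2 : ℝ) : ℂ) * a) := by
      push_cast
      ring
    rw [hsplit]
    refine (norm_sub_le _ _).trans (add_le_add ?_ (le_of_eq ?_))
    · rw [norm_div, Complex.norm_real, Real.norm_of_nonneg (by positivity)]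
      gcongr
      exact norm_sq_mul_sub_le a b
    · rw [norm_mul, norm_mul, Complex.norm_real, Complex.norm_real,
        Real.norm_of_nonneg hd0, Real.norm_of_nonneg (by positivity)]
      ring
  have hA : (3 / 2 * ‖b - a‖ * (‖a‖ ^ 2 + ‖b‖ ^ 2) / y ^ 2) ^ 2
      ≤ 9 / 2 * (h / x) / x * (G3 ^ 2 * G1 ^ 4 + G3 ^ 2 * G2 ^ 4) := by
    have h2 : ‖a‖ ^ 2 + ‖b‖ ^ 2 ≤ y * (G1 ^ 2 + G2 ^ 2) := by
      rw [sq1, sq2]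
      have : x * G1 ^ 2 ≤ y * G1 ^ 2 := by gcongr
      linarith
    have h3 : (G1 ^ 2 + G2 ^ 2) ^ 2 ≤ 2 * (G1 ^ 4 + G2 ^ 4) := by
      nlinarith [sq_nonneg (G1 ^ 2 - G2 ^ 2)]
    calc (3 / 2 * ‖b - a‖ * (‖a‖ ^ 2 + ‖b‖ ^ 2) / y ^ 2) ^ 2
        ≤ (3 / 2 * ‖b - a‖ * (y * (G1 ^ 2 + G2 ^ 2)) / y ^ 2) ^ 2 := by gcongr
      _ = 9 / 4 * ‖b - a‖ ^ 2 * (G1 ^ 2 + G2 ^ 2) ^ 2 / y ^ 2 := by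
          field_simp
          ring
      _ ≤ 9 / 4 * (h * G3 ^ 2) * (2 * (G1 ^ 4 + G2 ^ 4)) / x ^ 2 := by
          rw [sq3]
          gcongr
      _ = _ := by ring
  have hB : ((1 / x ^ 2 - 1 / y ^ 2) * ‖a‖ ^ 3) ^ 2 ≤ 4 * (h / x) / x * G1 ^ 6 := by
    calc ((1 / x ^ 2 - 1 / y ^ 2) * ‖a‖ ^ 3) ^ 2 ≤ (2 * h / x ^ 3 * ‖a‖ ^ 3) ^ 2 := by gcongr
      _ = (2 * h / x ^ 3) ^ 2 * (‖a‖ ^ 2) ^ 3 := by ring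
      _ = 4 * (h / x) * (h / x) / x * G1 ^ 6 := by rw [sq1]; field_simp; ring
      _ ≤ 4 * (h / x) * 1 / x * G1 ^ 6 := by gcongr
      _ = _ := by ring
  have j1 := sq_mul_pow_four_le hG3 hG1
  have j2 := sq_mul_pow_four_le hG3 hG2
  have j3 : 9 * (G3 ^ 2 * G1 ^ 4 + G3 ^ 2 * G2 ^ 4) + 8 * G1 ^ 6
      ≤ 18 * (G1 ^ 6 + G2 ^ 6 + G3 ^ 6) := by
    linarith [pow_nonneg hG1 6, pow_nonneg hG2 6]
  calc _ ≤ (3 / 2 * ‖b - a‖ * (‖a‖ ^ 2 + ‖b‖ ^ 2) / y ^ 2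
        + (1 / x ^ 2 - 1 / y ^ 2) * ‖a‖ ^ 3) ^ 2 := by gcongr
    _ ≤ 2 * ((3 / 2 * ‖b - a‖ * (‖a‖ ^ 2 + ‖b‖ ^ 2) / y ^ 2) ^ 2
        + ((1 / x ^ 2 - 1 / y ^ 2) * ‖a‖ ^ 3) ^ 2) := add_sq_le
    _ ≤ 2 * (9 / 2 * (h / x) / x * (G3 ^ 2 * G1 ^ 4 + G3 ^ 2 * G2 ^ 4)
        + 4 * (h / x) / x * G1 ^ 6) := by gcongr
    _ = (h / x) / x * (9 * (G3 ^ 2 * G1 ^ 4 + G3 ^ 2 * G2 ^ 4) + 8 * G1 ^ 6) := by ring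
    _ ≤ _ := by gcongr

/-- For x < h each value is bounded separately and gives 1/x; for h ≤ x the difference gives h/x².
Both are at most h^θ x^{-1-θ} for every θ in [0, 1]. -/
theorem incrSq_cubicProfile_le {N : ℕ} (g : Fin N → ℂ) {θ x h : ℝ} (hθ0 : 0 ≤ θ) (hθ1 : θ ≤ 1)
    (hx : 0 < x) (hh : 0 < h) :
    incrSq h (cubicProfile g) x ≤ ENNReal.ofReal (18 * h ^ θ * x ^ (-1 - θ)) *
      (ENNReal.ofReal ((‖profile g x‖ / √x) ^ 6) +
        ENNReal.ofReal ((‖profile g (x + h)‖ / √(x + h)) ^ 6) +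
        ENNReal.ofReal ((‖profile g (x + h) - profile g x‖ / √h) ^ 6)) := by
  set a := profile g x with ha
  set b := profile g (x + h) with hb
  set y := x + h with hy
  have hy0 : 0 < y := by linarith
  obtain ⟨G1, hG1, eG1⟩ : ∃ G, 0 ≤ G ∧ G = ‖a‖ / √x := ⟨_, by positivity, rfl⟩
  obtain ⟨G2, hG2, eG2⟩ : ∃ G, 0 ≤ G ∧ G = ‖b‖ / √y := ⟨_, by positivity, rfl⟩
  obtain ⟨G3, hG3, eG3⟩ : ∃ G, 0 ≤ G ∧ G = ‖b - a‖ / √h := ⟨_, by positivity, rfl⟩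
  have sq1 : ‖a‖ ^ 2 = x * G1 ^ 2 := by
    rw [eG1, div_pow, Real.sq_sqrt hx.le]; field_simp
  have sq2 : ‖b‖ ^ 2 = y * G2 ^ 2 := by
    rw [eG2, div_pow, Real.sq_sqrt hy0.le]; field_simp
  have sq3 : ‖b - a‖ ^ 2 = h * G3 ^ 2 := by
    rw [eG3, div_pow, Real.sq_sqrt hh.le]; field_simp
  rw [← eG1, ← eG2, ← eG3, ← ENNReal.ofReal_add (by positivity) (by positivity),
    ← ENNReal.ofReal_add (by positivity) (by positivity), ← ENNReal.ofReal_mul (by positivity)]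
  have e : ∀ z : ℂ, ‖z‖ₑ ^ 2 = ENNReal.ofReal (‖z‖ ^ 2) := fun z => by
    rw [ENNReal.ofReal_pow (norm_nonneg _), ofReal_norm]
  have hWx : ‖cubicProfile g x‖ ^ 2 = G1 ^ 6 / x := by
    rw [cubicProfile, ← ha, norm_div, norm_mul, Complex.norm_real, Complex.norm_real,
      Real.norm_of_nonneg (by positivity), Real.norm_of_nonneg (by positivity), div_pow, mul_pow,
      sq1]
    field_simp
  have hWy : ‖cubicProfile g y‖ ^ 2 = G2 ^ 6 / y := by
    rw [cubicProfile, ← hb, norm_div, norm_mul, Complex.norm_real, Complex.norm_real,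
      Real.norm_of_nonneg (by positivity), Real.norm_of_nonneg (by positivity), div_pow, mul_pow,
      sq2]
    field_simp
  have hxr : h ^ θ * x ^ (-1 - θ) = (h / x) ^ θ / x := by
    rw [Real.div_rpow hh.le hx.le, Real.rpow_sub hx, Real.rpow_neg_one]
    field_simp
  have key : (if x < h then ‖cubicProfile g x‖ ^ 2 else 0)
      + ‖cubicProfile g y - cubicProfile g x‖ ^ 2
      ≤ 18 * h ^ θ * x ^ (-1 - θ) * (G1 ^ 6 + G2 ^ 6 + G3 ^ 6) := by
    rw [mul_assoc 18, hxr]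
    split_ifs with hlt
    · have h1 : 1 ≤ (h / x) ^ θ :=
        Real.one_le_rpow (by rw [one_le_div hx]; exact hlt.le) hθ0
      have h2 : ‖cubicProfile g y - cubicProfile g x‖ ^ 2 ≤
          2 * (‖cubicProfile g y‖ ^ 2 + ‖cubicProfile g x‖ ^ 2) := by
        have := norm_sub_le (cubicProfile g y) (cubicProfile g x)
        calc _ ≤ (‖cubicProfile g y‖ + ‖cubicProfile g x‖) ^ 2 := by gcongr
          _ ≤ _ := by nlinarith [sq_nonneg (‖cubicProfile g y‖ - ‖cubicProfile g x‖)]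
      rw [hWx, hWy] at h2
      have h3 : G2 ^ 6 / y ≤ G2 ^ 6 / x := by gcongr; linarith
      rw [hWx]
      calc G1 ^ 6 / x + ‖cubicProfile g y - cubicProfile g x‖ ^ 2
          ≤ 3 * (G1 ^ 6 / x) + 2 * (G2 ^ 6 / x) := by linarith
        _ ≤ 18 * (1 / x) * (G1 ^ 6 + G2 ^ 6 + G3 ^ 6) := by
          have i1 : 0 ≤ G1 ^ 6 / x := by positivity
          have i2 : 0 ≤ G2 ^ 6 / x := by positivity
          have i3 : 0 ≤ G3 ^ 6 / x := by positivity
          have : 18 * (1 / x) * (G1 ^ 6 + G2 ^ 6 + G3 ^ 6)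
            = 18 * (G1 ^ 6 / x + G2 ^ 6 / x + G3 ^ 6 / x) := by ring
          linarith
        _ ≤ _ := by gcongr
    · push Not at hlt
      have hhx : h / x ≤ 1 := by rw [div_le_one hx]; exact hlt
      have h1 : h / x ≤ (h / x) ^ θ := by
        have := Real.rpow_le_rpow_of_exponent_ge (by positivity) hhx hθ1
        rwa [Real.rpow_one] at this
      have h2 := norm_cubic_quotient_sub_sq_le hx hh hlt hG1 hG2 hG3 sq1 sq2 sq3
      rw [zero_add]
      calc ‖cubicProfile g y - cubicProfile g x‖ ^ 2
          ≤ (h / x) / x * (18 * (G1 ^ 6 + G2 ^ 6 + G3 ^ 6)) := h2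
        _ ≤ (h / x) ^ θ / x * (18 * (G1 ^ 6 + G2 ^ 6 + G3 ^ 6)) := by gcongr
        _ = _ := by ring
  refine le_trans (le_of_eq ?_) (ENNReal.ofReal_le_ofReal key)
  rw [incrSq, ENNReal.ofReal_add (by split_ifs <;> positivity) (by positivity), e, e]
  congr 1
  split_ifs <;> simp

theorem summable_nat_succ_rpow {r : ℝ} (hr : r < -1) :
    Summable fun n : ℕ => ((n : ℝ) + 1) ^ r := by
  have := (summable_nat_add_iff 1).2 (Real.summable_nat_rpow.2 hr)
  simpa using this

/-- Moments of the quartic potential. -/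
theorem lintegral_pow_quartic_le (N p : ℕ) :
    ∫⁻ g, (∫⁻ x in Set.Ioc (0 : ℝ) 1, ENNReal.ofReal (‖profile g x‖ ^ 4 / x ^ 2)) ^ p
        ∂gaussianLaw (Fin N)
      ≤ ENNReal.ofReal (8 * (6 ^ 4) ^ p * (4 * p).factorial) := by
  have hF : Measurable (Function.uncurry fun (g : Fin N → ℂ) x =>
      ENNReal.ofReal (‖profile g x‖ ^ 4 / x ^ 2)) :=
    ((measurable_uncurry_profile.norm.pow_const 4).div
      (measurable_snd.pow_const 2)).ennreal_ofReal
  refine (lintegral_pow_lintegral_le _ _ hF p (B := ENNReal.ofReal (8 * (6 ^ 4) ^ p *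
    (4 * p).factorial)) ?_ ?_).trans (le_of_eq ?_)
  -- The integrand is the fourth power of |profile|/√x, a Gaussian of bounded variance at every x,
  -- so Jensen's inequality on (0, 1] costs nothing.
  · filter_upwards [ae_restrict_mem measurableSet_Ioc] with x hx
    refine le_trans (le_of_eq ?_) ((lintegral_pow_norm_profile_le (N := N) hx.1 (4 * p)).trans
      (le_of_eq ?_))
    · refine lintegral_congr fun g => ?_
      rw [← ENNReal.ofReal_pow (by positivity), pow_mul, div_pow _ (√x) 4,
        show √x ^ 4 = (√x ^ 2) ^ 2 by ring, Real.sq_sqrt hx.1.le]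
    · congr 1
      rw [pow_mul]
      ring
  · rintro rfl
    simp
  · simp

/-- Moments of the weighted sum of squares of the Gaussians. -/
theorem exists_lintegral_pow_sum_sq_le {s : ℝ} (hs : s < 1 / 2) :
    ∃ B : ℝ, 0 < B ∧ ∀ N p : ℕ,
      ∫⁻ g, (∑ i : Fin N, ENNReal.ofReal (((i : ℕ) + 1 : ℝ) ^ (2 * s - 2) * ‖g i‖ ^ 2)) ^ p
        ∂gaussianLaw (Fin N) ≤ ENNReal.ofReal (8 * B ^ p * (2 * p).factorial) := by
  have hsum := summable_nat_succ_rpow (r := 2 * s - 2) (by linarith)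
  set S := ∑' n : ℕ, ((n : ℝ) + 1) ^ (2 * s - 2) with hS
  have hS0 : 0 ≤ S := tsum_nonneg fun n => by positivity
  refine ⟨4 * (S + 1), by positivity, fun N p => ?_⟩
  -- The weighted sum becomes an integral against a measure of mass at most S + 1, finite uniformly
  -- in N because 2s - 2 < -1; Jensen's inequality then reduces to a single Gaussian.
  set m : Measure (Fin N) := Measure.count.withDensity fun i =>
    ENNReal.ofReal (((i : ℕ) + 1 : ℝ) ^ (2 * s - 2)) with hm
  have hmu : m Set.univ ≤ ENNReal.ofReal (S + 1) := by
    rw [hm, withDensity_apply _ MeasurableSet.univ, Measure.restrict_univ, lintegral_count,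
      tsum_fintype, ← ENNReal.ofReal_sum_of_nonneg fun _ _ => by positivity]
    refine ENNReal.ofReal_le_ofReal ?_
    rw [Fin.sum_univ_eq_sum_range (fun i : ℕ => ((i : ℝ) + 1) ^ (2 * s - 2))]
    have := hsum.sum_le_tsum (Finset.range N) fun i _ => by positivity
    linarith
  have hF : Measurable (Function.uncurry fun (g : Fin N → ℂ) (i : Fin N) =>
      ENNReal.ofReal (‖g i‖ ^ 2)) := by
    refine measurable_from_prod_countable_left fun i => ?_
    simp only [Function.uncurry]
    fun_prop
  have h := lintegral_pow_lintegral_le (gaussianLaw (Fin N)) m hF p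
    (B := ENNReal.ofReal (8 * 4 ^ p * (2 * p).factorial)) ?_ ?_
  · calc _ = _ := ?_
      _ ≤ _ := h
      _ ≤ ENNReal.ofReal (S + 1) ^ p * ENNReal.ofReal (8 * 4 ^ p * (2 * p).factorial) := by gcongr
      _ = _ := by
        rw [← ENNReal.ofReal_pow (by positivity), ← ENNReal.ofReal_mul (by positivity), mul_pow]
        congr 1
        ring
    refine lintegral_congr fun g => ?_
    congr 1
    rw [hm, lintegral_withDensity_eq_lintegral_mul _ (measurable_of_finite _)
      (measurable_of_finite _), lintegral_count, tsum_fintype]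
    refine Finset.sum_congr rfl fun i _ => ?_
    rw [ENNReal.ofReal_mul (by positivity)]
    rfl
  · refine Eventually.of_forall fun i => ?_
    have hβ : ∑ j : Fin N, (if j = i then (1 : ℝ) else 0) ^ 2 ≤ 1 ^ 2 := by simp
    refine le_trans (le_of_eq ?_)
      ((lintegral_pow_norm_gaussianLaw_le _ one_pos hβ (2 * p)).trans (le_of_eq ?_))
    · refine lintegral_congr fun g => ?_
      rw [← ENNReal.ofReal_pow (by positivity), pow_mul, Finset.sum_eq_single i]
      · simp
      · intro j _ hj
        simp [hj]
      · simp
    · congr 1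
      rw [mul_one, pow_mul]
      norm_num
      ring
  · rintro rfl
    simp

/-- The Gaussian factor in the bound for `incrSq (2⁻¹ ^ (k + 1)) (cubicProfile g) x`. -/
noncomputable def incrFactor {N : ℕ} (g : Fin N → ℂ) (y : ℕ × ℝ) : ℝ≥0∞ :=
  ENNReal.ofReal ((‖profile g y.2‖ / √y.2) ^ 6) +
    ENNReal.ofReal ((‖profile g (y.2 + 2⁻¹ ^ (y.1 + 1))‖ / √(y.2 + 2⁻¹ ^ (y.1 + 1))) ^ 6) +
    ENNReal.ofReal ((‖profile g (y.2 + 2⁻¹ ^ (y.1 + 1)) - profile g y.2‖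
      / √(2⁻¹ ^ (y.1 + 1))) ^ 6)

theorem measurable_uncurry_incrFactor {N : ℕ} :
    Measurable (Function.uncurry (incrFactor : (Fin N → ℂ) → ℕ × ℝ → ℝ≥0∞)) := by
  have hyk : Measurable fun q : (Fin N → ℂ) × (ℕ × ℝ) => (2⁻¹ : ℝ) ^ (q.2.1 + 1) :=
    (measurable_from_nat (f := fun k : ℕ => (2⁻¹ : ℝ) ^ (k + 1))).comp
      (measurable_fst.comp measurable_snd)
  have hy2 : Measurable fun q : (Fin N → ℂ) × (ℕ × ℝ) => q.2.2 := measurable_snd.comp measurable_snd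
  have hP1 : Measurable fun q : (Fin N → ℂ) × (ℕ × ℝ) => profile q.1 q.2.2 :=
    measurable_uncurry_profile.comp (measurable_fst.prodMk hy2)
  have hP2 : Measurable fun q : (Fin N → ℂ) × (ℕ × ℝ) =>
      profile q.1 (q.2.2 + 2⁻¹ ^ (q.2.1 + 1)) :=
    measurable_uncurry_profile.comp (measurable_fst.prodMk (hy2.add hyk))
  have m1 := ((hP1.norm.div hy2.sqrt).pow_const 6).ennreal_ofReal
  have m2 := ((hP2.norm.div (hy2.add hyk).sqrt).pow_const 6).ennreal_ofReal
  have m3 := (((hP2.sub hP1).norm.div hyk.sqrt).pow_const 6).ennreal_ofReal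
  exact (m1.add m2).add m3

theorem add_add_pow_le (a b d : ℝ≥0∞) (p : ℕ) :
    (a + b + d) ^ p ≤ 3 ^ p * (a ^ p + b ^ p + d ^ p) := by
  have hmax : a + b + d ≤ 3 * max a (max b d) := by
    have h1 : a ≤ max a (max b d) := le_max_left _ _
    have h2 : b ≤ max a (max b d) := (le_max_left _ _).trans (le_max_right _ _)
    have h3 : d ≤ max a (max b d) := (le_max_right _ _).trans (le_max_right _ _)
    calc a + b + d ≤ max a (max b d) + max a (max b d) + max a (max b d) := by gcongr
      _ = _ := by ring
  refine (pow_le_pow_left' hmax p).trans ?_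
  rw [mul_pow]
  refine mul_le_mul' le_rfl ?_
  rcases max_choice a (max b d) with e | e
  · rw [e, add_assoc]; exact le_self_add
  · rw [e]
    rcases max_choice b d with e | e
    · rw [e, add_right_comm]; exact le_add_self
    · rw [e]; exact le_add_self

/-- The constant 24 is 3 · 8 from the three Gaussian terms, and 3^p comes from the power of a sum of
three. -/
theorem lintegral_incrFactor_pow_le {N : ℕ} (p : ℕ) {y : ℕ × ℝ} (hy : 0 < y.2) :
    ∫⁻ g : Fin N → ℂ, incrFactor g y ^ p ∂gaussianLaw (Fin N)
      ≤ ENNReal.ofReal (24 * (3 * 6 ^ 6) ^ p * (6 * p).factorial) := by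
  have hh : (0 : ℝ) < 2⁻¹ ^ (y.1 + 1) := by positivity
  have hpos : 0 < y.2 + 2⁻¹ ^ (y.1 + 1) := add_pos hy hh
  have m1 := lintegral_pow_norm_profile_le (N := N) hy (6 * p)
  have m2 := lintegral_pow_norm_profile_le (N := N) hpos (6 * p)
  have m3 := lintegral_pow_norm_profile_sub_le (N := N) y.2 hh (6 * p)
  have n1 : Measurable fun g : Fin N → ℂ => profile g y.2 :=
    measurable_uncurry_profile.comp measurable_prodMk_right
  have n2 : Measurable fun g : Fin N → ℂ => profile g (y.2 + 2⁻¹ ^ (y.1 + 1)) :=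
    measurable_uncurry_profile.comp measurable_prodMk_right
  have eF : ∀ g : Fin N → ℂ, incrFactor g y ^ p ≤ 3 ^ p *
      (ENNReal.ofReal ((‖profile g y.2‖ / √y.2) ^ (6 * p)) +
        ENNReal.ofReal ((‖profile g (y.2 + 2⁻¹ ^ (y.1 + 1))‖ / √(y.2 + 2⁻¹ ^ (y.1 + 1)))
          ^ (6 * p)) +
        ENNReal.ofReal ((‖profile g (y.2 + 2⁻¹ ^ (y.1 + 1)) - profile g y.2‖
          / √(2⁻¹ ^ (y.1 + 1))) ^ (6 * p))) := by
    intro g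
    refine (add_add_pow_le _ _ _ p).trans (le_of_eq ?_)
    simp only [pow_mul]
    rw [ENNReal.ofReal_pow (n := p) (by positivity), ENNReal.ofReal_pow (n := p) (by positivity),
      ENNReal.ofReal_pow (n := p) (by positivity)]
  refine (lintegral_mono eF).trans ?_
  rw [lintegral_const_mul' _ _ (by simp), lintegral_add_left, lintegral_add_left]
  · refine (mul_le_mul' le_rfl (add_le_add (add_le_add m1 m2) m3)).trans (le_of_eq ?_)
    rw [← ENNReal.ofReal_add (by positivity) (by positivity),
      ← ENNReal.ofReal_add (by positivity) (by positivity),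
      show (3 : ℝ≥0∞) = ENNReal.ofReal 3 by norm_num, ← ENNReal.ofReal_pow (by norm_num),
      ← ENNReal.ofReal_mul (by positivity)]
    congr 1
    rw [mul_pow, pow_mul]
    ring
  · exact ((n1.norm.div_const _).pow_const _).ennreal_ofReal
  · exact (((n1.norm.div_const _).pow_const _).ennreal_ofReal).add
      (((n2.norm.div_const _).pow_const _).ennreal_ofReal)

/-- The scale weights of the Besov functional, together with the decay of the increments. -/
noncomputable def scaleWeight (s θ : ℝ) (k : ℕ) : ℝ :=
  4 ^ (s * (k + 1)) * (18 * (2⁻¹ ^ (k + 1)) ^ θ)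

theorem scaleWeight_nonneg (s θ : ℝ) (k : ℕ) : 0 ≤ scaleWeight s θ k := by
  unfold scaleWeight
  positivity

/-- A geometric series of ratio 2^{2s-θ}: regularity s is paid for by the decay h^θ of the
increments. -/
theorem summable_scaleWeight {s θ : ℝ} (hθ : 2 * s < θ) : Summable (scaleWeight s θ) := by
  have hq : (2 : ℝ) ^ (2 * s - θ) < 1 := Real.rpow_lt_one_of_one_lt_of_neg one_lt_two (by linarith)
  have hg := (summable_geometric_of_lt_one (by positivity) hq).mul_left (18 * 2 ^ (2 * s - θ))
  refine hg.congr fun k => ?_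
  have e1 : (4 : ℝ) ^ (s * (k + 1)) = 2 ^ (2 * s * (k + 1)) := by
    rw [show (4 : ℝ) = 2 ^ (2 : ℝ) by norm_num, ← Real.rpow_mul (by norm_num)]
    congr 1
    ring
  have e2 : ((2⁻¹ : ℝ) ^ (k + 1)) ^ θ = 2 ^ (-θ * (k + 1)) := by
    rw [← Real.rpow_natCast, ← Real.rpow_neg_one, ← Real.rpow_mul (by norm_num),
      ← Real.rpow_mul (by norm_num)]
    congr 1
    push_cast
    ring
  unfold scaleWeight
  rw [e1, e2, ← Real.rpow_natCast, ← Real.rpow_mul (by norm_num), mul_assoc,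
    ← Real.rpow_add two_pos, mul_left_comm, ← Real.rpow_add two_pos]
  congr 2
  ring

theorem besov_cubicProfile_le {s θ α : ℝ} (hθ0 : 0 ≤ θ) (hθ1 : θ ≤ 1) {N : ℕ} (g : Fin N → ℂ) :
    besov s α (cubicProfile g) ≤ ∑' k, ∫⁻ x in Set.Ioc (0 : ℝ) 1,
      ENNReal.ofReal (scaleWeight s θ k) * ENNReal.ofReal (x ^ (α - 1 - θ)) *
        incrFactor g (k, x) := by
  refine ENNReal.tsum_le_tsum fun k => ?_
  rw [← lintegral_const_mul' _ _ ENNReal.ofReal_ne_top]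
  refine setLIntegral_mono_ae' measurableSet_Ioc (Eventually.of_forall fun x hx => ?_)
  have hx0 := hx.1
  refine (mul_le_mul' le_rfl (mul_le_mul' le_rfl
    (incrSq_cubicProfile_le g hθ0 hθ1 hx0 (h := 2⁻¹ ^ (k + 1)) (by positivity)))).trans
    (le_of_eq ?_)
  rw [← mul_assoc, ← mul_assoc, ← ENNReal.ofReal_mul (by positivity),
    ← ENNReal.ofReal_mul (by positivity), ← ENNReal.ofReal_mul (scaleWeight_nonneg _ _ _)]
  congr 2
  rw [show α - 1 - θ = α + (-1 - θ) by ring, Real.rpow_add hx0, scaleWeight]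
  ring

/-- Moments of the Besov functional of the cubic term. -/
theorem exists_lintegral_pow_besov_le {s θ α : ℝ} (hs : 0 ≤ s) (hθ : 2 * s < θ) (hθ1 : θ ≤ 1)
    (hα : θ < α) :
    ∃ B : ℝ, 0 < B ∧ ∀ N p : ℕ,
      ∫⁻ g : Fin N → ℂ, besov s α (cubicProfile g) ^ p ∂gaussianLaw (Fin N)
        ≤ ENNReal.ofReal (24 * B ^ p * (6 * p).factorial) := by
  have hθ0 : 0 ≤ θ := by linarith
  set S := ∑' k, scaleWeight s θ k with hS
  have hS0 : 0 ≤ S := tsum_nonneg (scaleWeight_nonneg s θ)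
  have hαθ : 0 < α - θ := by linarith
  set L : ℝ := S * (1 / (α - θ)) with hL
  have hL0 : 0 ≤ L := by positivity
  refine ⟨3 * 6 ^ 6 * (L + 1), by positivity, fun N p => ?_⟩
  set w : ℕ × ℝ → ℝ≥0∞ := fun y =>
    ENNReal.ofReal (scaleWeight s θ y.1) * ENNReal.ofReal (y.2 ^ (α - 1 - θ)) with hw
  have hxm : Measurable fun x : ℝ => ENNReal.ofReal (x ^ (α - 1 - θ)) :=
    (measurable_id.pow_const _).ennreal_ofReal
  have hwm : Measurable w :=
    ((measurable_from_nat (f := fun k => ENNReal.ofReal (scaleWeight s θ k))).comp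
      measurable_fst).mul (hxm.comp measurable_snd)
  set m0 : Measure (ℕ × ℝ) := Measure.count.prod (volume.restrict (Set.Ioc 0 1)) with hm0
  -- Scales and positions are merged into one finite measure space: the scales converge because 2s <
  -- θ, the integral of x^{α-1-θ} because θ < α. The functional is thus dominated by one average of
  -- sixth powers of Gaussians, and Jensen's inequality applies once.
  set m : Measure (ℕ × ℝ) := m0.withDensity w with hm
  have hmu : m Set.univ ≤ ENNReal.ofReal (L + 1) := by
    rw [hm, withDensity_apply _ MeasurableSet.univ, Measure.restrict_univ, hm0,
      lintegral_prod _ hwm.aemeasurable, lintegral_count]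
    simp only [hw]
    have e : ∀ k, ∫⁻ x in Set.Ioc (0 : ℝ) 1,
        ENNReal.ofReal (scaleWeight s θ k) * ENNReal.ofReal (x ^ (α - 1 - θ))
        = ENNReal.ofReal (scaleWeight s θ k) * ENNReal.ofReal (1 / (α - θ)) := by
      intro k
      rw [lintegral_const_mul _ hxm]
      have := lintegral_rpow_neg_Ioc (α := 1 - (α - θ)) (by linarith)
      rw [show -(1 - (α - θ)) = α - 1 - θ by ring, show 1 - (1 - (α - θ)) = α - θ by ring] at this
      rw [this]
    simp_rw [e]
    rw [ENNReal.tsum_mul_right,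
      ← ENNReal.ofReal_tsum_of_nonneg (scaleWeight_nonneg s θ) (summable_scaleWeight hθ),
      ← ENNReal.ofReal_mul hS0]
    exact ENNReal.ofReal_le_ofReal (by linarith)
  have hFm := measurable_uncurry_incrFactor (N := N)
  have hbes : ∀ g : Fin N → ℂ, besov s α (cubicProfile g) ≤ ∫⁻ y, incrFactor g y ∂m := by
    intro g
    have hFg : Measurable (incrFactor g) := hFm.of_uncurry_left
    rw [hm, lintegral_withDensity_eq_lintegral_mul _ hwm hFg, hm0,
      lintegral_prod _ (hwm.mul hFg).aemeasurable, lintegral_count]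
    exact besov_cubicProfile_le hθ0 hθ1 g
  have hae : ∀ᵐ y ∂m, y.2 ∈ Set.Ioc (0 : ℝ) 1 :=
    (withDensity_absolutelyContinuous m0 w).ae_le
      (Measure.quasiMeasurePreserving_snd.ae (ae_restrict_mem measurableSet_Ioc))
  obtain ⟨B, hB⟩ : ∃ B, B = ENNReal.ofReal (24 * (3 * 6 ^ 6) ^ p * (6 * p).factorial) := ⟨_, rfl⟩
  have hBm : ∀ᵐ y ∂m, ∫⁻ g : Fin N → ℂ, incrFactor g y ^ p ∂gaussianLaw (Fin N) ≤ B := by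
    filter_upwards [hae] with y hy
    rw [hB]
    exact lintegral_incrFactor_pow_le p hy.1
  have hB0 : p = 0 → gaussianLaw (Fin N) Set.univ ≤ B := by
    rintro rfl
    rw [hB]
    simp
  have h := lintegral_pow_lintegral_le (gaussianLaw (Fin N)) m hFm p hBm hB0
  rw [hB] at h
  calc _ ≤ _ := lintegral_mono fun g => pow_le_pow_left' (hbes g) p
    _ ≤ _ := h
    _ ≤ ENNReal.ofReal (L + 1) ^ p *
        ENNReal.ofReal (24 * (3 * 6 ^ 6) ^ p * (6 * p).factorial) :=
        mul_le_mul' (pow_le_pow_left' hmu p) le_rfl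
    _ = _ := by
      rw [← ENNReal.ofReal_pow (by positivity), ← ENNReal.ofReal_mul (by positivity),
        mul_pow _ (L + 1)]
      congr 1
      ring

end Moments

end BallNLS

namespace BallNLS

/-! ### Radial calculus on the ball: Laplacian, polar coordinates, orthogonality. -/

section Radial

/-- Composing with |y|² rather than |y| makes the inner map polynomial. The second derivative along
v is 4⟨x,v⟩² G₂ + 2|v|² G₁; summing over an orthonormal basis of a space of dimension three gives
the 6. -/
theorem laplacian_comp_norm_sq {G G₁ G₂ : ℝ → ℂ} (h1 : ∀ q, 0 < q → HasDerivAt G (G₁ q) q)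
    (h2 : ∀ q, 0 < q → HasDerivAt G₁ (G₂ q) q) {x : E3} (hx : x ≠ 0) :
    Laplacian.laplacian (fun y : E3 => G (‖y‖ ^ 2)) x
      = 4 * (‖x‖ ^ 2 : ℝ) * G₂ (‖x‖ ^ 2) + 6 * G₁ (‖x‖ ^ 2) := by
  have hq : ∀ y : E3, y ≠ 0 → 0 < ‖y‖ ^ 2 := fun y hy => by positivity
  have hN : ∀ y : E3, HasFDerivAt (fun z : E3 => ‖z‖ ^ 2) (2 • innerSL ℝ y) y := fun y =>
    (hasStrictFDerivAt_norm_sq y).hasFDerivAt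
  have hf1 : ∀ y : E3, y ≠ 0 → HasFDerivAt (fun z : E3 => G (‖z‖ ^ 2))
      ((2 • innerSL ℝ y).smulRight (G₁ (‖y‖ ^ 2))) y := by
    intro y hy
    refine ((h1 _ (hq y hy)).hasFDerivAt.comp y (hN y)).congr_fderiv ?_
    ext v
    simp [mul_assoc]
  have hev : fderiv ℝ (fun z : E3 => G (‖z‖ ^ 2))
      =ᶠ[𝓝 x] fun y => (2 • innerSL ℝ y).smulRight (G₁ (‖y‖ ^ 2)) := by
    filter_upwards [isOpen_ne.mem_nhds hx] with y hy
    exact (hf1 y hy).fderiv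
  have hG1 : HasFDerivAt (fun z : E3 => G₁ (‖z‖ ^ 2))
      ((2 • innerSL ℝ x).smulRight (G₂ (‖x‖ ^ 2))) x := by
    refine ((h2 _ (hq x hx)).hasFDerivAt.comp x (hN x)).congr_fderiv ?_
    ext v
    simp [mul_assoc]
  have hline : ∀ v : E3, fderiv ℝ (fun y : E3 =>
      (2 • innerSL ℝ y : E3 →L[ℝ] ℝ).smulRight (G₁ (‖y‖ ^ 2))) x v v
      = 4 * ((inner ℝ x v) ^ 2 : ℝ) * G₂ (‖x‖ ^ 2) + 2 * (‖v‖ ^ 2 : ℝ) * G₁ (‖x‖ ^ 2) := by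
    intro v
    have hd : DifferentiableAt ℝ (fun y : E3 =>
      (2 • innerSL ℝ y : E3 →L[ℝ] ℝ).smulRight (G₁ (‖y‖ ^ 2))) x := by
      have h3 : DifferentiableAt ℝ (fun y : E3 => (2 • innerSL ℝ y : E3 →L[ℝ] ℝ)) x :=
        ((innerSL ℝ (E := E3)).differentiableAt).const_smul 2
      have h4 := (isBoundedBilinearMap_smulRight (𝕜 := ℝ) (E := E3) (F := ℂ)).differentiableAt
        (2 • innerSL ℝ x, G₁ (‖x‖ ^ 2))
      exact h4.comp x (h3.prodMk hG1.differentiableAt)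
    have hv : HasFDerivAt (fun y : E3 =>
        ((2 • innerSL ℝ y : E3 →L[ℝ] ℝ).smulRight (G₁ (‖y‖ ^ 2))) v)
        ((ContinuousLinearMap.apply ℝ ℂ v).comp (fderiv ℝ (fun y : E3 =>
          (2 • innerSL ℝ y : E3 →L[ℝ] ℝ).smulRight (G₁ (‖y‖ ^ 2))) x)) x :=
      (ContinuousLinearMap.apply ℝ ℂ v).hasFDerivAt.comp x hd.hasFDerivAt
    have hv' : HasFDerivAt (fun y : E3 =>
        ((2 • innerSL ℝ y : E3 →L[ℝ] ℝ).smulRight (G₁ (‖y‖ ^ 2))) v)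
        ((2 * inner ℝ x v) • ((2 • innerSL ℝ x).smulRight (G₂ (‖x‖ ^ 2)))
          + (2 • innerSL ℝ v : E3 →L[ℝ] ℝ).smulRight (G₁ (‖x‖ ^ 2))) x := by
      have hi : HasFDerivAt (fun y : E3 => 2 * inner ℝ y v) (2 • innerSL ℝ v : E3 →L[ℝ] ℝ) x := by
        have h3 : HasFDerivAt (fun y : E3 => inner ℝ v y) (innerSL ℝ v : E3 →L[ℝ] ℝ) x :=
          (innerSL ℝ v).hasFDerivAt
        have h4 := h3.const_smul (2 : ℝ)
        refine (h4.congr_of_eventuallyEq (Eventually.of_forall fun y => ?_)).congr_fderiv ?_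
        · simp [real_inner_comm]
        · ext; simp
      refine (hi.smul hG1).congr_of_eventuallyEq (Eventually.of_forall fun y => ?_)
      simp
    have := congrArg (fun L => L v) (hv.unique hv')
    simp only [ContinuousLinearMap.comp_apply, ContinuousLinearMap.apply_apply] at this
    rw [this]
    simp
    ring
  rw [InnerProductSpace.laplacian_eq_iteratedFDeriv_orthonormalBasis _
    (EuclideanSpace.basisFun (Fin 3) ℝ)]
  simp only [iteratedFDeriv_two_apply, hev.fderiv_eq]
  simp only [Matrix.cons_val_zero, Matrix.cons_val_one, hline]
  rw [EuclideanSpace.norm_sq_eq]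
  simp only [Fin.sum_univ_three, EuclideanSpace.basisFun_apply, EuclideanSpace.inner_single_right]
  simp
  ring

/-- The frequency `(i+1)π` of the mode of index `i`. -/
noncomputable def freq (i : ℕ) : ℝ := (i + 1 : ℕ) * Real.pi

theorem freq_pos (i : ℕ) : 0 < freq i := by
  unfold freq
  positivity

/-- The radial function `∑ gᵢ sin(ωᵢ|x|)/(ωᵢ|x|)`, `ωᵢ = (i+1)π`. -/
noncomputable def radialSum {N : ℕ} (g : Fin N → ℂ) (r : ℝ) : ℂ :=
  ∑ i, g i * (Real.sinc (freq i * r) : ℂ)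

/-- Each sin(ω|x|)/(ω|x|) is an eigenfunction for -ω², checked through its derivatives in q = |x|².
The origin is excluded because √q is not smooth there, and it is never needed. -/
theorem laplacian_radialSum {N : ℕ} (g : Fin N → ℂ) {x : E3} (hx : x ≠ 0) :
    Laplacian.laplacian (fun y : E3 => radialSum g ‖y‖) x
      = radialSum (fun i => -(freq i ^ 2 : ℝ) * g i) ‖x‖ := by
  set G : ℝ → ℂ := fun q => radialSum g √q with hG
  set S : ℕ → ℝ → ℝ := fun i q => Real.sin (freq i * √q) with hS
  set C : ℕ → ℝ → ℝ := fun i q => Real.cos (freq i * √q) with hC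
  set A₁ : ℕ → ℝ → ℝ := fun i q => C i q / (2 * q) - S i q / (2 * freq i * (q * √q)) with hA1
  set A₂ : ℕ → ℝ → ℝ := fun i q => -freq i * S i q / (4 * (q * √q)) - 3 * C i q / (4 * q ^ 2)
    + 3 * S i q / (4 * freq i * (q ^ 2 * √q)) with hA2
  have hs : ∀ i q, 0 < q → HasDerivAt (S i) (C i q * (freq i * (1 / (2 * √q)))) q := fun i q hq =>
    ((Real.hasDerivAt_sqrt hq.ne').const_mul (freq i)).sin
  have hc : ∀ i q, 0 < q → HasDerivAt (C i) (-S i q * (freq i * (1 / (2 * √q)))) q := fun i q hq =>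
    ((Real.hasDerivAt_sqrt hq.ne').const_mul (freq i)).cos
  have hd0 : ∀ i q, 0 < q → HasDerivAt (fun q => Real.sinc (freq i * √q)) (A₁ i q) q := by
    intro i q hq
    have hω := freq_pos i
    have hr : 0 < √q := Real.sqrt_pos.2 hq
    have h := (hs i q hq).div ((Real.hasDerivAt_sqrt hq.ne').const_mul (freq i)) (by positivity)
    refine (h.congr_of_eventuallyEq ?_).congr_deriv ?_
    · filter_upwards [lt_mem_nhds hq] with p hp
      have hrp : 0 < √p := Real.sqrt_pos.2 hp
      rw [Real.sinc_of_ne_zero (by positivity)]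
      rfl
    · simp only [hA1]
      generalize S i q = s
      generalize C i q = c
      obtain ⟨r, hr2⟩ : ∃ r, r = √q := ⟨_, rfl⟩
      have hq2 : q = r ^ 2 := by rw [hr2, Real.sq_sqrt hq.le]
      rw [← hr2] at hr ⊢
      rw [hq2]
      field_simp
  have hd1 : ∀ i q, 0 < q → HasDerivAt (A₁ i) (A₂ i q) q := by
    intro i q hq
    have hω := freq_pos i
    have hr : 0 < √q := Real.sqrt_pos.2 hq
    have h := ((hc i q hq).div ((hasDerivAt_id q).const_mul 2) (by simpa using hq.ne')).sub
      ((hs i q hq).div (((hasDerivAt_id q).mul (Real.hasDerivAt_sqrt hq.ne')).const_mul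
        (2 * freq i)) (by
        have : 0 < 2 * freq i * (q * √q) := by positivity
        exact this.ne'))
    refine h.congr_deriv ?_
    simp only [hA2, id]
    generalize S i q = s
    generalize C i q = c
    obtain ⟨r, hr2⟩ : ∃ r, r = √q := ⟨_, rfl⟩
    have hq2 : q = r ^ 2 := by rw [hr2, Real.sq_sqrt hq.le]
    simp only [Pi.mul_apply, id]
    rw [← hr2] at hr ⊢
    rw [hq2]
    field_simp
    ring
  have e0 : (fun y : E3 => radialSum g ‖y‖) = fun y => G (‖y‖ ^ 2) := by
    funext y
    simp only [hG, Real.sqrt_sq (norm_nonneg y)]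
  have h1 : ∀ q, 0 < q → HasDerivAt G (∑ i : Fin N, g i * (A₁ i q : ℂ)) q := fun q hq =>
    HasDerivAt.fun_sum fun i _ => ((hd0 i q hq).ofReal_comp).const_mul (g i)
  have h2 : ∀ q, 0 < q → HasDerivAt (fun q => ∑ i : Fin N, g i * (A₁ i q : ℂ))
      (∑ i : Fin N, g i * (A₂ i q : ℂ)) q := fun q hq =>
    HasDerivAt.fun_sum fun i _ => ((hd1 i q hq).ofReal_comp).const_mul (g i)
  have hr : 0 < ‖x‖ := norm_pos_iff.2 hx
  rw [e0, laplacian_comp_norm_sq h1 h2 hx, radialSum, Finset.mul_sum, Finset.mul_sum,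
    ← Finset.sum_add_distrib]
  refine Finset.sum_congr rfl fun i _ => ?_
  have hω := freq_pos i
  have key : 4 * ‖x‖ ^ 2 * A₂ i (‖x‖ ^ 2) + 6 * A₁ i (‖x‖ ^ 2)
      = -(freq i ^ 2) * Real.sinc (freq i * ‖x‖) := by
    rw [Real.sinc_of_ne_zero (by positivity)]
    simp only [hA1, hA2, hS, hC, Real.sqrt_sq hr.le]
    field_simp
    ring
  have key' := congrArg (fun z : ℝ => (z : ℂ)) key
  push_cast at key' ⊢
  linear_combination (g i) * key'

/-- Polar coordinates: 3|B| is the area of the unit sphere, a factor that cancels in the quotient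
`coeff`. -/
theorem integral_ball_norm (F : ℝ → ℂ) :
    ∫ x, F ‖x‖ ∂ballMeasure
      = (3 * volume.real (Metric.ball (0 : E3) 1) : ℝ) * ∫ r in (0 : ℝ)..1, (r ^ 2 : ℝ) * F r := by
  have h := integral_fun_norm_addHaar (volume : Measure E3) ((Set.Iio (1 : ℝ)).indicator F)
  have h1 : ∫ x, F ‖x‖ ∂ballMeasure = ∫ x : E3, (Set.Iio (1 : ℝ)).indicator F ‖x‖ := by
    rw [ballMeasure, ← integral_indicator (by exact measurableSet_ball)]
    congr 1
    funext x
    simp [Set.indicator, unitBall]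
  rw [h1, h, intervalIntegral.integral_of_le zero_le_one, integral_Ioc_eq_integral_Ioo]
  have h2 : ∀ y : ℝ, y ^ (Module.finrank ℝ E3 - 1) • (Set.Iio (1 : ℝ)).indicator F y
      = (Set.Iio (1 : ℝ)).indicator (fun r => ((r ^ 2 : ℝ) : ℂ) * F r) y := by
    intro y
    simp only [Set.indicator]
    split_ifs <;> simp
  simp_rw [h2]
  rw [setIntegral_indicator measurableSet_Iio, Set.Ioi_inter_Iio]
  simp
  ring

theorem integral_ball_norm_real (F : ℝ → ℝ) :
    ∫ x, F ‖x‖ ∂ballMeasure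
      = (3 * volume.real (Metric.ball (0 : E3) 1) : ℝ) * ∫ r in (0 : ℝ)..1, r ^ 2 * F r := by
  have h := integral_ball_norm fun r => (F r : ℂ)
  rw [integral_complex_ofReal] at h
  simp only [← Complex.ofReal_mul] at h
  rw [intervalIntegral.integral_ofReal, ← Complex.ofReal_mul] at h
  exact_mod_cast h

theorem eigenfunction_eq_freq (i : ℕ) (x : E3) :
    eigenfunction (i + 1) x = freq i * Real.sinc (freq i * ‖x‖) := rfl

theorem mul_sinc_freq (i : ℕ) (r : ℝ) :
    r * (freq i * Real.sinc (freq i * r)) = Real.sin (freq i * r) := by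
  rcases eq_or_ne r 0 with rfl | hr
  · simp
  · have := freq_pos i
    rw [Real.sinc_of_ne_zero (by positivity)]
    field_simp

theorem integral_cos_int_mul_pi {k : ℤ} (hk : k ≠ 0) :
    ∫ r in (0 : ℝ)..1, Real.cos (k * Real.pi * r) = 0 := by
  have hkR : (k : ℝ) * Real.pi ≠ 0 := mul_ne_zero (by exact_mod_cast hk) Real.pi_ne_zero
  rw [intervalIntegral.integral_comp_mul_left _ hkR]
  simp [Real.sin_int_mul_pi]

theorem integral_sin_mul_sin (i j : ℕ) :
    ∫ r in (0 : ℝ)..1, Real.sin (freq i * r) * Real.sin (freq j * r)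
      = if i = j then 1 / 2 else 0 := by
  have e : ∀ r : ℝ, Real.sin (freq i * r) * Real.sin (freq j * r)
      = 1 / 2 * (Real.cos (((i - j : ℤ) : ℝ) * Real.pi * r)
        - Real.cos (((i + j + 2 : ℤ) : ℝ) * Real.pi * r)) := by
    intro r
    have h1 : ((i - j : ℤ) : ℝ) * Real.pi * r = freq i * r - freq j * r := by
      unfold freq; push_cast; ring
    have h2 : ((i + j + 2 : ℤ) : ℝ) * Real.pi * r = freq i * r + freq j * r := by
      unfold freq; push_cast; ring
    rw [h1, h2, Real.cos_sub, Real.cos_add]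
    ring
  simp_rw [e]
  rw [intervalIntegral.integral_const_mul, intervalIntegral.integral_sub
    (Continuous.intervalIntegrable (by fun_prop) _ _)
    (Continuous.intervalIntegrable (by fun_prop) _ _), integral_cos_int_mul_pi (k := i + j + 2) (by omega),
    sub_zero]
  split_ifs with h
  · simp [h]
  · rw [integral_cos_int_mul_pi (by omega), mul_zero]

/-- The weight r² and the factor 1/r in the eigenfunction combine, so coefficients are sine
coefficients of rF(r); the 2 is the inverse of ∫₀¹ sin². -/
theorem coeff_radial (i : ℕ) {f : E3 → ℂ} {F : ℝ → ℂ} (hf : f =ᵐ[ballMeasure] fun x => F ‖x‖) :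
    coeff (i + 1) f = 2 * ∫ r in (0 : ℝ)..1, r * F r * Real.sin (freq i * r) := by
  have hB : 0 < volume.real (Metric.ball (0 : E3) 1) := by
    rw [measureReal_def]
    exact ENNReal.toReal_pos (Metric.measure_ball_pos _ _ one_pos).ne' measure_ball_lt_top.ne
  have hnum : ∫ x, f x * (eigenfunction (i + 1) x : ℂ) ∂ballMeasure
      = (3 * volume.real (Metric.ball (0 : E3) 1) : ℝ) *
        ∫ r in (0 : ℝ)..1, r * F r * Real.sin (freq i * r) := by
    have h1 : ∫ x, f x * (eigenfunction (i + 1) x : ℂ) ∂ballMeasure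
        = ∫ x, F ‖x‖ * ((freq i * Real.sinc (freq i * ‖x‖) : ℝ) : ℂ) ∂ballMeasure := by
      refine integral_congr_ae ?_
      filter_upwards [hf] with x hx
      rw [hx, eigenfunction_eq_freq]
    rw [h1, integral_ball_norm fun r => F r * ((freq i * Real.sinc (freq i * r) : ℝ) : ℂ)]
    congr 1
    refine intervalIntegral.integral_congr fun r _ => ?_
    rw [← mul_sinc_freq]
    push_cast
    ring
  have hden : ∫ x, eigenfunction (i + 1) x ^ 2 ∂ballMeasure
      = 3 * volume.real (Metric.ball (0 : E3) 1) * (1 / 2) := by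
    simp_rw [eigenfunction_eq_freq]
    rw [integral_ball_norm_real fun r => (freq i * Real.sinc (freq i * r)) ^ 2]
    congr 1
    have := integral_sin_mul_sin i i
    rw [if_pos rfl] at this
    rw [← this]
    refine intervalIntegral.integral_congr fun r _ => ?_
    rw [← mul_sinc_freq]
    ring
  rw [coeff, hnum, hden]
  have : (volume.real (Metric.ball (0 : E3) 1) : ℂ) ≠ 0 := by exact_mod_cast hB.ne'
  simp only [Complex.ofReal_mul, Complex.ofReal_div, Complex.ofReal_one, Complex.ofReal_ofNat]
  rw [div_eq_iff (by simpa using this)]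
  ring

theorem continuous_radialSum {N : ℕ} (g : Fin N → ℂ) : Continuous (radialSum g) := by
  unfold radialSum
  have := Real.continuous_sinc
  fun_prop

theorem mul_radialSum {N : ℕ} (g : Fin N → ℂ) (r : ℝ) :
    r * radialSum g r = ∑ i, g i / freq i * (Real.sin (freq i * r) : ℂ) := by
  rw [radialSum, Finset.mul_sum]
  refine Finset.sum_congr rfl fun i _ => ?_
  have hω : (freq i : ℂ) ≠ 0 := by exact_mod_cast (freq_pos i).ne'
  rw [← mul_sinc_freq]
  push_cast
  field_simp

theorem integral_radialSum_mul_sin {N : ℕ} (g : Fin N → ℂ) (i : Fin N) :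
    ∫ r in (0 : ℝ)..1, r * radialSum g r * Real.sin (freq i * r) = g i / freq i / 2 := by
  simp_rw [mul_radialSum, Finset.sum_mul]
  rw [intervalIntegral.integral_finsetSum
    fun j _ => Continuous.intervalIntegrable (by fun_prop) _ _]
  have e : ∀ j : Fin N, ∫ r in (0 : ℝ)..1,
      g j / freq j * (Real.sin (freq j * r) : ℂ) * (Real.sin (freq i * r) : ℂ)
      = g j / freq j * ((if (j : ℕ) = i then 1 / 2 else 0 : ℝ) : ℂ) := by
    intro j
    rw [← integral_sin_mul_sin, ← intervalIntegral.integral_ofReal,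
      ← intervalIntegral.integral_const_mul]
    refine intervalIntegral.integral_congr fun r _ => ?_
    push_cast
    ring
  simp_rw [e]
  rw [Finset.sum_eq_single i]
  · simp
    ring
  · intro j _ hj
    rw [if_neg (fun h => hj (Fin.ext h))]
    simp
  · simp

/-- Orthogonality of the sines recovers each coefficient from values on (0, 1) only. Pointwise
identities on the punctured ball thereby become identities between coefficients. -/
theorem radialSum_injective {N : ℕ} {g h : Fin N → ℂ}
    (heq : ∀ r, 0 < r → r < 1 → radialSum g r = radialSum h r) : g = h := by
  funext i
  have h1 : ∫ r in (0 : ℝ)..1, r * radialSum g r * Real.sin (freq i * r)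
      = ∫ r in (0 : ℝ)..1, r * radialSum h r * Real.sin (freq i * r) := by
    simp only [intervalIntegral.integral_of_le zero_le_one, integral_Ioc_eq_integral_Ioo]
    refine setIntegral_congr_fun measurableSet_Ioo fun r hr => ?_
    rw [heq r hr.1 hr.2]
  rw [integral_radialSum_mul_sin, integral_radialSum_mul_sin] at h1
  have hω : (freq i : ℂ) ≠ 0 := by exact_mod_cast (freq_pos i).ne'
  field_simp at h1
  exact h1

end Radial

end BallNLS

namespace BallNLS

/-! ### From the truncated equation to the Hamiltonian system. -/

section Reduction

/-- The functional `F ↦ ∫₀¹ F(r) r² dr` on `C([0,1], ℂ)`. -/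
noncomputable def radialFunctional : C(unitInterval, ℂ) →L[ℂ] ℂ :=
  LinearMap.mkContinuous
    { toFun := fun F => ∫ r in (0 : ℝ)..1, (r ^ 2 : ℝ) * F (Set.projIcc 0 1 zero_le_one r)
      map_add' := fun F G => by
        simp only [ContinuousMap.add_apply, mul_add]
        exact intervalIntegral.integral_add
          (Continuous.intervalIntegrable (by fun_prop) _ _)
          (Continuous.intervalIntegrable (by fun_prop) _ _)
      map_smul' := fun c F => by
        simp only [ContinuousMap.smul_apply, smul_eq_mul, RingHom.id_apply]
        rw [← intervalIntegral.integral_const_mul]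
        refine intervalIntegral.integral_congr fun r _ => ?_
        ring }
    1 (fun F => by
      have h := intervalIntegral.norm_integral_le_of_norm_le_const (a := (0 : ℝ)) (b := 1)
        (f := fun r : ℝ => ((r ^ 2 : ℝ) : ℂ) * F (Set.projIcc 0 1 zero_le_one r)) (C := 1 * ‖F‖)
        (fun r hr => by
          rw [Set.uIoc_of_le zero_le_one] at hr
          rw [norm_mul, Complex.norm_real, Real.norm_of_nonneg (by positivity)]
          gcongr
          · exact pow_le_one₀ hr.1.le hr.2
          · exact F.norm_coe_le_norm _)
      simpa using h)

theorem radialFunctional_apply (F : C(unitInterval, ℂ)) :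
    radialFunctional F = ∫ r in (0 : ℝ)..1, (r ^ 2 : ℝ) * F (Set.projIcc 0 1 zero_le_one r) := rfl

theorem radialFunctional_star (F : C(unitInterval, ℂ)) :
    radialFunctional (star F) = star (radialFunctional F) := by
  rw [radialFunctional_apply, radialFunctional_apply, Complex.star_def,
    intervalIntegral.integral_of_le zero_le_one, intervalIntegral.integral_of_le zero_le_one,
    ← integral_conj]
  congr 1
  funext r
  simp

theorem radialFunctional_eq {F : C(unitInterval, ℂ)} {f : ℝ → ℂ}
    (h : ∀ r (hr : r ∈ Set.Icc (0 : ℝ) 1), F ⟨r, hr⟩ = f r) :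
    radialFunctional F = ∫ r in (0 : ℝ)..1, (r ^ 2 : ℝ) * f r := by
  rw [radialFunctional_apply]
  refine intervalIntegral.integral_congr fun r hr => ?_
  rw [Set.uIcc_of_le zero_le_one] at hr
  rw [Set.projIcc_of_mem _ hr, h]

/-- The radial functions `sin(ωᵢ r)/(ωᵢ r)` on `[0,1]`. -/
noncomputable def radialMode {N : ℕ} (i : Fin N) : C(unitInterval, ℂ) :=
  ⟨fun r => (Real.sinc (freq i * r) : ℂ), by
    have := Real.continuous_sinc
    fun_prop⟩

theorem star_radialMode {N : ℕ} (i : Fin N) : star (radialMode i) = radialMode i := by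
  ext r
  simp [radialMode]

theorem field_radialMode {N : ℕ} (g : Fin N → ℂ) (r : unitInterval) :
    field radialMode g r = radialSum g r := by
  simp [field, radialSum, radialMode, ContinuousMap.sum_apply]

theorem cubic_radialMode {N : ℕ} (g : Fin N → ℂ) (i : Fin N) :
    cubic radialFunctional radialMode g i = 2 * ∫ r in (0 : ℝ)..1, (r ^ 2 : ℝ) *
      ((‖radialSum g r‖ ^ 2 : ℝ) * radialSum g r * (Real.sinc (freq i * r) : ℂ)) := by
  rw [cubic, radialFunctional_eq]
  intro r hr
  simp only [ContinuousMap.mul_apply, ContinuousMap.star_apply, field_radialMode]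
  rw [mul_assoc (radialSum g r) (radialSum g r), mul_left_comm, Complex.star_def,
    Complex.mul_conj, Complex.normSq_eq_norm_sq]
  simp only [radialMode, ContinuousMap.coe_mk]
  ring

theorem potential_radialMode {N : ℕ} (g : Fin N → ℂ) :
    potential radialFunctional radialMode g = ∫ r in (0 : ℝ)..1, r ^ 2 * ‖radialSum g r‖ ^ 4 := by
  rw [potential, radialFunctional_eq (f := fun r => ((‖radialSum g r‖ ^ 4 : ℝ) : ℂ))]
  · simp_rw [← Complex.ofReal_mul]
    rw [intervalIntegral.integral_ofReal, Complex.ofReal_re]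
  · intro r hr
    simp only [ContinuousMap.mul_apply, ContinuousMap.star_apply, field_radialMode]
    have h : radialSum g r * star (radialSum g r) = ((‖radialSum g r‖ ^ 2 : ℝ) : ℂ) := by
      rw [Complex.star_def, Complex.mul_conj, Complex.normSq_eq_norm_sq]
    calc radialSum g r * radialSum g r * star (radialSum g r) * star (radialSum g r)
        = (radialSum g r * star (radialSum g r)) * (radialSum g r * star (radialSum g r)) := by ring
      _ = _ := by
        rw [h]
        push_cast
        ring

theorem potential_radialMode_nonneg {N : ℕ} (g : Fin N → ℂ) :
    0 ≤ potential radialFunctional radialMode g := by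
  rw [potential_radialMode]
  exact intervalIntegral.integral_nonneg zero_le_one fun r _ => by positivity

theorem mul_radialSum_eq_profile {N : ℕ} (g : Fin N → ℂ) {r : ℝ} (hr : r ≤ 1) :
    r * radialSum g r = profile g r := by
  rw [mul_radialSum, profile]
  refine Finset.sum_congr rfl fun i _ => ?_
  rw [sineMode, if_pos hr, freq]
  push_cast
  ring

theorem ofReal_potential_radialMode {N : ℕ} (g : Fin N → ℂ) :
    ENNReal.ofReal (potential radialFunctional radialMode g)
      = ∫⁻ x in Set.Ioc (0 : ℝ) 1, ENNReal.ofReal (‖profile g x‖ ^ 4 / x ^ 2) := by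
  have hc := continuous_radialSum g
  rw [potential_radialMode, intervalIntegral.integral_of_le zero_le_one,
    ofReal_integral_eq_lintegral_ofReal]
  · refine setLIntegral_congr_fun measurableSet_Ioc fun x hx => ?_
    have hx0 := hx.1
    rw [← mul_radialSum_eq_profile g hx.2, norm_mul, Complex.norm_real,
      Real.norm_of_nonneg hx0.le]
    congr 1
    field_simp
  · exact (Continuous.integrableOn_Icc (by fun_prop)).mono_set Set.Ioc_subset_Icc_self
  · exact Eventually.of_forall fun r => by positivity

theorem radial_cubic_eq_cubicProfile {N : ℕ} (g : Fin N → ℂ) {r : ℝ} (hr0 : 0 < r) (hr : r ≤ 1) :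
    r * ((‖radialSum g r‖ ^ 2 : ℝ) * radialSum g r) = cubicProfile g r := by
  have hrC : (r : ℂ) ≠ 0 := by exact_mod_cast hr0.ne'
  rw [cubicProfile, ← mul_radialSum_eq_profile g hr, norm_mul, Complex.norm_real,
    Real.norm_of_nonneg hr0.le]
  push_cast
  field_simp

/-- One factor r turns |f|²f into the cubic profile, the other turns ωᵢ sinc(ωᵢr) into sin(ωᵢr).
This links the Hamiltonian side to the sine coefficient estimates. -/
theorem freq_mul_cubic_radialMode {N : ℕ} (g : Fin N → ℂ) (i : Fin N) :
    freq i * cubic radialFunctional radialMode g i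
      = 2 * ∫ r in (0 : ℝ)..1, cubicProfile g r * Real.sin (freq i * r) := by
  rw [cubic_radialMode, mul_left_comm, ← intervalIntegral.integral_const_mul]
  congr 1
  simp only [intervalIntegral.integral_of_le zero_le_one]
  refine setIntegral_congr_fun measurableSet_Ioc fun r hr => ?_
  rw [← radial_cubic_eq_cubicProfile g hr.1 hr.2, ← mul_sinc_freq]
  push_cast
  ring

theorem exists_mem_unitBall_norm_eq {r : ℝ} (h0 : 0 < r) (h1 : r < 1) :
    ∃ x ∈ unitBall, x ≠ 0 ∧ ‖x‖ = r := by
  have hn : ‖(EuclideanSpace.single 0 r : E3)‖ = r := by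
    simp [abs_of_pos h0]
  refine ⟨EuclideanSpace.single 0 r, ?_, ?_, hn⟩
  · simpa [unitBall, hn] using h1
  · rw [← norm_pos_iff, hn]
    exact h0

/-- Coordinates of a curve are differentiable as soon as all its radial sums are. -/
theorem differentiableAt_of_radialSum {N : ℕ} {y : ℝ → Fin N → ℂ} {t : ℝ}
    (h : ∀ r, 0 < r → r < 1 → DifferentiableAt ℝ (fun τ => radialSum (y τ) r) t) :
    DifferentiableAt ℝ y t := by
  let ev : ℝ → Module.Dual ℂ (Fin N → ℂ) := fun r =>
    { toFun := fun g => radialSum g r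
      map_add' := fun g g' => by simp [radialSum, add_mul, Finset.sum_add_distrib]
      map_smul' := fun c g => by simp [radialSum, Finset.mul_sum, mul_assoc] }
  -- Evaluations at points of (0, 1) separate coefficient vectors, so they span the
  -- finite-dimensional dual. Each coordinate is then a finite combination of evaluations, which are
  -- differentiable along the curve by hypothesis.
  have htop : Submodule.span ℂ (ev '' Set.Ioo 0 1) = ⊤ := by
    rw [← Subspace.dualCoannihilator_dualAnnihilator_eq
      (W := Submodule.span ℂ (ev '' Set.Ioo 0 1)), ← Submodule.dualAnnihilator_bot]
    congr 1
    rw [eq_bot_iff]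
    intro g hg
    rw [Submodule.mem_dualCoannihilator] at hg
    rw [Submodule.mem_bot]
    refine radialSum_injective fun r h0 h1 => ?_
    have h2 := hg (ev r) (Submodule.subset_span ⟨r, ⟨h0, h1⟩, rfl⟩)
    calc radialSum g r = 0 := h2
      _ = _ := by simp [radialSum]
  rw [differentiableAt_pi]
  intro i
  have hmem : (LinearMap.proj i : Module.Dual ℂ (Fin N → ℂ)) ∈
      Submodule.span ℂ (ev '' Set.Ioo 0 1) := htop ▸ Submodule.mem_top
  have key : DifferentiableAt ℝ
      (fun τ => (LinearMap.proj i : Module.Dual ℂ (Fin N → ℂ)) (y τ)) t := by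
    refine Submodule.span_induction
      (p := fun (L : Module.Dual ℂ (Fin N → ℂ)) _ => DifferentiableAt ℝ (fun τ => L (y τ)) t)
      ?_ ?_ ?_ ?_ hmem
    · rintro _ ⟨r, hr, rfl⟩
      exact h r hr.1 hr.2
    · simp
    · intro a b _ _ ha hb
      exact ha.add hb
    · intro c a _ ha
      exact ha.const_mul c
  exact key

theorem sum_Icc_one_eq_sum_fin {M : Type*} [AddCommMonoid M] (N : ℕ) (f : ℕ → M) :
    ∑ n ∈ Finset.Icc 1 N, f n = ∑ i : Fin N, f (i + 1) := by
  induction N with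
  | zero => simp
  | succ N ih => rw [Finset.sum_Icc_succ_top (by omega), Fin.sum_univ_castSucc, ih]; simp

theorem proj_radial {N : ℕ} {f : E3 → ℂ} {F : ℝ → ℂ} (hf : f =ᵐ[ballMeasure] fun x => F ‖x‖)
    (x : E3) :
    proj N f x = radialSum (fun i : Fin N => freq i *
      (2 * ∫ r in (0 : ℝ)..1, r * F r * Real.sin (freq i * r))) ‖x‖ := by
  rw [proj, radialSum, sum_Icc_one_eq_sum_fin]
  refine Finset.sum_congr rfl fun i _ => ?_
  rw [coeff_radial _ hf, eigenfunction_eq_freq]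
  push_cast
  ring

/-- Every solution takes values in the span, so its equation is one between radial sums and can be
read on coefficients. The factor ωᵢ in the coordinates is the normalization of the eigenfunctions
and makes the initial vector exactly g. No existence of solutions is required. -/
theorem IsTruncatedSolution.exists_hamiltonian {N : ℕ} {g : Fin N → ℂ} {φ : E3 → ℂ}
    {u : ℝ → E3 → ℂ} (hφ : φ =ᵐ[ballMeasure] fun x => radialSum g ‖x‖)
    (hu : IsTruncatedSolution N φ u) :
    ∃ y : ℝ → Fin N → ℂ, y 0 = g ∧
      (∀ t, HasDerivAt y
        (hamField radialFunctional radialMode (fun i => freq i ^ 2) (y t)) t) ∧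
      ∀ t, ∀ x ∈ unitBall, u t x = radialSum (y t) ‖x‖ := by
  obtain ⟨a, ha⟩ := hu.mem_range
  set y : ℝ → Fin N → ℂ := fun t i => freq i * a t (i + 1) with hy
  have huy : ∀ t, ∀ x ∈ unitBall, u t x = radialSum (y t) ‖x‖ := by
    intro t x hx
    rw [ha t x hx, radialSum, sum_Icc_one_eq_sum_fin]
    refine Finset.sum_congr rfl fun i _ => ?_
    rw [eigenfunction_eq_freq]
    push_cast
    ring
  have hdy : ∀ t, DifferentiableAt ℝ y t := by
    intro t
    refine differentiableAt_of_radialSum fun r h0 h1 => ?_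
    obtain ⟨x, hx, -, hxr⟩ := exists_mem_unitBall_norm_eq h0 h1
    have h := hu.differentiable t x hx
    have e : (fun τ => u τ x) = fun τ => radialSum (y τ) r := by
      funext τ
      rw [huy τ x hx, hxr]
    rwa [e] at h
  refine ⟨y, ?_, fun t => ?_, huy⟩
  · refine radialSum_injective fun r h0 h1 => ?_
    obtain ⟨x, hx, -, rfl⟩ := exists_mem_unitBall_norm_eq h0 h1
    rw [← huy 0 x hx, hu.initial x hx, proj_radial hφ]
    congr 1
    funext i
    have hω : (freq i : ℂ) ≠ 0 := by exact_mod_cast (freq_pos i).ne'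
    rw [integral_radialSum_mul_sin]
    field_simp
  · have hd := (hdy t).hasDerivAt
    suffices hs : deriv y t = hamField radialFunctional radialMode (fun i => freq i ^ 2) (y t) by
      rwa [hs] at hd
    have hdi : ∀ i, HasDerivAt (fun τ => y τ i) (deriv y t i) t := hasDerivAt_pi.1 hd
    refine radialSum_injective fun r h0 h1 => ?_
    obtain ⟨x, hx, hx0, rfl⟩ := exists_mem_unitBall_norm_eq h0 h1
    have heq := hu.equation t x hx
    have e1 : deriv (fun τ => u τ x) t = radialSum (deriv y t) ‖x‖ := by
      have e : (fun τ => u τ x) = fun τ => radialSum (y τ) ‖x‖ := by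
        funext τ
        rw [huy τ x hx]
      rw [e]
      exact (HasDerivAt.fun_sum fun i _ => (hdi i).mul_const _).deriv
    have e2 : Laplacian.laplacian (u t) x
        = radialSum (fun i => -(freq i ^ 2 : ℝ) * y t i) ‖x‖ := by
      rw [← laplacian_radialSum (y t) hx0]
      refine (InnerProductSpace.laplacian_congr_nhds ?_).self_of_nhds
      filter_upwards [Metric.isOpen_ball.mem_nhds hx] with z hz
      exact huy t z hz
    have e3 : proj N (fun z => (‖u t z‖ ^ 2 : ℝ) * u t z) x
        = radialSum (fun i : Fin N => freq i *
          (freq i * cubic radialFunctional radialMode (y t) i)) ‖x‖ := by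
      rw [proj_radial (F := fun r => (‖radialSum (y t) r‖ ^ 2 : ℝ) * radialSum (y t) r)]
      · congr 1
        funext i
        rw [freq_mul_cubic_radialMode]
        congr 2
        simp only [intervalIntegral.integral_of_le zero_le_one]
        refine setIntegral_congr_fun measurableSet_Ioc fun r hr => ?_
        rw [radial_cubic_eq_cubicProfile _ hr.1 hr.2]
      · have hm : ∀ᵐ z ∂ballMeasure, z ∈ unitBall := ae_restrict_mem measurableSet_ball
        filter_upwards [hm] with z hz
        rw [huy t z hz]
    rw [e1, e2, e3] at heq
    have e4 : radialSum (deriv y t) ‖x‖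
        = -Complex.I * (radialSum (fun i : Fin N => freq i *
            (freq i * cubic radialFunctional radialMode (y t) i)) ‖x‖
          - radialSum (fun i => -(freq i ^ 2 : ℝ) * y t i) ‖x‖) := by
      have hI := Complex.I_mul_I
      linear_combination -Complex.I * heq + radialSum (deriv y t) ‖x‖ * hI
    rw [e4]
    simp only [radialSum, hamField]
    rw [← Finset.sum_sub_distrib, Finset.mul_sum]
    refine Finset.sum_congr rfl fun i _ => ?_
    push_cast
    ring

end Reduction

end BallNLS

namespace BallNLS

/-! ### Building admissible representations from modes. -/

section Representation

theorem hasSum_of_eq {ι : Type*} {f g : ι → ℂ} {a : ℂ} (h : HasSum f a) (hfg : ∀ i, f i = g i) :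
    HasSum g a :=
  (funext hfg : f = g) ▸ h

theorem norm_timeExp (θ : ℝ) : ‖timeExp θ‖ = 1 := by
  rw [timeExp, Complex.norm_exp, Complex.neg_re, Complex.I_mul_re, Complex.ofReal_im]
  simp

theorem abs_eigenfunction_le (n : ℕ) (x : E3) : |eigenfunction n x| ≤ n * Real.pi := by
  have hn : (0 : ℝ) ≤ n * Real.pi := by positivity
  rw [eigenfunction, abs_mul, abs_of_nonneg hn]
  exact mul_le_of_le_one_right hn (Real.abs_sinc_le_one _)

/-- The bound |e_n| ≤ nπ makes the remainder uniformly small off a large finite set, and the domain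
has finite measure, so convergence holds in L² along all finite sets. -/
theorem isRepresentation_of_hasSum {T : ℝ} {f : ℝ → E3 → ℂ} {F : ℕ+ × ℤ → ℂ}
    (hF : Summable fun k : ℕ+ × ℤ => ‖F k‖ * ((k.1 : ℕ) * Real.pi))
    (hf : ∀ t ∈ Set.Ico 0 T, ∀ x ∈ unitBall,
      HasSum (fun k : ℕ+ × ℤ => F k * (eigenfunction (k.1 : ℕ) x : ℂ) * timeExp (k.2 * t)) (f t x)) :
    IsRepresentation T f F := by
  set R : Finset (ℕ+ × ℤ) → ℝ := fun S =>
    ∑' k : {k // k ∉ S}, ‖F k‖ * ((k.1.1 : ℕ) * Real.pi) with hR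
  have hR0 : Tendsto R atTop (𝓝 0) :=
    tendsto_tsum_compl_atTop_zero fun k : ℕ+ × ℤ => ‖F k‖ * ((k.1 : ℕ) * Real.pi)
  set μ := ((volume.restrict (Set.Ico 0 T)).prod ballMeasure : Measure (ℝ × E3)) with hμ
  have hterm : ∀ t x, ∀ k : ℕ+ × ℤ,
      ‖F k * (eigenfunction (k.1 : ℕ) x : ℂ) * timeExp (k.2 * t)‖ ≤ ‖F k‖ * ((k.1 : ℕ) * Real.pi) := by
    intro t x k
    rw [norm_mul, norm_mul, norm_timeExp, mul_one, Complex.norm_real]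
    exact mul_le_mul_of_nonneg_left (abs_eigenfunction_le _ _) (norm_nonneg _)
  have hmem : ∀ᵐ p ∂μ, p.1 ∈ Set.Ico 0 T ∧ p.2 ∈ unitBall := by
    rw [hμ, ballMeasure, Measure.prod_restrict]
    filter_upwards [ae_restrict_mem (measurableSet_Ico.prod measurableSet_ball)] with p hp
    exact hp
  have hb : ∀ S, eLpNorm (fun p : ℝ × E3 => f p.1 p.2 -
      ∑ k ∈ S, F k * (eigenfunction (k.1 : ℕ) p.2 : ℂ) * timeExp (k.2 * p.1)) 2 μ
      ≤ μ Set.univ ^ (2 : ℝ≥0∞).toReal⁻¹ * ENNReal.ofReal (R S) := by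
    intro S
    refine eLpNorm_le_of_ae_bound ?_
    filter_upwards [hmem] with p hp
    have h := hf p.1 hp.1 p.2 hp.2
    rw [← h.tsum_eq, ← h.summable.sum_add_tsum_compl (s := S), add_sub_cancel_left]
    refine tsum_of_norm_bounded ?_ fun k => hterm p.1 p.2 k
    exact (hF.subtype _).hasSum
  refine tendsto_of_tendsto_of_tendsto_of_le_of_le tendsto_const_nhds ?_ (fun _ => zero_le) hb
  have h0 : Tendsto (fun S => ENNReal.ofReal (R S)) atTop (𝓝 0) := by
    simpa using ENNReal.tendsto_ofReal hR0
  have := ENNReal.Tendsto.const_mul (a := μ Set.univ ^ (2 : ℝ≥0∞).toReal⁻¹) h0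
    (Or.inr (ENNReal.rpow_ne_top_of_nonneg (by simp) (measure_ne_top _ _)))
  simpa using this

/-- The indices `(n, m)` in terms of the mode `i = n - 1` and the modulation `j = n² - m`. -/
def modulationEquiv : ℕ × ℤ ≃ ℕ+ × ℤ where
  toFun q := (q.1.succPNat, ((q.1 + 1 : ℕ) : ℤ) ^ 2 - q.2)
  invFun k := (k.1.natPred, ((k.1 : ℕ) : ℤ) ^ 2 - k.2)
  left_inv q := by simp
  right_inv k := by simp

/-- The norm is an infimum, so any representation bounds it. Expanding each time coefficient in
modulations j and setting m = n² - j turns ⟨n² - m⟩ into ⟨j⟩. -/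
theorem xsbNorm_le_of_modes {s b T : ℝ} {N : ℕ} {u : ℝ → E3 → ℂ} {G : ℕ → ℤ → ℂ} {a : ℕ → ℝ → ℂ}
    (hG : ∀ i, Summable fun j => ‖G i j‖) (hG0 : ∀ i, N ≤ i → G i = 0)
    (ha : ∀ i, i < N → ∀ t ∈ Set.Ico 0 T,
      HasSum (fun j => G i j * timeExp ((((i + 1 : ℕ) : ℝ) ^ 2 - j) * t)) (a i t))
    (hu : ∀ t ∈ Set.Ico 0 T, ∀ x ∈ unitBall,
      u t x = ∑ i ∈ Finset.range N, a i t * (eigenfunction (i + 1) x : ℂ)) :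
    xsbNorm s b T u ≤ (∑' i : ℕ, ∑' j : ℤ, ENNReal.ofReal
      (bracket ((i + 1 : ℕ) : ℝ) ^ (2 * s) * bracket j ^ (2 * b) * ‖G i j‖ ^ 2)) ^ (1 / 2 : ℝ) := by
  set F : ℕ+ × ℤ → ℂ := fun k =>
    G (modulationEquiv.symm k).1 (modulationEquiv.symm k).2 with hF
  have hFe : ∀ q, F (modulationEquiv q) = G q.1 q.2 := fun q => by
    simp only [hF, Equiv.symm_apply_apply]
  have he1 : ∀ q, ((modulationEquiv q).1 : ℕ) = q.1 + 1 := fun q => rfl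
  have he2 : ∀ q, (modulationEquiv q).2 = ((q.1 + 1 : ℕ) : ℤ) ^ 2 - q.2 := fun q => rfl
  have hsum : Summable fun k : ℕ+ × ℤ => ‖F k‖ * ((k.1 : ℕ) * Real.pi) := by
    rw [← modulationEquiv.summable_iff, summable_prod_of_nonneg]
    · simp only [Function.comp_def, hFe, he1]
      refine ⟨fun i => (hG i).mul_right _, ?_⟩
      refine summable_of_ne_finset_zero (s := Finset.range N) fun i hi => ?_
      rw [Finset.mem_range, not_lt] at hi
      simp [hG0 i hi]
    · intro q
      simp only [Function.comp_def, Pi.zero_apply]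
      positivity
  have hrep : IsRepresentation T u F := by
    refine isRepresentation_of_hasSum hsum fun t ht x hx => ?_
    have hs : Summable fun k : ℕ+ × ℤ =>
        F k * (eigenfunction (k.1 : ℕ) x : ℂ) * timeExp (k.2 * t) := by
      refine Summable.of_norm_bounded hsum fun k => ?_
      rw [norm_mul, norm_mul, norm_timeExp, mul_one, Complex.norm_real]
      exact mul_le_mul_of_nonneg_left (abs_eigenfunction_le _ _) (norm_nonneg _)
    have h1 := modulationEquiv.hasSum_iff.2 hs.hasSum
    have h2 : ∀ i : ℕ, HasSum (fun j : ℤ => ((fun k : ℕ+ × ℤ =>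
        F k * (eigenfunction (k.1 : ℕ) x : ℂ) * timeExp (k.2 * t)) ∘ modulationEquiv) (i, j))
        (if i < N then a i t * (eigenfunction (i + 1) x : ℂ) else 0) := by
      intro i
      simp only [Function.comp_def, hFe, he1, he2]
      split_ifs with hi
      · refine hasSum_of_eq ((ha i hi t ht).mul_right (eigenfunction (i + 1) x : ℂ)) fun j => ?_
        push_cast
        ring
      · rw [not_lt] at hi
        simp [hG0 i hi, hasSum_zero]
    have h3 := h1.prod_fiberwise h2
    have h4 : HasSum (fun i : ℕ => if i < N then a i t * (eigenfunction (i + 1) x : ℂ) else 0)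
        (∑ i ∈ Finset.range N, if i < N then a i t * (eigenfunction (i + 1) x : ℂ) else 0) :=
      hasSum_sum_of_ne_finset_zero fun i hi => by
        rw [Finset.mem_range] at hi
        simp [hi]
    have h5 : u t x = ∑' k : ℕ+ × ℤ,
        F k * (eigenfunction (k.1 : ℕ) x : ℂ) * timeExp (k.2 * t) := by
      rw [h3.unique h4, hu t ht x hx]
      refine Finset.sum_congr rfl fun i hi => ?_
      rw [if_pos (Finset.mem_range.1 hi)]
    rw [h5]
    exact hs.hasSum
  refine (iInf₂_le F hrep).trans ?_
  rw [weightedNorm]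
  refine ENNReal.rpow_le_rpow (le_of_eq ?_) (by norm_num)
  rw [← modulationEquiv.tsum_eq, ← ENNReal.tsum_prod]
  refine tsum_congr fun q => ?_
  rw [hFe, he1, he2]
  congr 4
  push_cast
  ring_nf

end Representation

end BallNLS

namespace BallNLS

/-! ### Duhamel's formula for the modulated coefficients and the deterministic norm bound. -/

section Duhamel

theorem timeExp_add (a b : ℝ) : timeExp (a + b) = timeExp a * timeExp b := by
  rw [timeExp, timeExp, timeExp, ← Complex.exp_add]
  congr 1
  push_cast
  ring

theorem timeExp_zero : timeExp 0 = 1 := by simp [timeExp]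

theorem hasDerivAt_timeExp_mul (c t : ℝ) :
    HasDerivAt (fun t => timeExp (c * t)) (-(Complex.I * (Real.pi ^ 2 * c : ℝ)) * timeExp (c * t))
      t := by
  have h1 : HasDerivAt (fun t : ℝ => ((Real.pi ^ 2 * (c * t) : ℝ) : ℂ)) ((Real.pi ^ 2 * c : ℝ) : ℂ) t := by
    have := (((hasDerivAt_id t).const_mul c).const_mul (Real.pi ^ 2)).ofReal_comp
    simpa using this
  have h2 := ((h1.const_mul Complex.I).neg).cexp
  refine h2.congr_deriv ?_
  rw [timeExp]
  exact mul_comm _ _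

theorem continuous_timeExp_mul (c : ℝ) : Continuous fun t => timeExp (c * t) := by
  unfold timeExp
  fun_prop

/-- Over the period 2/π the standard characters are the functions e(-jt); the reflected sign is why
the modulation appears as n² + m in the estimates. -/
theorem fourier_eq_timeExp (j : ℤ) (t : ℝ) :
    fourier j (t : AddCircle (2 / Real.pi)) = timeExp (-j * t) := by
  have hpi : (Real.pi : ℂ) ≠ 0 := by exact_mod_cast Real.pi_ne_zero
  rw [fourier_coe_apply, timeExp]
  congr 1
  push_cast
  field_simp

theorem norm_profile_le {N : ℕ} (g : Fin N → ℂ) {x : ℝ} (hx : 0 ≤ x) :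
    ‖profile g x‖ ≤ x * ∑ i, ‖g i‖ := by
  rw [profile, Finset.mul_sum]
  refine norm_sum_le_of_le _ fun i _ => ?_
  rw [norm_mul, Complex.norm_real, mul_comm]
  exact mul_le_mul_of_nonneg_right (abs_sineMode_le _ hx) (norm_nonneg _)

theorem cubicProfile_eq_zero {N : ℕ} (g : Fin N → ℂ) {x : ℝ} (hx : 1 < x) :
    cubicProfile g x = 0 := by
  have h : profile g x = 0 := by
    simp [profile, sineMode, not_le.2 hx]
  simp [cubicProfile, h]

/-- A crude bound that supplies boundedness and integrability along one trajectory; it enters no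
final constant. -/
theorem norm_cubicProfile_le {N : ℕ} (g : Fin N → ℂ) {x : ℝ} (hx : 0 < x) :
    ‖cubicProfile g x‖ ≤ (∑ i, ‖g i‖) ^ 3 := by
  have hS : 0 ≤ ∑ i, ‖g i‖ := Finset.sum_nonneg fun _ _ => norm_nonneg _
  rcases lt_or_ge 1 x with h1 | h1
  · rw [cubicProfile_eq_zero g h1, norm_zero]
    positivity
  · have h := norm_profile_le g hx.le
    rw [cubicProfile, norm_div, norm_mul, Complex.norm_real, Complex.norm_real,
      Real.norm_of_nonneg (by positivity), Real.norm_of_nonneg (by positivity),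
      div_le_iff₀ (by positivity)]
    calc ‖profile g x‖ ^ 2 * ‖profile g x‖ = ‖profile g x‖ ^ 3 := by ring
      _ ≤ (x * ∑ i, ‖g i‖) ^ 3 := by gcongr
      _ = x * ((∑ i, ‖g i‖) ^ 3 * x ^ 2) := by ring
      _ ≤ 1 * ((∑ i, ‖g i‖) ^ 3 * x ^ 2) := by gcongr
      _ = _ := one_mul _

/-- The sine coefficient of index `i` of the cubic term. -/
noncomputable def sineCoeff {N : ℕ} (g : Fin N → ℂ) (i : ℕ) : ℂ :=
  ∫ x in (0 : ℝ)..1, cubicProfile g x * Real.sin (freq i * x)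

variable {N : ℕ} {y : ℝ → Fin N → ℂ}
  (hy : ∀ t, HasDerivAt y (hamField radialFunctional radialMode (fun i => freq i ^ 2) (y t)) t)

theorem continuous_sineCoeff (hyc : Continuous y) (i : Fin N) :
    Continuous fun t => sineCoeff (y t) i := by
  have h : (fun t => sineCoeff (y t) i) = fun t =>
      freq i * cubic radialFunctional radialMode (y t) i / 2 := by
    funext t
    rw [freq_mul_cubic_radialMode]
    simp [sineCoeff]
  rw [h]
  have hc := (contDiff_cubic radialFunctional (star_radialMode (N := N)) i).continuous.comp hyc
  exact (continuous_const.mul hc).div_const _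

include hy in
-- Passing to the interaction picture removes the linear rotation, leaving -iωᵢ `cubic` = -2i times
-- the sine coefficient of the cubic term.
theorem hasDerivAt_modulated (i : Fin N) (t : ℝ) :
    HasDerivAt (fun t => timeExp (-(((i : ℕ) + 1 : ℕ) : ℝ) ^ 2 * t) * (y t i / freq i))
      (-2 * Complex.I * (timeExp (-(((i : ℕ) + 1 : ℕ) : ℝ) ^ 2 * t) * sineCoeff (y t) i)) t := by
  have hyi := hasDerivAt_pi.1 (hy t) i
  have h := (hasDerivAt_timeExp_mul (-(((i : ℕ) + 1 : ℕ) : ℝ) ^ 2) t).mul (hyi.div_const (freq i : ℂ))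
  refine h.congr_deriv ?_
  have hω : (freq i : ℂ) ≠ 0 := by exact_mod_cast (freq_pos i).ne'
  have hc := freq_mul_cubic_radialMode (y t) i
  change _ = 2 * sineCoeff (y t) i at hc
  have hsc : sineCoeff (y t) i = freq i * cubic radialFunctional radialMode (y t) i / 2 := by
    rw [hc]
    ring
  have hf : ((Real.pi ^ 2 * -(((i : ℕ) + 1 : ℕ) : ℝ) ^ 2 : ℝ) : ℂ) = -(freq i : ℂ) ^ 2 := by
    unfold freq
    push_cast
    ring
  rw [hf, hsc, hamField]
  push_cast
  field_simp
  ring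

/-- The cubic term along a curve, cut off in time at `T`. -/
noncomputable def truncatedCubic (T : ℝ) (y : ℝ → Fin N → ℂ) (t x : ℝ) : ℂ :=
  if t < T then cubicProfile (y t) x else 0

theorem measurable_truncatedCubic (T : ℝ) (hyc : Continuous y) :
    Measurable (Function.uncurry (truncatedCubic T y)) := by
  have hq : Measurable fun p : ℝ × ℝ => (y p.1, p.2) :=
    (hyc.measurable.comp measurable_fst).prodMk measurable_snd
  have h : Measurable (Function.uncurry cubicProfile ∘ fun p : ℝ × ℝ => (y p.1, p.2)) :=
    (measurable_uncurry_cubicProfile (N := N)).comp hq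
  have hs : MeasurableSet {p : ℝ × ℝ | p.1 < T} := measurableSet_Iio.preimage measurable_fst
  have h2 : Measurable fun p : ℝ × ℝ => if p.1 < T then cubicProfile (y p.1) p.2 else 0 :=
    h.ite hs measurable_const
  exact h2

theorem exists_norm_truncatedCubic_le (T P : ℝ) (hyc : Continuous y) :
    ∃ M, ∀ t ∈ Set.Ioc 0 P, ∀ x, 0 < x → ‖truncatedCubic T y t x‖ ≤ M := by
  have hc : Continuous fun t => (∑ i, ‖y t i‖) ^ 3 := by fun_prop
  obtain ⟨M, hM⟩ := (isCompact_Icc (a := 0) (b := P)).exists_bound_of_continuousOn hc.continuousOn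
  refine ⟨M, fun t ht x hx => ?_⟩
  have h := (le_abs_self _).trans (hM t (Set.Ioc_subset_Icc_self ht))
  have h0 : 0 ≤ (∑ i, ‖y t i‖) ^ 3 := by positivity
  unfold truncatedCubic
  split_ifs
  · exact (norm_cubicProfile_le _ hx).trans h
  · simpa using h0.trans h

theorem besov_zero (s α : ℝ) : besov s α (fun _ => 0) = 0 := by
  simp [besov, incrSq]

theorem lintegral_besov_truncatedCubic_le (s α P T : ℝ) (y : ℝ → Fin N → ℂ) :
    ∫⁻ t in Set.Ioc 0 P, besov s α (truncatedCubic T y t)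
      ≤ ∫⁻ t in Set.Ioc 0 T, besov s α (cubicProfile (y t)) := by
  rw [← lintegral_indicator measurableSet_Ioc, ← lintegral_indicator measurableSet_Ioc]
  refine lintegral_mono fun t => ?_
  by_cases h : t ∈ Set.Ioc 0 P
  · by_cases hT : t < T
    · have e : truncatedCubic T y t = cubicProfile (y t) := by
        funext x
        simp [truncatedCubic, hT]
      rw [Set.indicator_of_mem h, Set.indicator_of_mem (show t ∈ Set.Ioc 0 T from ⟨h.1, hT.le⟩), e]
    · have e : truncatedCubic T y t = fun _ => 0 := by
        funext x
        simp [truncatedCubic, hT]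
      rw [Set.indicator_of_mem h, e, besov_zero]
      exact zero_le
  · rw [Set.indicator_of_notMem h]
    exact zero_le

/-- Multiplication by e(-n²t) shifts the Fourier index by n². -/
theorem norm_fourierCoeffOn_modulated (T : ℝ) (y : ℝ → Fin N → ℂ) (hP : 0 < 2 / Real.pi)
    (i : ℕ) (m : ℤ) :
    ‖fourierCoeffOn hP ((Set.Iio T).indicator fun t =>
        -2 * Complex.I * (timeExp (-((i + 1 : ℕ) : ℝ) ^ 2 * t) * sineCoeff (y t) i))
        (((i + 1 : ℕ) : ℤ) ^ 2 + m)‖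
      = 2 * ‖fourierCoeffOn hP (fun t => ∫ x in (0 : ℝ)..1,
          truncatedCubic T y t x * Real.sin ((i + 1 : ℕ) * Real.pi * x)) m‖ := by
  have e : fourierCoeffOn hP ((Set.Iio T).indicator fun t =>
        -2 * Complex.I * (timeExp (-((i + 1 : ℕ) : ℝ) ^ 2 * t) * sineCoeff (y t) i))
        (((i + 1 : ℕ) : ℤ) ^ 2 + m)
      = -2 * Complex.I * fourierCoeffOn hP (fun t => ∫ x in (0 : ℝ)..1,
          truncatedCubic T y t x * Real.sin ((i + 1 : ℕ) * Real.pi * x)) m := by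
    rw [fourierCoeffOn_eq_setIntegral, fourierCoeffOn_eq_setIntegral, mul_left_comm,
      ← integral_const_mul (-2 * Complex.I)]
    congr 1
    refine integral_congr_ae (Eventually.of_forall fun t => ?_)
    simp only [Set.indicator, Set.mem_Iio]
    by_cases hT : t < T
    · have e1 : ∫ x in (0 : ℝ)..1, truncatedCubic T y t x * Real.sin ((i + 1 : ℕ) * Real.pi * x)
          = sineCoeff (y t) i := by
        simp only [truncatedCubic, hT, if_true]
        rfl
      rw [if_pos hT, e1, fourier_eq_timeExp, fourier_eq_timeExp]
      have e2 : timeExp (-((-(((i + 1 : ℕ) : ℤ) ^ 2 + m) : ℤ) : ℝ) * t)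
          * timeExp (-((i + 1 : ℕ) : ℝ) ^ 2 * t) = timeExp (-((-m : ℤ) : ℝ) * t) := by
        rw [← timeExp_add]
        congr 1
        push_cast
        ring
      rw [← e2]
      ring
    · simp [truncatedCubic, hT]
  rw [e, norm_mul]
  simp

include hy in
-- The periodic extension is applied to the modulated coefficient and the phase is then restored.
-- The extension property enters as a hypothesis with its constant C fixed, so C is the same for
-- every mode and every N. The factor 4 is |-2i|², and 1/ωᵢ ≤ 1/(i+1) gives the exponent -2.
theorem exists_modulation_coefficients {b T C : ℝ} (hP : 0 < 2 / Real.pi)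
    (hC : ∀ A γ : ℝ → ℂ, (∀ t, HasDerivAt A (γ t) t) → Continuous γ →
      ∃ G : ℤ → ℂ, Summable (fun j => ‖G j‖) ∧
        (∀ t ∈ Set.Ico 0 T, HasSum (fun j => G j * fourier j (t : AddCircle (2 / Real.pi))) (A t)) ∧
        ∑' j : ℤ, ENNReal.ofReal (bracket j ^ (2 * b) * ‖G j‖ ^ 2) ≤
          ENNReal.ofReal C * (ENNReal.ofReal (‖A 0‖ ^ 2) +
            ∑' j : ℤ, ENNReal.ofReal (bracket j ^ (2 * b - 2) *
              ‖fourierCoeffOn hP ((Set.Iio T).indicator γ) j‖ ^ 2))) (i : Fin N) :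
    ∃ G : ℤ → ℂ, Summable (fun j => ‖G j‖) ∧
      (∀ t ∈ Set.Ico 0 T,
        HasSum (fun j : ℤ => G j * timeExp (((((i : ℕ) + 1 : ℕ) : ℝ) ^ 2 - j) * t))
          (y t i / freq i)) ∧
      ∑' j : ℤ, ENNReal.ofReal (bracket j ^ (2 * b) * ‖G j‖ ^ 2) ≤
        ENNReal.ofReal C * (ENNReal.ofReal (((i : ℕ) + 1 : ℝ) ^ (-2 : ℝ) * ‖y 0 i‖ ^ 2) +
          4 * ∑' m : ℤ, ENNReal.ofReal (bracket ((((i : ℕ) + 1 : ℕ) : ℝ) ^ 2 + m) ^ (2 * b - 2)) *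
            ‖fourierCoeffOn hP (fun t => ∫ x in (0 : ℝ)..1,
              truncatedCubic T y t x * Real.sin (((i : ℕ) + 1 : ℕ) * Real.pi * x)) m‖ₑ ^ 2) := by
  have hyc : Continuous y := continuous_iff_continuousAt.2 fun t => (hy t).continuousAt
  obtain ⟨G, hG, hGs, hGb⟩ := hC _ _ (hasDerivAt_modulated hy i)
    (continuous_const.mul ((continuous_timeExp_mul _).mul (continuous_sineCoeff hyc i)))
  refine ⟨G, hG, fun t ht => ?_, hGb.trans ?_⟩
  · have h := (hGs t ht).mul_left (timeExp ((((i : ℕ) + 1 : ℕ) : ℝ) ^ 2 * t))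
    have e : timeExp ((((i : ℕ) + 1 : ℕ) : ℝ) ^ 2 * t) *
        (timeExp (-(((i : ℕ) + 1 : ℕ) : ℝ) ^ 2 * t) * (y t i / freq i)) = y t i / freq i := by
      rw [← mul_assoc, ← timeExp_add, neg_mul, add_neg_cancel, timeExp_zero, one_mul]
    rw [e] at h
    refine hasSum_of_eq h fun j => ?_
    rw [fourier_eq_timeExp, mul_left_comm, ← timeExp_add]
    congr 2
    ring
  · have hi1 : (0 : ℝ) < (i : ℕ) + 1 := by positivity
    have h1 : ENNReal.ofReal (‖timeExp (-(((i : ℕ) + 1 : ℕ) : ℝ) ^ 2 * 0) * (y 0 i / freq i)‖ ^ 2)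
        ≤ ENNReal.ofReal (((i : ℕ) + 1 : ℝ) ^ (-2 : ℝ) * ‖y 0 i‖ ^ 2) := by
      refine ENNReal.ofReal_le_ofReal ?_
      rw [norm_mul, norm_timeExp, one_mul, norm_div, Complex.norm_real,
        Real.norm_of_nonneg (freq_pos i).le, div_pow, Real.rpow_neg hi1.le,
        div_eq_inv_mul]
      have h2 : ((i : ℕ) + 1 : ℝ) ≤ freq i := by
        unfold freq
        push_cast
        have := Real.pi_gt_three
        nlinarith
      have h3 : ((i : ℕ) + 1 : ℝ) ^ (2 : ℝ) ≤ freq i ^ 2 := by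
        rw [Real.rpow_two]
        gcongr
      gcongr
    have h4 : ∑' j : ℤ, ENNReal.ofReal (bracket j ^ (2 * b - 2) *
          ‖fourierCoeffOn hP ((Set.Iio T).indicator fun t => -2 * Complex.I *
            (timeExp (-(((i : ℕ) + 1 : ℕ) : ℝ) ^ 2 * t) * sineCoeff (y t) i)) j‖ ^ 2)
        = 4 * ∑' m : ℤ, ENNReal.ofReal (bracket ((((i : ℕ) + 1 : ℕ) : ℝ) ^ 2 + m) ^ (2 * b - 2)) *
            ‖fourierCoeffOn hP (fun t => ∫ x in (0 : ℝ)..1,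
              truncatedCubic T y t x * Real.sin (((i : ℕ) + 1 : ℕ) * Real.pi * x)) m‖ₑ ^ 2 := by
      rw [← ENNReal.tsum_mul_left,
        ← (Equiv.addLeft ((((i : ℕ) + 1 : ℕ) : ℤ) ^ 2)).tsum_eq]
      refine tsum_congr fun m => ?_
      rw [Equiv.coe_addLeft, norm_fourierCoeffOn_modulated, ← ofReal_norm,
        ← ENNReal.ofReal_pow (norm_nonneg _),
        ← ENNReal.ofReal_mul (Real.rpow_nonneg (bracket_pos _).le _),
        show (4 : ℝ≥0∞) = ENNReal.ofReal 4 by norm_num, ← ENNReal.ofReal_mul (by norm_num)]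
      congr 1
      push_cast
      ring
    exact mul_le_mul' le_rfl (add_le_add h1 h4.le)

/-- The norm of a solution is controlled by its initial datum and the Besov functional of the
cubic term. -/
theorem exists_xsbNorm_sq_le {s b T α : ℝ} (hs : 0 ≤ s) (hb : 1 / 2 < b) (hb1 : b < 3 / 4)
    (hT0 : 0 < T) (hT1 : T < 2 / Real.pi) (hα1 : α < 1) :
    ∃ C : ℝ, 0 < C ∧ ∀ (N : ℕ) (y : ℝ → Fin N → ℂ) (u : ℝ → E3 → ℂ),
      (∀ t, HasDerivAt y (hamField radialFunctional radialMode (fun i => freq i ^ 2) (y t)) t) →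
      (∀ t, ∀ x ∈ unitBall, u t x = radialSum (y t) ‖x‖) →
      xsbNorm s b T u ^ 2 ≤ ENNReal.ofReal C *
        (∑ i : Fin N, ENNReal.ofReal (((i : ℕ) + 1 : ℝ) ^ (2 * s - 2) * ‖y 0 i‖ ^ 2) +
          ∫⁻ t in Set.Ioc 0 T, besov s α (cubicProfile (y t))) := by
  have hP : 0 < 2 / Real.pi := hT0.trans hT1
  obtain ⟨C₁, hC₁, hext⟩ := exists_periodic_extension hb (by linarith) hT0 hT1
  obtain ⟨C₂, hC₂, hbes⟩ := exists_tsum_sin_fourierCoeffOn_le (α := α) hs hb1 hα1 hP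
  -- 4^s comes from ⟨n⟩ ≤ 2n, C₁ from the extension in time, and 4C₂ from the weighted space-time
  -- bound.
  refine ⟨4 ^ s * C₁ * (1 + 4 * C₂), by positivity, fun N y u hy hu => ?_⟩
  have hyc : Continuous y := continuous_iff_continuousAt.2 fun t => (hy t).continuousAt
  choose G hG hGs hGb using exists_modulation_coefficients hy hP hext
  have hle := xsbNorm_le_of_modes (s := s) (b := b) (T := T) (N := N) (u := u)
    (G := fun i => if h : i < N then G ⟨i, h⟩ else 0)
    (a := fun i t => if h : i < N then y t ⟨i, h⟩ / freq i else 0) ?_ ?_ ?_ ?_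
  · set w : ℕ → ℤ → ℝ≥0∞ := fun n m => ENNReal.ofReal (((n + 1 : ℕ) : ℝ) ^ (2 * s) *
          bracket (((n + 1 : ℕ) : ℝ) ^ 2 + m) ^ (2 * b - 2)) *
        ‖fourierCoeffOn hP (fun t => ∫ x in (0 : ℝ)..1,
          truncatedCubic T y t x * Real.sin ((n + 1 : ℕ) * Real.pi * x)) m‖ₑ ^ 2 with hw
    have hterm : ∀ i : Fin N, ∑' j : ℤ, ENNReal.ofReal
        (bracket (((i : ℕ) + 1 : ℕ) : ℝ) ^ (2 * s) * bracket j ^ (2 * b) * ‖G i j‖ ^ 2)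
        ≤ ENNReal.ofReal (4 ^ s * C₁) * (ENNReal.ofReal
          (((i : ℕ) + 1 : ℝ) ^ (2 * s - 2) * ‖y 0 i‖ ^ 2) + 4 * ∑' m, w i m) := by
      intro i
      have hi1 : (0 : ℝ) < (i : ℕ) + 1 := by positivity
      have hbr : bracket (((i : ℕ) + 1 : ℕ) : ℝ) ^ (2 * s)
          ≤ 4 ^ s * ((i : ℕ) + 1 : ℝ) ^ (2 * s) := by
        have h1 : (1 : ℝ) ≤ |(((i : ℕ) + 1 : ℕ) : ℝ)| := by
          rw [Nat.abs_cast]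
          push_cast
          linarith [(Nat.cast_nonneg (i : ℕ) : (0 : ℝ) ≤ (i : ℕ))]
        have h2 := bracket_le_two_mul_abs h1
        rw [Nat.abs_cast] at h2
        push_cast at h2 ⊢
        calc bracket ((i : ℕ) + 1 : ℝ) ^ (2 * s) ≤ (2 * ((i : ℕ) + 1 : ℝ)) ^ (2 * s) :=
              Real.rpow_le_rpow (bracket_pos _).le h2 (by positivity)
          _ = _ := by
              rw [Real.mul_rpow (by norm_num) hi1.le, Real.rpow_mul (by norm_num)]
              norm_num
      calc ∑' j : ℤ, ENNReal.ofReal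
            (bracket (((i : ℕ) + 1 : ℕ) : ℝ) ^ (2 * s) * bracket j ^ (2 * b) * ‖G i j‖ ^ 2)
          = ENNReal.ofReal (bracket (((i : ℕ) + 1 : ℕ) : ℝ) ^ (2 * s)) *
            ∑' j : ℤ, ENNReal.ofReal (bracket j ^ (2 * b) * ‖G i j‖ ^ 2) := by
            rw [← ENNReal.tsum_mul_left]
            refine tsum_congr fun j => ?_
            rw [mul_assoc, ENNReal.ofReal_mul (Real.rpow_nonneg (bracket_pos _).le _)]
        _ ≤ _ := mul_le_mul' (ENNReal.ofReal_le_ofReal hbr) (hGb i)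
        _ = _ := by
            have e1 : ∑' m, w i m = ENNReal.ofReal (((i : ℕ) + 1 : ℝ) ^ (2 * s)) *
                ∑' m : ℤ, ENNReal.ofReal
                  (bracket ((((i : ℕ) + 1 : ℕ) : ℝ) ^ 2 + m) ^ (2 * b - 2)) *
                  ‖fourierCoeffOn hP (fun t => ∫ x in (0 : ℝ)..1,
                    truncatedCubic T y t x *
                      Real.sin (((i : ℕ) + 1 : ℕ) * Real.pi * x)) m‖ₑ ^ 2 := by
              rw [← ENNReal.tsum_mul_left]
              refine tsum_congr fun m => ?_
              simp only [hw]
              rw [ENNReal.ofReal_mul (by positivity), mul_assoc]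
              push_cast
              rfl
            have e2 : ((i : ℕ) + 1 : ℝ) ^ (2 * s - 2) * ‖y 0 i‖ ^ 2
                = ((i : ℕ) + 1 : ℝ) ^ (2 * s) * (((i : ℕ) + 1 : ℝ) ^ (-2 : ℝ) * ‖y 0 i‖ ^ 2) := by
              rw [← mul_assoc, ← Real.rpow_add hi1]
              rfl
            rw [e1, e2, ENNReal.ofReal_mul (p := 4 ^ s) (by positivity),
              ENNReal.ofReal_mul (p := 4 ^ s) (by positivity),
              ENNReal.ofReal_mul (p := ((i : ℕ) + 1 : ℝ) ^ (2 * s)) (by positivity)]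
            ring
    obtain ⟨M, hM⟩ := exists_norm_truncatedCubic_le T (2 / Real.pi) hyc
    have hB := hbes M (truncatedCubic T y) (measurable_truncatedCubic T hyc) hM
      (fun t x hx => by simp [truncatedCubic, cubicProfile_eq_zero _ hx])
    calc xsbNorm s b T u ^ 2 ≤ _ := pow_le_pow_left' hle 2
      _ = ∑' i : ℕ, ∑' j : ℤ, ENNReal.ofReal (bracket ((i + 1 : ℕ) : ℝ) ^ (2 * s) *
            bracket j ^ (2 * b) * ‖(if h : i < N then G ⟨i, h⟩ else 0) j‖ ^ 2) := by
          rw [← ENNReal.rpow_natCast, ← ENNReal.rpow_mul]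
          norm_num
      _ = ∑ i : Fin N, ∑' j : ℤ, ENNReal.ofReal (bracket (((i : ℕ) + 1 : ℕ) : ℝ) ^ (2 * s) *
            bracket j ^ (2 * b) * ‖G i j‖ ^ 2) := by
          rw [tsum_eq_sum (s := Finset.range N), Finset.sum_range]
          · refine Finset.sum_congr rfl fun i _ => ?_
            simp only [i.2, dif_pos]
          · intro i hi
            rw [Finset.mem_range] at hi
            simp [hi]
      _ ≤ _ := Finset.sum_le_sum fun i _ => hterm i
      _ = ENNReal.ofReal (4 ^ s * C₁) * (∑ i : Fin N, ENNReal.ofReal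
          (((i : ℕ) + 1 : ℝ) ^ (2 * s - 2) * ‖y 0 i‖ ^ 2) + 4 * ∑ i : Fin N, ∑' m, w i m) := by
          rw [← Finset.mul_sum, Finset.sum_add_distrib, ← Finset.mul_sum]
      _ ≤ ENNReal.ofReal (4 ^ s * C₁) * (∑ i : Fin N, ENNReal.ofReal
          (((i : ℕ) + 1 : ℝ) ^ (2 * s - 2) * ‖y 0 i‖ ^ 2) + 4 * (ENNReal.ofReal C₂ *
            ∫⁻ t in Set.Ioc 0 T, besov s α (cubicProfile (y t)))) := by
          refine mul_le_mul' le_rfl (add_le_add le_rfl (mul_le_mul' le_rfl ?_))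
          calc ∑ i : Fin N, ∑' m, w i m = ∑ i ∈ Finset.range N, ∑' m, w i m :=
                (Finset.sum_range fun i => ∑' m, w i m).symm
            _ ≤ ∑' i, ∑' m, w i m := ENNReal.sum_le_tsum _
            _ ≤ _ := hB
            _ ≤ _ := mul_le_mul' le_rfl (lintegral_besov_truncatedCubic_le s α _ T y)
      _ ≤ _ := by
          rw [ENNReal.ofReal_mul (p := 4 ^ s * C₁) (by positivity), mul_assoc (ENNReal.ofReal _)]
          refine mul_le_mul' le_rfl ?_
          rw [mul_add, ← mul_assoc 4, show (4 : ℝ≥0∞) = ENNReal.ofReal 4 by norm_num,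
            ← ENNReal.ofReal_mul (by norm_num)]
          refine add_le_add ?_ (mul_le_mul' (ENNReal.ofReal_le_ofReal (by linarith)) le_rfl)
          refine le_mul_of_one_le_left' ?_
          rw [ENNReal.one_le_ofReal]
          linarith
  · intro i
    by_cases h : i < N
    · simpa [h] using hG ⟨i, h⟩
    · simp [h]
  · intro i hi
    simp [not_lt.2 hi]
  · intro i hi t ht
    simpa [hi] using hGs ⟨i, hi⟩ t ht
  · intro t _ x hx
    rw [hu t x hx, radialSum, Finset.sum_range]
    refine Finset.sum_congr rfl fun i _ => ?_
    have hω : (freq i : ℂ) ≠ 0 := by exact_mod_cast (freq_pos i).ne'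
    rw [dif_pos i.2, eigenfunction_eq_freq]
    push_cast
    field_simp

end Duhamel

end BallNLS

namespace BallNLS

/-! ### Comparing the Gibbs measure with the Gaussian law. -/

section GibbsBound

/-- `y` solves the Hamiltonian equation satisfied by the modes of the truncated flow. -/
def IsTrajectory {N : ℕ} (y : ℝ → Fin N → ℂ) : Prop :=
  ∀ t, HasDerivAt y (hamField radialFunctional radialMode (fun i => freq i ^ 2) (y t)) t

theorem measurable_besov_cubicProfile (s α : ℝ) (N : ℕ) :
    Measurable fun g : Fin N → ℂ => besov s α (cubicProfile g) := by
  unfold besov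
  refine Measurable.tsum fun k => Measurable.const_mul ?_ _
  have hc := measurable_uncurry_cubicProfile (N := N)
  have h0 : Measurable fun p : (Fin N → ℂ) × ℝ => ‖Function.uncurry cubicProfile p‖ₑ ^ 2 :=
    hc.enorm.pow_const 2
  have hsh : Measurable fun p : (Fin N → ℂ) × ℝ => (p.1, p.2 + (2⁻¹ : ℝ) ^ (k + 1)) :=
    measurable_fst.prodMk (measurable_snd.add_const _)
  have h1 : Measurable fun p : (Fin N → ℂ) × ℝ =>
      ‖(Function.uncurry cubicProfile ∘ fun p : (Fin N → ℂ) × ℝ =>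
        (p.1, p.2 + (2⁻¹ : ℝ) ^ (k + 1))) p - Function.uncurry cubicProfile p‖ₑ ^ 2 :=
    ((hc.comp hsh).sub hc).enorm.pow_const 2
  have hs : MeasurableSet {p : (Fin N → ℂ) × ℝ | p.2 < (2⁻¹ : ℝ) ^ (k + 1)} :=
    measurableSet_Iio.preimage measurable_snd
  have hx : Measurable fun p : (Fin N → ℂ) × ℝ => ENNReal.ofReal (p.2 ^ α) :=
    (measurable_snd.pow_const α).ennreal_ofReal
  have h2 : Measurable (Function.uncurry fun (g : Fin N → ℂ) (x : ℝ) =>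
      ENNReal.ofReal (x ^ α) * incrSq (2⁻¹ ^ (k + 1)) (cubicProfile g) x) :=
    hx.mul ((h0.ite hs measurable_const).add h1)
  exact h2.lintegral_prod_right'

theorem integrable_exp_neg_energy (N : ℕ) :
    Integrable fun g : Fin N → ℂ => Real.exp (-energy radialFunctional radialMode g) := by
  refine (integrable_exp_neg_sum_sq_norm (Fin N)).mono' ?_ (Eventually.of_forall fun g => ?_)
  · have := (contDiff_energy radialFunctional (star_radialMode (N := N))).continuous
    exact Continuous.aestronglyMeasurable (by fun_prop)
  · rw [Real.norm_of_nonneg (Real.exp_pos _).le]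
    exact Real.exp_le_exp.2 (neg_le_neg (sq_norm_le_energy potential_radialMode_nonneg g))

theorem energy_eq (N : ℕ) (g : Fin N → ℂ) :
    energy radialFunctional radialMode g
      = ∑ i, ‖g i‖ ^ 2 + potential radialFunctional radialMode g := by
  rw [energy]
  congr 1
  refine Finset.sum_congr rfl fun i _ => ?_
  rw [← Complex.normSq_eq_norm_sq, Complex.normSq_apply]
  ring

/-- The Gibbs measure, normalized as a density with respect to the Gaussian law. -/
noncomputable def gibbs (N : ℕ) : Measure (Fin N → ℂ) :=
  ENNReal.ofReal (Real.pi⁻¹ ^ Fintype.card (Fin N)) •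
    volume.withDensity fun g => ENNReal.ofReal (Real.exp (-energy radialFunctional radialMode g))

theorem measurable_exp_neg_energy (N : ℕ) : Measurable fun g : Fin N → ℂ =>
    ENNReal.ofReal (Real.exp (-energy radialFunctional radialMode g)) := by
  have := (contDiff_energy radialFunctional (star_radialMode (N := N))).continuous
  exact (Continuous.measurable (by fun_prop)).ennreal_ofReal

theorem gibbs_eq_withDensity (N : ℕ) :
    gibbs N = (gaussianLaw (Fin N)).withDensity fun g =>
      ENNReal.ofReal (Real.exp (-potential radialFunctional radialMode g)) := by
  have hE := (contDiff_energy radialFunctional (star_radialMode (N := N))).continuous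
  have hp : Continuous fun g : Fin N → ℂ => potential radialFunctional radialMode g := by
    have e : (fun g : Fin N → ℂ => potential radialFunctional radialMode g)
        = fun g => energy radialFunctional radialMode g - ∑ i, ‖g i‖ ^ 2 := by
      funext g
      rw [energy_eq]
      ring
    rw [e]
    fun_prop
  rw [gibbs, ← withDensity_smul _ (measurable_exp_neg_energy N), gaussianLaw_eq_withDensity,
    ← withDensity_mul]
  · congr 1
    funext g
    simp only [Pi.smul_apply, Pi.mul_apply, smul_eq_mul]
    rw [← ENNReal.ofReal_mul (by positivity), ← ENNReal.ofReal_mul (by positivity), energy_eq,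
      mul_assoc, ← Real.exp_add]
    congr 3
    ring
  · exact (Continuous.measurable (by fun_prop)).ennreal_ofReal
  · exact (Continuous.measurable (by fun_prop)).ennreal_ofReal

theorem measurable_potential (N : ℕ) :
    Measurable fun g : Fin N → ℂ => ENNReal.ofReal (potential radialFunctional radialMode g) := by
  have e : (fun g : Fin N → ℂ => ENNReal.ofReal (potential radialFunctional radialMode g))
      = fun g => ENNReal.ofReal (energy radialFunctional radialMode g - ∑ i, ‖g i‖ ^ 2) := by
    funext g
    rw [energy_eq]
    congr 1
    ring
  have hE := (contDiff_energy radialFunctional (star_radialMode (N := N))).continuous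
  rw [e]
  exact (Continuous.measurable (by fun_prop)).ennreal_ofReal

/-- The relative density e^{-V} is at most 1 because the equation is defocusing, i.e. V ≥ 0. -/
theorem gibbs_le_gaussianLaw (N : ℕ) : gibbs N ≤ gaussianLaw (Fin N) := by
  rw [gibbs_eq_withDensity]
  calc _ ≤ (gaussianLaw (Fin N)).withDensity 1 := by
        refine withDensity_mono (Eventually.of_forall fun g => ?_)
        simp only [Pi.one_apply]
        rw [ENNReal.ofReal_le_one, Real.exp_le_one_iff]
        linarith [potential_radialMode_nonneg g]
    _ = _ := withDensity_one

instance (N : ℕ) : IsFiniteMeasure (gibbs N) :=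
  isFiniteMeasure_of_le _ (gibbs_le_gaussianLaw N)

/-- Where V ≤ K the relative density is at least e^{-K}, so the comparison reverses at the price
e^K. The exceptional set involves V only and is estimated at time 0. -/
theorem gaussianLaw_le_gibbs (N : ℕ) {K : ℝ} (hK : 0 ≤ K) {S : Set (Fin N → ℂ)} (hS : MeasurableSet S) :
    gaussianLaw (Fin N) S ≤
      gaussianLaw (Fin N)
        {g | ENNReal.ofReal K < ENNReal.ofReal (potential radialFunctional radialMode g)}
      + ENNReal.ofReal (Real.exp K) * gibbs N S := by
  set V : Set (Fin N → ℂ) :=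
    {g | ENNReal.ofReal K < ENNReal.ofReal (potential radialFunctional radialMode g)} with hV
  have hVm : MeasurableSet V := measurableSet_lt measurable_const (measurable_potential N)
  refine (measure_le_inter_add_sdiff _ S V).trans (add_le_add (measure_mono Set.inter_subset_right) ?_)
  calc gaussianLaw (Fin N) (S \ V) = ∫⁻ _ in S \ V, 1 ∂gaussianLaw (Fin N) := by simp
    _ ≤ ∫⁻ g in S \ V, ENNReal.ofReal (Real.exp K) *
          ENNReal.ofReal (Real.exp (-potential radialFunctional radialMode g))
          ∂gaussianLaw (Fin N) := by
        refine setLIntegral_mono_ae' (hS.diff hVm) (Eventually.of_forall fun g hg => ?_)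
        have h1 : ¬ ENNReal.ofReal K < ENNReal.ofReal (potential radialFunctional radialMode g) :=
          hg.2
        rw [← ENNReal.ofReal_mul (Real.exp_pos _).le, ← Real.exp_add, ENNReal.one_le_ofReal,
          Real.one_le_exp_iff]
        rw [ENNReal.ofReal_lt_ofReal_iff'] at h1
        by_contra h2
        exact h1 ⟨by linarith, by linarith⟩
    _ = ENNReal.ofReal (Real.exp K) * gibbs N (S \ V) := by
        rw [lintegral_const_mul' _ _ ENNReal.ofReal_ne_top, gibbs_eq_withDensity,
          withDensity_apply _ (hS.diff hVm)]
    _ ≤ _ := mul_le_mul' le_rfl (measure_mono Set.sdiff_subset)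

/-- Moments of the time average of the Besov functional along the flow. -/
theorem lintegral_pow_flow_le {N : ℕ} {s α B T : ℝ} (hT : 0 < T)
    (hB : ∀ p : ℕ, ∫⁻ g : Fin N → ℂ, besov s α (cubicProfile g) ^ p ∂gaussianLaw (Fin N)
      ≤ ENNReal.ofReal (24 * B ^ p * (6 * p).factorial))
    {φ : ℝ → (Fin N → ℂ) → Fin N → ℂ} (hφ : Measurable (Function.uncurry φ))
    (hmp : ∀ t, MeasurePreserving (φ t) (gibbs N) (gibbs N)) :
    Measurable (fun g => ∫⁻ t in Set.Ioc 0 T, besov s α (cubicProfile (φ t g))) ∧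
    ∀ p : ℕ, ∫⁻ g, (∫⁻ t in Set.Ioc 0 T, besov s α (cubicProfile (φ t g))) ^ p ∂gibbs N
      ≤ ENNReal.ofReal (24 * (T * B) ^ p * (6 * p).factorial) := by
  have hbm := measurable_besov_cubicProfile s α N
  have hsw : Measurable fun q : (Fin N → ℂ) × ℝ => φ q.2 q.1 := hφ.comp measurable_swap
  have hm : Measurable (Function.uncurry fun (g : Fin N → ℂ) (t : ℝ) =>
      besov s α (cubicProfile (φ t g))) := hbm.comp hsw
  refine ⟨hm.lintegral_prod_right', fun p => ?_⟩
  obtain ⟨D, hD⟩ : ∃ D, D = ENNReal.ofReal (24 * B ^ p * (6 * p).factorial) := ⟨_, rfl⟩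
  have h := lintegral_pow_lintegral_le (gibbs N) (volume.restrict (Set.Ioc 0 T)) hm p (B := D) ?_ ?_
  · refine h.trans (le_of_eq ?_)
    rw [hD, Measure.restrict_apply_univ, Real.volume_Ioc, sub_zero,
      ← ENNReal.ofReal_pow hT.le, ← ENNReal.ofReal_mul (by positivity), mul_pow]
    congr 1
    ring
  · refine Eventually.of_forall fun t => ?_
    -- Invariance replaces the datum at time t by the datum at time 0, after which the Gibbs measure
    -- is dominated by the Gaussian law.
    rw [(hmp t).lintegral_comp (hbm.pow_const p), hD]
    exact (lintegral_mono' (gibbs_le_gaussianLaw N) le_rfl).trans (hB p)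
  · rintro rfl
    refine (gibbs_le_gaussianLaw N _).trans ?_
    rw [hD, measure_univ]
    simp

end GibbsBound

end BallNLS

namespace BallNLS

/-! ### Tail of the set of large data. -/

section Tail

/-- The initial data whose trajectory has a large Besov functional. -/
def largeData (s α T τ : ℝ) (N : ℕ) : Set (Fin N → ℂ) :=
  {g | ∃ y : ℝ → Fin N → ℂ, IsTrajectory y ∧ y 0 = g ∧ ENNReal.ofReal τ <
    ∑ i : Fin N, ENNReal.ofReal (((i : ℕ) + 1 : ℝ) ^ (2 * s - 2) * ‖g i‖ ^ 2) +
      ∫⁻ t in Set.Ioc 0 T, besov s α (cubicProfile (y t))}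

theorem gaussianLaw_largeData_le {N : ℕ} {s α B T τ K : ℝ} (hB0 : 0 < B) (hT : 0 < T) (hτ : 0 < τ)
    (hK : 0 ≤ K)
    (hB : ∀ p : ℕ, ∫⁻ g : Fin N → ℂ, besov s α (cubicProfile g) ^ p ∂gaussianLaw (Fin N)
      ≤ ENNReal.ofReal (24 * B ^ p * (6 * p).factorial)) :
    gaussianLaw (Fin N) (largeData s α T τ N) ≤
      gaussianLaw (Fin N) {g | ENNReal.ofReal (τ / 2) <
        ∑ i : Fin N, ENNReal.ofReal (((i : ℕ) + 1 : ℝ) ^ (2 * s - 2) * ‖g i‖ ^ 2)} +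
      (gaussianLaw (Fin N)
        {g | ENNReal.ofReal K < ENNReal.ofReal (potential radialFunctional radialMode g)} +
      ENNReal.ofReal (Real.exp K) * ENNReal.ofReal (24 * Real.exp 1 *
        Real.exp (-((τ / 2 / (Real.exp 1 * (T * B))) ^ (1 / (6 : ℕ) : ℝ) / (6 : ℕ))))) := by
  set E : (Fin N → ℂ) → ℝ := energy radialFunctional radialMode with hE
  set D := largeData s α T τ N with hD
  -- The invariant flow represents trajectories only up to energy R, so the set is exhausted by
  -- energy levels and bounded uniformly in R. Continuity from below along increasing sets needs no
  -- measurability of D.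
  have hU : D = ⋃ R : ℕ, D ∩ {g | E g ≤ R} := by
    rw [← Set.inter_iUnion]
    refine (Set.inter_eq_left.2 fun g _ => ?_).symm
    obtain ⟨R, hR⟩ := exists_nat_ge (E g)
    exact Set.mem_iUnion.2 ⟨R, hR⟩
  have hmono : Monotone fun R : ℕ => D ∩ {g | E g ≤ R} := fun a b hab =>
    Set.inter_subset_inter_right _ fun g (hg : E g ≤ a) =>
      show E g ≤ b from hg.trans (by exact_mod_cast hab)
  rw [hU, hmono.measure_iUnion]
  refine iSup_le fun R => ?_
  obtain ⟨φ, hφm, hφ, hφy⟩ := exists_gibbs_preserving_flow radialFunctional radialFunctional_star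
    star_radialMode potential_radialMode_nonneg (fun i : Fin N => freq i ^ 2)
    (integrable_exp_neg_energy N) R
  have hmp : ∀ t, MeasurePreserving (φ t) (gibbs N) (gibbs N) := fun t => (hφ t).smul_measure _
  obtain ⟨hXm, hXmom⟩ := lintegral_pow_flow_le hT hB hφm hmp
  set X : (Fin N → ℂ) → ℝ≥0∞ := fun g => ∫⁻ t in Set.Ioc 0 T, besov s α (cubicProfile (φ t g))
    with hX
  have hsub : D ∩ {g | E g ≤ R} ⊆ {g | ENNReal.ofReal (τ / 2) <
        ∑ i : Fin N, ENNReal.ofReal (((i : ℕ) + 1 : ℝ) ^ (2 * s - 2) * ‖g i‖ ^ 2)} ∪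
      {g | ENNReal.ofReal (τ / 2) < X g} := by
    rintro g ⟨⟨y, hy, rfl, hlt⟩, hER⟩
    have hyφ : ∫⁻ t in Set.Ioc 0 T, besov s α (cubicProfile (y t)) = X (y 0) := by
      simp only [hX]
      refine lintegral_congr fun t => ?_
      rw [← hφy y hy hER t]
    rw [hyφ] at hlt
    by_contra hcon
    simp only [Set.mem_union, Set.mem_ofPred_eq, not_or, not_lt] at hcon
    refine absurd hlt (not_lt.2 ((add_le_add hcon.1 hcon.2).trans (le_of_eq ?_)))
    rw [← ENNReal.ofReal_add (by positivity) (by positivity), add_halves]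
  refine (measure_mono hsub).trans ((measure_union_le _ _).trans (add_le_add le_rfl ?_))
  refine (gaussianLaw_le_gibbs N hK (measurableSet_lt measurable_const hXm)).trans
    (add_le_add le_rfl (mul_le_mul' le_rfl ?_))
  exact measure_lt_le_of_lintegral_pow_le (gibbs N) (by norm_num) (by norm_num) (by positivity) hXm
    hXmom (by positivity)

theorem rpow_one_div_mul_sq {a lam : ℝ} (ha : 0 ≤ a) (hlam : 0 ≤ lam) (k : ℝ) :
    (a * lam ^ 2) ^ (1 / k) = a ^ (1 / k) * lam ^ (2 / k) := by
  rw [Real.mul_rpow ha (by positivity), ← Real.rpow_natCast, ← Real.rpow_mul hlam]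
  congr 2
  push_cast
  ring

/-- Stretched exponential tail of the set of large data, uniform in the truncation. -/
theorem exists_gaussianLaw_largeData_le {s α T C₀ : ℝ} (hs : 0 ≤ s) (hs1 : s < 1 / 2)
    (hα : ∃ θ, 2 * s < θ ∧ θ ≤ 1 ∧ θ < α) (hT : 0 < T) (hC₀ : 0 < C₀) :
    ∃ c : ℝ, 0 < c ∧ ∀ (N : ℕ) (lam : ℝ), 1 ≤ lam →
      gaussianLaw (Fin N) (largeData s α T (lam ^ 2 / C₀) N)
        ≤ ENNReal.ofReal (40 * Real.exp 1 * Real.exp (-(c * lam ^ (1 / 12 : ℝ)))) := by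
  obtain ⟨θ, hθ, hθ1, hθα⟩ := hα
  obtain ⟨B, hB0, hB⟩ := exists_lintegral_pow_besov_le hs hθ hθ1 hθα
  obtain ⟨B₁, hB₁0, hB₁⟩ := exists_lintegral_pow_sum_sq_le hs1
  have he := Real.exp_pos 1
  set a : ℝ := 1 / (2 * C₀ * (Real.exp 1 * (T * B))) with ha
  set a₁ : ℝ := 1 / (2 * C₀ * (Real.exp 1 * B₁)) with ha₁
  have ha0 : 0 < a := by positivity
  have ha₁0 : 0 < a₁ := by positivity
  -- The Gibbs tail at level λ²/(2C₀) has exponent 2κλ^{1/3}. Taking K = κλ^{1/3}, the factor e^K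
  -- consumes half of it. The slowest contribution is then that of V > K, of order K^{1/4}, whence
  -- the power 1/12.
  set κ : ℝ := a ^ (1 / 6 : ℝ) / 12 with hκ
  have hκ0 : 0 < κ := by positivity
  set c₂ : ℝ := (κ / (Real.exp 1 * 6 ^ 4)) ^ (1 / 4 : ℝ) / 4 with hc₂
  have hc₂0 : 0 < c₂ := by positivity
  set c₃ : ℝ := a₁ ^ (1 / 2 : ℝ) / 2 with hc₃
  have hc₃0 : 0 < c₃ := by positivity
  set c : ℝ := min κ (min c₂ c₃) with hc
  have hcκ : c ≤ κ := min_le_left _ _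
  have hcc₂ : c ≤ c₂ := (min_le_right _ _).trans (min_le_left _ _)
  have hcc₃ : c ≤ c₃ := (min_le_right _ _).trans (min_le_right _ _)
  have hc0 : 0 < c := lt_min hκ0 (lt_min hc₂0 hc₃0)
  refine ⟨c, hc0, fun N lam hlam => ?_⟩
  have hlam0 : 0 < lam := by linarith
  have hτ : 0 < lam ^ 2 / C₀ := by positivity
  have hp : ∀ r : ℝ, 1 / 12 ≤ r → ∀ c' : ℝ, c ≤ c' →
      Real.exp (-(c' * lam ^ r)) ≤ Real.exp (-(c * lam ^ (1 / 12 : ℝ))) := by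
    intro r hr c' hc'
    refine Real.exp_le_exp.2 (neg_le_neg ?_)
    have := Real.rpow_le_rpow_of_exponent_le hlam hr
    gcongr
    linarith
  have hK0 : 0 < κ * lam ^ (1 / 3 : ℝ) := by positivity
  have hmain := gaussianLaw_largeData_le (N := N) (s := s) (α := α) (B := B) (T := T) hB0 hT hτ
    hK0.le (hB N)
  have hR1m : Measurable fun g : Fin N → ℂ =>
      ∑ i : Fin N, ENNReal.ofReal (((i : ℕ) + 1 : ℝ) ^ (2 * s - 2) * ‖g i‖ ^ 2) := by
    fun_prop
  have hR1 := measure_lt_le_of_lintegral_pow_le (gaussianLaw (Fin N)) (k := 2) (by norm_num)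
    (A := 8) (by norm_num) hB₁0 hR1m (hB₁ N) (half_pos hτ)
  have hVmom : ∀ p : ℕ, ∫⁻ g, ENNReal.ofReal (potential radialFunctional radialMode g) ^ p
      ∂gaussianLaw (Fin N) ≤ ENNReal.ofReal (8 * (6 ^ 4) ^ p * (4 * p).factorial) := by
    intro p
    simp_rw [ofReal_potential_radialMode]
    exact lintegral_pow_quartic_le N p
  have hV := measure_lt_le_of_lintegral_pow_le (gaussianLaw (Fin N)) (k := 4) (by norm_num)
    (A := 8) (B := 6 ^ 4) (by norm_num) (by norm_num) (measurable_potential N) hVmom hK0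
  have e1 : (lam ^ 2 / C₀ / 2 / (Real.exp 1 * (T * B))) ^ (1 / (6 : ℕ) : ℝ) / (6 : ℕ)
      = 2 * κ * lam ^ (1 / 3 : ℝ) := by
    have e : lam ^ 2 / C₀ / 2 / (Real.exp 1 * (T * B)) = a * lam ^ 2 := by
      rw [ha]; field_simp
    rw [e, rpow_one_div_mul_sq ha0.le hlam0.le, hκ]
    norm_num
    ring
  have e2 : (lam ^ 2 / C₀ / 2 / (Real.exp 1 * B₁)) ^ (1 / (2 : ℕ) : ℝ) / (2 : ℕ)
      = c₃ * lam ^ (1 : ℝ) := by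
    have e : lam ^ 2 / C₀ / 2 / (Real.exp 1 * B₁) = a₁ * lam ^ 2 := by
      rw [ha₁]; field_simp
    rw [e, rpow_one_div_mul_sq ha₁0.le hlam0.le, hc₃]
    norm_num
    ring
  have e3 : (κ * lam ^ (1 / 3 : ℝ) / (Real.exp 1 * 6 ^ 4)) ^ (1 / (4 : ℕ) : ℝ) / (4 : ℕ)
      = c₂ * lam ^ (1 / 12 : ℝ) := by
    have e : κ * lam ^ (1 / 3 : ℝ) / (Real.exp 1 * 6 ^ 4)
        = κ / (Real.exp 1 * 6 ^ 4) * lam ^ (1 / 3 : ℝ) := by ring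
    rw [e, Real.mul_rpow (by positivity) (by positivity), ← Real.rpow_mul hlam0.le, hc₂]
    norm_num
    ring
  rw [e1] at hmain
  rw [e2] at hR1
  rw [e3] at hV
  refine hmain.trans ((add_le_add hR1 (add_le_add hV le_rfl)).trans ?_)
  -- The constant 40 is 8 + 8 + 24, from the initial datum, the potential and the Besov functional.
  rw [← ENNReal.ofReal_mul (Real.exp_pos _).le, ← ENNReal.ofReal_add (by positivity) (by positivity),
    ← ENNReal.ofReal_add (by positivity) (by positivity)]
  refine ENNReal.ofReal_le_ofReal ?_
  have e4 : Real.exp (κ * lam ^ (1 / 3 : ℝ)) *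
      (24 * Real.exp 1 * Real.exp (-(2 * κ * lam ^ (1 / 3 : ℝ))))
      = 24 * Real.exp 1 * Real.exp (-(κ * lam ^ (1 / 3 : ℝ))) := by
    rw [mul_left_comm, ← Real.exp_add]
    congr 2
    ring
  rw [e4]
  have h1 := hp 1 (by norm_num) c₃ hcc₃
  have h2 := hp (1 / 12) le_rfl c₂ hcc₂
  have h3 := hp (1 / 3) (by norm_num) κ hcκ
  nlinarith

theorem coeFn_sum_smul_eigenL2 {N : ℕ} (g : Fin N → ℂ) :
    (∑ i : Fin N, (g i / (((i : ℕ) + 1) * Real.pi : ℂ)) • eigenL2 ((i : ℕ) + 1) : L2Ball)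
      =ᵐ[ballMeasure] fun x => radialSum g ‖x‖ := by
  have h1 : ∀ i : Fin N, ((g i / (((i : ℕ) + 1) * Real.pi : ℂ)) • eigenL2 ((i : ℕ) + 1) : L2Ball)
      =ᵐ[ballMeasure] fun x => g i * (Real.sinc (freq i * ‖x‖) : ℂ) := by
    intro i
    have hω : (((i : ℕ) + 1) * Real.pi : ℂ) ≠ 0 :=
      mul_ne_zero (by exact_mod_cast (i : ℕ).succ_ne_zero) (by exact_mod_cast Real.pi_ne_zero)
    filter_upwards [Lp.coeFn_smul (g i / (((i : ℕ) + 1) * Real.pi : ℂ)) (eigenL2 ((i : ℕ) + 1)),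
      (memLp_eigenfunction ((i : ℕ) + 1)).coeFn_toLp] with x hx1 hx2
    rw [hx1, Pi.smul_apply, eigenL2, hx2, eigenfunction_eq_freq, smul_eq_mul, freq]
    push_cast
    field_simp
  refine (Lp.coeFn_fun_finsetSum _ _).trans ?_
  filter_upwards [ae_all_iff.2 h1] with x hx
  rw [radialSum]
  exact Finset.sum_congr rfl fun i _ => hx i

/-- An injective linear map from a finite-dimensional space is a closed embedding. The push-forward
can thus be evaluated on arbitrary sets, so the exceptional set of data need not be shown
measurable. -/
theorem measurableEmbedding_sum_smul_eigenL2 (N : ℕ) :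
    MeasurableEmbedding fun g : Fin N → ℂ =>
      (∑ i : Fin N, (g i / (((i : ℕ) + 1) * Real.pi : ℂ)) • eigenL2 ((i : ℕ) + 1) : L2Ball) := by
  let L : (Fin N → ℂ) →ₗ[ℂ] L2Ball :=
    { toFun := fun g => ∑ i : Fin N, (g i / (((i : ℕ) + 1) * Real.pi : ℂ)) • eigenL2 ((i : ℕ) + 1)
      map_add' := fun g h => by
        simp only [Pi.add_apply, add_div, add_smul, Finset.sum_add_distrib]
      map_smul' := fun c g => by
        simp only [Pi.smul_apply, smul_eq_mul, mul_div_assoc, mul_smul, Finset.smul_sum,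
          RingHom.id_apply] }
  have hL : Function.Injective L := by
    intro g h hgh
    have h1 := coeFn_sum_smul_eigenL2 g
    have h2 := coeFn_sum_smul_eigenL2 h
    change L g =ᵐ[ballMeasure] _ at h1
    change L h =ᵐ[ballMeasure] _ at h2
    rw [hgh] at h1
    funext i
    have h3 := (coeff_radial i h1).symm.trans (coeff_radial i h2)
    rw [integral_radialSum_mul_sin, integral_radialSum_mul_sin] at h3
    have hω : (freq i : ℂ) ≠ 0 := by exact_mod_cast (freq_pos i).ne'
    field_simp at h3
    exact h3
  exact (LinearMap.isClosedEmbedding_of_injective (LinearMap.ker_eq_bot.2 hL)).measurableEmbedding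

end Tail

end BallNLS

/-! ### Choice of the parameters and conclusion. -/

theorem proposition6 (s b T : ℝ) (hs₀ : 0 ≤ s) (hs₁ : s < 1 / 2)
    (hb₀ : 1 / 2 < b) (hb₁ : b < 3 / 4) (hT₀ : 0 < T) (hT₁ : T < 2 / Real.pi) :
    ∃ C c₁ c₂ : ℝ, 0 < C ∧ 0 < c₁ ∧ 0 < c₂ ∧
      ∀ N : ℕ, 0 < N → ∀ lam : ℝ, 0 < lam →
        BallNLS.freeMeasure N
            {φ : BallNLS.L2Ball | ∃ u : ℝ → BallNLS.E3 → ℂ,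
              BallNLS.IsTruncatedSolution N φ u ∧
                ENNReal.ofReal lam < BallNLS.xsbNorm s b T u}
          ≤ ENNReal.ofReal (C * Real.exp (-(c₁ * lam ^ c₂))) := by
  -- The chain 2s < θ < α < 1 exists exactly because s < 1/2.
  obtain ⟨θ, hθ, hθ1⟩ := exists_between (show 2 * s < 1 by linarith)
  obtain ⟨α, hα, hα1⟩ := exists_between hθ1
  obtain ⟨C₀, hC₀, hnorm⟩ := BallNLS.exists_xsbNorm_sq_le hs₀ hb₀ hb₁ hT₀ hT₁ hα1
  obtain ⟨c, hc, htail⟩ := BallNLS.exists_gaussianLaw_largeData_le hs₀ hs₁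
    ⟨θ, hθ, hθ1.le, hα⟩ hT₀ hC₀
  -- The summand e^c makes the right side at least 1 when λ < 1, where the bound is trivial for a
  -- probability measure.
  refine ⟨40 * Real.exp 1 + Real.exp c, c, 1 / 12, by positivity, hc, by norm_num,
    fun N _ lam hlam => ?_⟩
  rw [BallNLS.freeMeasure, (BallNLS.measurableEmbedding_sum_smul_eigenL2 N).map_apply]
  change BallNLS.gaussianLaw (Fin N) _ ≤ _
  rcases le_or_gt 1 lam with h1 | h1
  · refine (measure_mono ?_).trans ((htail N lam h1).trans (ENNReal.ofReal_le_ofReal ?_))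
    · rintro g ⟨u, hu, hlt⟩
      obtain ⟨y, hy0, hy, huy⟩ := hu.exists_hamiltonian (BallNLS.coeFn_sum_smul_eigenL2 g)
      have h := hnorm N y u hy huy
      refine ⟨y, hy, hy0, ?_⟩
      rw [hy0] at h
      have h2 : ENNReal.ofReal (lam ^ 2) < BallNLS.xsbNorm s b T u ^ 2 := by
        rw [ENNReal.ofReal_pow hlam.le]
        exact ENNReal.pow_lt_pow_left two_ne_zero hlt
      have h3 := h2.trans_le h
      have h4 : ENNReal.ofReal (lam ^ 2) = ENNReal.ofReal C₀ * ENNReal.ofReal (lam ^ 2 / C₀) := by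
        rw [← ENNReal.ofReal_mul hC₀.le]
        congr 1
        field_simp
      rw [h4] at h3
      exact lt_of_mul_lt_mul_left' h3
    · gcongr
      linarith [Real.exp_pos c]
  · refine prob_le_one.trans ?_
    rw [ENNReal.one_le_ofReal]
    have h2 : lam ^ (1 / 12 : ℝ) ≤ 1 := Real.rpow_le_one hlam.le h1.le (by norm_num)
    have h3 : Real.exp (-c) ≤ Real.exp (-(c * lam ^ (1 / 12 : ℝ))) :=
      Real.exp_le_exp.2 (by nlinarith)
    have h4 : Real.exp c * Real.exp (-c) = 1 := by rw [← Real.exp_add]; simp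
    have h5 := Real.exp_pos 1
    have h6 := Real.exp_pos c
    have h7 := Real.exp_pos (-c)
    calc (1 : ℝ) = Real.exp c * Real.exp (-c) := h4.symm
      _ ≤ (40 * Real.exp 1 + Real.exp c) * Real.exp (-(c * lam ^ (1 / 12 : ℝ))) := by
          gcongr
          linarith
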